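/- Let $\mathfrak E_1$ be the class of (formal) singular second order ODEs $$\mathcal E_\Phi:\qquad w''=w\,\Phi\Bigl(z,w,\frac{w'}{w}\Bigr),\qquad \Phi(z,w,\zeta)=\sum_{a,b\ge 0,\;c\ge 2}\Phi_{a,b,c}\,z^aw^b\zeta^c\in\mathbb C[[z,w,\zeta]],$$ and let $\mathfrak D_1\subset\mathfrak E_1$ (the normal forms) be the class of those with $$\Phi_{0,j,2}=\Phi_{1,j,2}=\Phi_{0,j,3}=\Phi_{1,j,3}=0\qquad\text{for all } j>0 .$$ For $\mathcal E,\mathcal E'\in\mathfrak E_1$ let $\operatorname{Hom}(\mathcal E,\mathcal E')$ be the set of formal maps $(z,w)\mapsto(F(z,w),G(z,w))$ that transform graphs of solutions of $\mathcal E$ into graphs of solutions of $\mathcal E'$ (as a formal identity in the free variables $z,w,\zeta=w'/w$) and are normalized by $$F=z+f(z,w),\quad G=w+w\,g_0(w)+w\,g(z,w),\quad f(0,0)=f_z(0,0)=0,\ g_0(0)=0,\ g(z,w)=O(zw).$$ Put $\alpha_j=\Phi_{j,0,2}$, $\beta_j=\Phi_{j,0,3}$, $\gamma_j=\Phi_{j,0,4}$.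 For a map of a normal form into $\mathcal E_\Phi$ the Cauchy data $H=(g_0,g_1,f_0,f_1)$, where $f_0(w)=F(0,w)$, $f_1(w)=F_z(0,w)-1$, $w g_0(w)=G(0,w)-w$, $w g_1(w)=G_z(0,w)$, satisfy a system $w^2H''=T(w,H,wH')$ with $T=0$ at the origin, determined by $\Phi$. The equation $\mathcal E_\Phi$ is called non-resonant if the linearization matrix at the origin of the corresponding first order system for $(H,wH')$, $$\mathbf M=\begin{pmatrix}0&I\\ T_H& I+T_G\end{pmatrix},$$ $$T_H=\begin{pmatrix}0&3\beta_0&\alpha_1&0\\0&-\beta_1&-\tfrac23\alpha_2&-\tfrac13\alpha_1\\0&-4\gamma_0&-\beta_1&\beta_0\\0&-2\beta_0(\alpha_0-1)-4\gamma_1&-2\beta_2&0\end{pmatrix},\qquad T_G=\begin{pmatrix}\alpha_0-2&0&0&2\\-\tfrac13\alpha_1&\alpha_0-2&0&0\\-2\beta_0&0&-\alpha_0&0\\-2\beta_1&0&-\alpha_1&-\alpha_0\end{pmatrix},$$ has no positive integer eigenvalue. Theorem. Let $\mathcal E\in\mathfrak E_1$ be non-resonant. Then there is a unique $\mathcal N\in\mathfrak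 D_1$ with $\operatorname{Hom}(\mathcal N,\mathcal E)\ne\emptyset$, and for this $\mathcal N$ the set $\operatorname{Hom}(\mathcal N,\mathcal E)$ has exactly one element. If moreover $\mathcal E$ is convergent (i.e. the power series $\Phi$ converges near the origin), then $\mathcal N$ and both components of the normalizing transformation are convergent. -/

import Mathlib

noncomputable section

namespace SingODE

/-- Formal power series in the two variables `z = X 0`, `w = X 1`. -/
abbrev Series2 := MvPowerSeries (Fin 2) ℂ

/-- Formal power series in the three variables `z = X 0`, `w = X 1`, `ζ = X 2`. -/
abbrev Series3 := MvPowerSeries (Fin 3) ℂ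

/-- The exponent of the monomial `z ^ a * w ^ b * ζ ^ c`. -/
def expo (a b c : ℕ) : Fin 3 →₀ ℕ := Finsupp.equivFunOnFinite.symm ![a, b, c]

/-- The coefficient `Φ_{a,b,c}` of `z ^ a * w ^ b * ζ ^ c` in `Φ`. -/
def cf (Φ : Series3) (a b c : ℕ) : ℂ := MvPowerSeries.coeff (expo a b c) Φ

/-- A formal power series is convergent if it converges absolutely on some polydisc
of positive radius about the origin. -/
def Convergent {n : ℕ} (f : MvPowerSeries (Fin n) ℂ) : Prop :=
  ∃ r : ℝ, 0 < r ∧ Summable fun d : Fin n →₀ ℕ => ‖MvPowerSeries.coeff d f‖ * r ^ d.degree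

/-- The class `𝔈₁` of (formal) singular equations `w'' = w Φ(z, w, w'/w)`, identified with the
right-hand sides `Φ ∈ ℂ⟦z,w,ζ⟧`, `Φ = O(ζ²)`. -/
def ODE1 : Set Series3 := {Φ | (MvPowerSeries.X 2 : Series3) ^ 2 ∣ Φ}

/-- The space `𝔇₁` of normal forms: `Φ = O(ζ²)` and
`Φ_{0,j,2} = Φ_{1,j,2} = Φ_{0,j,3} = Φ_{1,j,3} = 0` for all `j > 0`. -/
def NF1 : Set Series3 :=
  {Φ | Φ ∈ ODE1 ∧ ∀ j : ℕ, 0 < j →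
    cf Φ 0 j 2 = 0 ∧ cf Φ 1 j 2 = 0 ∧ cf Φ 0 j 3 = 0 ∧ cf Φ 1 j 3 = 0}

/-- A series in `(z, w)` regarded as a series in `(z, w, ζ)`. -/
def lift (f : Series2) : Series3 := MvPowerSeries.rename (Fin.castSucc : Fin 2 → Fin 3) f

/-- The derivative `d/dz` along the solutions of `w'' = w Φ(z, w, w'/w)`, in the coordinates
`(z, w, ζ)` with `ζ = w'/w`: one has `w' = w ζ` and
`ζ' = w''/w - (w'/w)² = Φ(z, w, ζ) - ζ²`. -/
def totalDeriv (Φ : Series3) (A : Series3) : Series3 :=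
  MvPowerSeries.pderiv ℂ 0 A
    + MvPowerSeries.X 1 * MvPowerSeries.X 2 * MvPowerSeries.pderiv ℂ 1 A
    + (Φ - MvPowerSeries.X 2 ^ 2) * MvPowerSeries.pderiv ℂ 2 A

/-- The formal map `H = (F, G)` is normalized:
`F = z + f(z,w)` with `f(0,0) = 0`, `f_z(0,0) = 0`, and `G = w + w g₀(w) + w g(z,w)` with
`g₀(0) = 0`, `g = O(zw)`. The two conditions on `g₀`, `g` say together exactly that
`g₀(w) + g(z,w)` is an arbitrary multiple of `w`, i.e. that `w²` divides `G - w`. In particular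
the linear part of `H` at `0` is invertible. -/
def Normalized (F G : Series2) : Prop :=
  MvPowerSeries.constantCoeff F = 0 ∧
  MvPowerSeries.coeff (Finsupp.single (0 : Fin 2) 1) F = 1 ∧
  (MvPowerSeries.X 1 : Series2) ^ 2 ∣ G - MvPowerSeries.X 1

/-- `H = (F, G)` transforms the graphs of solutions of `w'' = w Φ(z, w, w'/w)` into graphs of
solutions of `w'' = w Ψ(z, w, w'/w)`. With `D` the derivative along the solutions of the first
equation, the image of the graph of a solution has slope `W' = D G / D F` and second derivative
`W'' = D (W') / D F`. Writing `W' = G * Z`, the requirement is `W'' = G * Ψ(F, G, W' / G)`, an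
identity in the free variables `z, w, ζ`. For normalized `(F, G)` the series `Z` exists, is unique
and has no constant term. -/
def Transforms (Φ Ψ : Series3) (F G : Series2) : Prop :=
  ∃ Z : Series3,
    totalDeriv Φ (lift G) = totalDeriv Φ (lift F) * (lift G * Z) ∧
    totalDeriv Φ (lift G * Z) =
      totalDeriv Φ (lift F) * (lift G * MvPowerSeries.subst ![lift F, lift G, Z] Ψ)

/-- `Hom(Φ, Ψ)`: the normalized formal maps `(F, G)` which transform the equation given by `Φ`
into the equation given by `Ψ`. -/
def Hom (Φ Ψ : Series3) : Set (Series2 × Series2) :=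
  {H | Normalized H.1 H.2 ∧ Transforms Φ Ψ H.1 H.2}

/-!
The Cauchy data of a map `(F, G)` as above are
`f₀ = F(0,w)`, `f₁ = F_z(0,w) - 1`, `g₀ = G(0,w)/w - 1`, `g₁ = G_z(0,w)/w`. If `(F, G)` maps a normal
form into the equation given by `Φ`, they satisfy a system
`w² H'' = T(w, H, w H')`, `H = (g₀, g₁, f₀, f₁)`, `T = 0` at the origin, which is obtained by
equating to constants the coefficients of `z⁰ζ², z¹ζ², z⁰ζ³, z¹ζ³` in the right-hand side of the
transformation rule (the coefficients of `z⁰ζ⁰`, `z⁰ζ¹` being used to eliminate the coefficients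
of `z²` in `F`, `G`). With `αⱼ = Φ_{j,0,2}`, `βⱼ = Φ_{j,0,3}`, `γⱼ = Φ_{j,0,4}`, its linear part in
`(H, w H')` at `w = 0` is equivalent to
`w²g₀'' + (2 - α₀) w g₀' - 2 w f₁' - 3 β₀ g₁ - α₁ f₀ = 0`,
`3 w²g₁'' + α₁ w g₀' + (6 - 3 α₀) w g₁' + 3 β₁ g₁ + 2 α₂ f₀ + α₁ f₁ = 0`,
`w²f₀'' + 2 β₀ w g₀' + α₀ w f₀' + 4 γ₀ g₁ + β₁ f₀ - β₀ f₁ = 0`,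
`w²f₁'' + 2 β₁ w g₀' + α₁ w f₀' + α₀ w f₁' + (2 β₀ (α₀ - 1) + 4 γ₁) g₁ + 2 β₂ f₀ = 0`.
-/

/-- The matrix `∂T/∂H` at the origin; the order of the unknowns is `(g₀, g₁, f₀, f₁)`. -/
def TH (Φ : Series3) : Matrix (Fin 4) (Fin 4) ℂ :=
  let α := fun j : ℕ => cf Φ j 0 2
  let β := fun j : ℕ => cf Φ j 0 3
  let γ := fun j : ℕ => cf Φ j 0 4
  !![0, 3 * β 0, α 1, 0;
     0, -β 1, -(2 / 3) * α 2, -(1 / 3) * α 1;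
     0, -4 * γ 0, -β 1, β 0;
     0, -(2 * β 0 * (α 0 - 1) + 4 * γ 1), -2 * β 2, 0]

/-- The matrix `∂T/∂(wH')` at the origin; the order of the unknowns is `(g₀, g₁, f₀, f₁)`. -/
def TG (Φ : Series3) : Matrix (Fin 4) (Fin 4) ℂ :=
  let α := fun j : ℕ => cf Φ j 0 2
  let β := fun j : ℕ => cf Φ j 0 3
  !![α 0 - 2, 0, 0, 2;
     -(1 / 3) * α 1, α 0 - 2, 0, 0;
     -2 * β 0, 0, -α 0, 0;
     -2 * β 1, 0, -α 1, -α 0]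

/-- The linearization matrix at the origin of the first order system
`w 𝐇' = 𝐓(w, 𝐇)` for `𝐇 = (H, w H')`. -/
def linMatrix (Φ : Series3) : Matrix (Fin 4 ⊕ Fin 4) (Fin 4 ⊕ Fin 4) ℂ :=
  Matrix.fromBlocks 0 1 (TH Φ) (1 + TG Φ)

/-- The equation is non-resonant if the linearization matrix has no positive integer eigenvalue. -/
def NonResonant (Φ : Series3) : Prop :=
  ∀ k : ℕ, 0 < k → ¬ Module.End.HasEigenvalue (Matrix.toLin' (linMatrix Φ)) (k : ℂ)

end SingODE

end

/-! Write a map as `F = z + f`, `G = w (1 + u)`, with `u` divisible by `w` by normalization. If both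
equations vanish to second order in `ζ`, comparing coefficients of `ζ` at `w = 0` gives `f_zz(z,0) =
0`, so `f` is divisible by `w` as well (`exists_of_mem_hom`). The second total derivatives of `F`
and `G` are affine in the right-hand side `N` of the source equation, and the resulting coefficient
of `N` is a unit. Hence `N` is an explicit function of the 2-jet of `(f, u)`: it is `jetSource Φ`
evaluated at `jetVars f u` (`transforms_iff`). Every map thus has exactly one source, and the
theorem says that exactly one `(f, u)` makes this source a normal form.

Split `jetSource` into `jetLinear`, its part of order at most one in the jets at `w = 0`, and a
remainder in `nonlinIdeal`, each of whose terms contains `w` or two jet factors. Since all jets are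
divisible by `w`, the coefficient of `w^k` of the remainder depends only on lower coefficients of
`(f, u)` (`cf_nonlin_congr`), whereas the linear part preserves the degree in `w`. So the normal
form conditions become linear equations for each `k > 0`. The coefficients of `ζ^0` and `ζ^1`
determine `u_zz` and `f_zz`, leaving four unknowns, the Cauchy data. Those of `ζ^2` and `ζ^3` at
`z^0, z^1` give four equations with matrix `k^2 - k (1 + T_G) - T_H` (`levelEq_iff`). A kernel
vector `v` yields the eigenvector `(v, k v)` of the linearization matrix with eigenvalue `k`.
Non-resonance therefore allows a unique recursive solution.

Convergence is an a priori estimate for this solution. In a weighted `ℓ¹` norm with weights `r^i ρ^k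
/ binom(i+k, i)`, the operator `w ∂_w` is bounded by `∂_z` and the restriction to `z = 0`. Together
with the gain of powers of `k` from the inverse level matrices, this shows that the linear problem
gains two derivatives, with a constant independent of `ρ` (`exists_jetNorm_bound`). The remainder is
`O(ρ + e^2)` on jets of size `e` (`wnorm_subst_nonlin_le`), so for small `e` and `ρ` proportional to
`e^2` a fixed bound passes from each truncation in `w` to the next, and then to the full solution
(`IsNormalizing.convergent`). -/

noncomputable section
namespace SingODE
open scoped ENNReal NNReal
open MvPowerSeries (coeff constantCoeff subst HasSubst X)

/-! ### Weighted `ℓ¹` norms of power series -/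

section WeightedNorm
variable {σ τ : Type*}

/-- The weighted `ℓ¹` norm of a power series. -/
def wnorm (W : (σ →₀ ℕ) → ℝ≥0∞) (f : MvPowerSeries σ ℂ) : ℝ≥0∞ := ∑' d, ‖coeff d f‖ₑ * W d

/-- Weights for which the weighted norm is submultiplicative. -/
structure IsSubmul (W : (σ →₀ ℕ) → ℝ≥0∞) : Prop where
  zero_le_one : W 0 ≤ 1
  add_le : ∀ d e, W (d + e) ≤ W d * W e

variable {W : (σ →₀ ℕ) → ℝ≥0∞}

theorem wnorm_mono {f g : MvPowerSeries σ ℂ} (h : ∀ d, ‖coeff d f‖ₑ ≤ ‖coeff d g‖ₑ) :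
    wnorm W f ≤ wnorm W g :=
  ENNReal.tsum_le_tsum fun d => mul_le_mul_left (h d) _

theorem wnorm_zero : wnorm W (0 : MvPowerSeries σ ℂ) = 0 := by simp [wnorm]

theorem wnorm_neg (f : MvPowerSeries σ ℂ) : wnorm W (-f) = wnorm W f := by simp [wnorm]

theorem wnorm_add_le (f g : MvPowerSeries σ ℂ) : wnorm W (f + g) ≤ wnorm W f + wnorm W g := by
  rw [wnorm, wnorm, wnorm, ← ENNReal.tsum_add]
  refine ENNReal.tsum_le_tsum fun d => ?_
  rw [map_add, ← add_mul]
  exact mul_le_mul_left (enorm_add_le _ _) _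

theorem wnorm_sub_le (f g : MvPowerSeries σ ℂ) : wnorm W (f - g) ≤ wnorm W f + wnorm W g := by
  rw [sub_eq_add_neg, ← wnorm_neg g]; exact wnorm_add_le _ _

theorem wnorm_monomial (d : σ →₀ ℕ) (a : ℂ) :
    wnorm W (MvPowerSeries.monomial d a) = ‖a‖ₑ * W d := by
  classical
  rw [wnorm, tsum_eq_single d]
  · simp
  · intro e he
    rw [MvPowerSeries.coeff_monomial, if_neg he]; simp

theorem wnorm_X (i : σ) : wnorm W (X i : MvPowerSeries σ ℂ) = W (Finsupp.single i 1) := by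
  rw [MvPowerSeries.X_def, wnorm_monomial]; simp

theorem wnorm_one_le (hW : IsSubmul W) : wnorm W (1 : MvPowerSeries σ ℂ) ≤ 1 := by
  rw [← MvPowerSeries.monomial_zero_one, wnorm_monomial]; simpa using hW.zero_le_one

theorem wnorm_mul_le (hW : IsSubmul W) (f g : MvPowerSeries σ ℂ) :
    wnorm W (f * g) ≤ wnorm W f * wnorm W g := by
  classical
  have key : ∀ n, ‖coeff n (f * g)‖ₑ * W n ≤ ∑ p ∈ Finset.HasAntidiagonal.antidiagonal n,
      (‖coeff p.1 f‖ₑ * W p.1) * (‖coeff p.2 g‖ₑ * W p.2) := by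
    intro n
    rw [MvPowerSeries.coeff_mul]
    refine (mul_le_mul_left (enorm_sum_le _ _) _).trans ?_
    rw [Finset.sum_mul]
    refine Finset.sum_le_sum fun p hp => ?_
    rw [Finset.HasAntidiagonal.mem_antidiagonal] at hp
    rw [enorm_mul, mul_mul_mul_comm]
    exact mul_le_mul_right (hp ▸ hW.add_le _ _) _
  refine (ENNReal.tsum_le_tsum key).trans_eq ?_
  have h1 : ∀ n : σ →₀ ℕ, ∑ p ∈ Finset.HasAntidiagonal.antidiagonal n,
      (‖coeff p.1 f‖ₑ * W p.1) * (‖coeff p.2 g‖ₑ * W p.2) =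
      ∑' p : Finset.HasAntidiagonal.antidiagonal n,
      (‖coeff p.1.1 f‖ₑ * W p.1.1) * (‖coeff p.1.2 g‖ₑ * W p.1.2) := by
    intro n
    rw [tsum_fintype, ← Finset.sum_coe_sort]
  simp_rw [h1]
  rw [← ENNReal.tsum_sigma (β := fun n : σ →₀ ℕ => Finset.HasAntidiagonal.antidiagonal n)
    (fun _ p => (‖coeff p.1.1 f‖ₑ * W p.1.1) * (‖coeff p.1.2 g‖ₑ * W p.1.2)),
    ← Finset.HasAntidiagonal.sigmaAntidiagonalEquivProd.symm.tsum_eq, ENNReal.tsum_prod']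
  simp only [Finset.HasAntidiagonal.sigmaAntidiagonalEquivProd_symm_apply_snd_coe]
  simp_rw [ENNReal.tsum_mul_left, ENNReal.tsum_mul_right]
  rfl

theorem wnorm_pow_le (hW : IsSubmul W) (f : MvPowerSeries σ ℂ) (n : ℕ) :
    wnorm W (f ^ n) ≤ wnorm W f ^ n := by
  induction n with
  | zero => simpa using wnorm_one_le hW
  | succ n ih =>
    rw [pow_succ, pow_succ]
    exact (wnorm_mul_le hW _ _).trans (mul_le_mul_left ih _)

theorem wnorm_prod_le {ι : Type*} (hW : IsSubmul W) (s : Finset ι) (f : ι → MvPowerSeries σ ℂ) :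
    wnorm W (∏ i ∈ s, f i) ≤ ∏ i ∈ s, wnorm W (f i) := by
  classical
  induction s using Finset.induction_on with
  | empty => simpa using wnorm_one_le hW
  | insert a s ha ih =>
    rw [Finset.prod_insert ha, Finset.prod_insert ha]
    exact (wnorm_mul_le hW _ _).trans (mul_le_mul_right ih _)

/-- Triangle inequality over the monomials of `f`, exchange of the two sums, and
submultiplicativity. With values in `ℝ≥0∞` no summability has to be known beforehand. -/
theorem wnorm_subst_le [Finite τ] (hW : IsSubmul W) {a : τ → MvPowerSeries σ ℂ} (ha : HasSubst a)
    (f : MvPowerSeries τ ℂ) :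
    wnorm W (subst a f) ≤ ∑' d : τ →₀ ℕ, ‖coeff d f‖ₑ * d.prod fun i n => wnorm W (a i) ^ n := by
  have h1 : ∀ e, ‖coeff e (subst a f)‖ₑ * W e ≤
      ∑' d : τ →₀ ℕ, ‖coeff d f‖ₑ * (‖coeff e (d.prod fun i n => a i ^ n)‖ₑ * W e) := by
    intro e
    rw [MvPowerSeries.coeff_subst ha, finsum_eq_sum_of_support_subset (s :=
      (MvPowerSeries.coeff_subst_finite ha f e).toFinset) _ (by simp)]
    refine (mul_le_mul_left (enorm_sum_le _ _) _).trans ?_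
    rw [Finset.sum_mul]
    refine le_trans (Finset.sum_le_sum fun d _ => ?_) (ENNReal.sum_le_tsum _)
    rw [smul_eq_mul, enorm_mul, mul_assoc]
  refine (ENNReal.tsum_le_tsum h1).trans ?_
  rw [ENNReal.tsum_comm]
  refine ENNReal.tsum_le_tsum fun d => ?_
  rw [ENNReal.tsum_mul_left]
  refine mul_le_mul_right ?_ _
  refine (wnorm_prod_le hW _ _).trans ?_
  exact Finset.prod_le_prod' fun i _ => wnorm_pow_le hW _ _

/-- The weight `r ^ |d|`. -/
def degWeight (σ : Type*) (r : ℝ≥0) (d : σ →₀ ℕ) : ℝ≥0∞ := (r : ℝ≥0∞) ^ d.degree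

theorem isSubmul_degWeight (r : ℝ≥0) : IsSubmul (degWeight σ r) where
  zero_le_one := by simp [degWeight]
  add_le d e := by simp [degWeight, pow_add]

theorem wnorm_degWeight_mono {r s : ℝ≥0} (h : r ≤ s) (f : MvPowerSeries σ ℂ) :
    wnorm (degWeight σ r) f ≤ wnorm (degWeight σ s) f :=
  ENNReal.tsum_le_tsum fun _ => mul_le_mul_right
    (pow_le_pow_left' (ENNReal.coe_le_coe.2 h) _) _

/-- Every term that occurs has positive degree, so shrinking the radius from `s` to `r` gains at
least one factor `r / s`. -/
theorem wnorm_degWeight_le_mul {r s : ℝ≥0} (h : r ≤ s) {f : MvPowerSeries σ ℂ}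
    (hf : constantCoeff f = 0) :
    wnorm (degWeight σ r) f ≤ (r / s : ℝ≥0) * wnorm (degWeight σ s) f := by
  rw [wnorm, wnorm, ← ENNReal.tsum_mul_left]
  refine ENNReal.tsum_le_tsum fun d => ?_
  by_cases hd : d = 0
  · subst hd
    rw [MvPowerSeries.coeff_zero_eq_constantCoeff_apply, hf]; simp
  · rw [mul_left_comm]
    refine mul_le_mul_right ?_ _
    rw [degWeight, degWeight, ← ENNReal.coe_pow, ← ENNReal.coe_pow, ← ENNReal.coe_mul,
      ENNReal.coe_le_coe]
    have hd1 : d.degree ≠ 0 := by simpa [Finsupp.degree_eq_zero_iff] using hd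
    obtain ⟨n, hn⟩ := Nat.exists_eq_succ_of_ne_zero hd1
    -- For `s = 0` the quotient `r / s` is `0` by convention, but then `r = 0` too and the weight
    -- itself vanishes.
    rcases eq_or_ne s 0 with hs | hs
    · have : r = 0 := by simpa [hs] using h
      simp [this, hn]
    rw [hn, Nat.succ_eq_add_one, pow_succ, pow_succ, mul_comm, mul_comm (s ^ n), ← mul_assoc,
      div_mul_cancel₀ _ hs]
    exact mul_le_mul_right (pow_le_pow_left' h n) r

end WeightedNorm

theorem convergent_iff {n : ℕ} (f : MvPowerSeries (Fin n) ℂ) :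
    Convergent f ↔ ∃ r : ℝ≥0, 0 < r ∧ wnorm (degWeight (Fin n) r) f ≠ ∞ := by
  have key : ∀ r : ℝ≥0, (Summable fun d : Fin n →₀ ℕ => ‖coeff d f‖ * (r : ℝ) ^ d.degree) ↔
      wnorm (degWeight (Fin n) r) f ≠ ∞ := by
    intro r
    have h1 : ∀ d, ‖coeff d f‖ₑ * degWeight (Fin n) r d =
        ((‖coeff d f‖₊ * r ^ d.degree : ℝ≥0) : ℝ≥0∞) := by
      intro d; simp [degWeight, enorm]
    rw [wnorm]
    simp_rw [h1]
    rw [ENNReal.tsum_coe_ne_top_iff_summable, ← NNReal.summable_coe]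
    simp
  constructor
  · rintro ⟨r, hr, h⟩
    exact ⟨⟨r, hr.le⟩, hr, (key ⟨r, hr.le⟩).1 h⟩
  · rintro ⟨r, hr, h⟩
    exact ⟨r, hr, (key r).2 h⟩

/-! ### Stability of convergence under algebraic operations and substitution -/

section Convergent
variable {n m : ℕ} {f g : MvPowerSeries (Fin n) ℂ}

theorem Convergent.exists_wnorm₂ (hf : Convergent f) (hg : Convergent g) :
    ∃ r : ℝ≥0, 0 < r ∧ wnorm (degWeight (Fin n) r) f ≠ ∞ ∧ wnorm (degWeight (Fin n) r) g ≠ ∞ := by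
  obtain ⟨r, hr, h⟩ := (convergent_iff f).1 hf
  obtain ⟨s, hs, h'⟩ := (convergent_iff g).1 hg
  exact ⟨min r s, lt_min hr hs, ne_top_of_le_ne_top h (wnorm_degWeight_mono (min_le_left _ _) _),
    ne_top_of_le_ne_top h' (wnorm_degWeight_mono (min_le_right _ _) _)⟩

theorem Convergent.add (hf : Convergent f) (hg : Convergent g) : Convergent (f + g) := by
  obtain ⟨r, hr, h, h'⟩ := hf.exists_wnorm₂ hg
  exact (convergent_iff _).2 ⟨r, hr, ne_top_of_le_ne_top (ENNReal.add_ne_top.2 ⟨h, h'⟩)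
    (wnorm_add_le _ _)⟩

theorem Convergent.sub (hf : Convergent f) (hg : Convergent g) : Convergent (f - g) := by
  obtain ⟨r, hr, h, h'⟩ := hf.exists_wnorm₂ hg
  exact (convergent_iff _).2 ⟨r, hr, ne_top_of_le_ne_top (ENNReal.add_ne_top.2 ⟨h, h'⟩)
    (wnorm_sub_le _ _)⟩

theorem Convergent.mul (hf : Convergent f) (hg : Convergent g) : Convergent (f * g) := by
  obtain ⟨r, hr, h, h'⟩ := hf.exists_wnorm₂ hg
  exact (convergent_iff _).2 ⟨r, hr, ne_top_of_le_ne_top (ENNReal.mul_ne_top h h')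
    (wnorm_mul_le (isSubmul_degWeight r) _ _)⟩

theorem Convergent.monomial (d : Fin n →₀ ℕ) (a : ℂ) :
    Convergent (MvPowerSeries.monomial d a) :=
  (convergent_iff _).2 ⟨1, one_pos, by rw [wnorm_monomial]; simp [degWeight]⟩

theorem Convergent.X (i : Fin n) : Convergent (X i : MvPowerSeries (Fin n) ℂ) :=
  Convergent.monomial _ _

theorem Convergent.one : Convergent (1 : MvPowerSeries (Fin n) ℂ) := Convergent.monomial 0 1

theorem Convergent.pow (hf : Convergent f) (k : ℕ) : Convergent (f ^ k) := by
  induction k with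
  | zero => simpa using Convergent.one
  | succ k ih => rw [pow_succ]; exact ih.mul hf

/-- The product of powers of quantities bounded by `R`. -/
theorem finsupp_prod_pow_le {σ : Type*} {a : σ → ℝ≥0∞} {R : ℝ≥0} (h : ∀ i, a i ≤ R) (d : σ →₀ ℕ) :
    (d.prod fun i n => a i ^ n) ≤ degWeight σ R d := by
  rw [degWeight, Finsupp.degree_apply, Finsupp.prod, ← Finset.prod_pow_eq_pow_sum]
  exact Finset.prod_le_prod' fun i _ => pow_le_pow_left' (h i) _

theorem wnorm_subst_le_of_le {σ τ : Type*} [Finite τ] {W : (σ →₀ ℕ) → ℝ≥0∞} (hW : IsSubmul W)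
    {a : τ → MvPowerSeries σ ℂ} (ha : HasSubst a) {R : ℝ≥0} (h : ∀ i, wnorm W (a i) ≤ R)
    (f : MvPowerSeries τ ℂ) : wnorm W (subst a f) ≤ wnorm (degWeight τ R) f :=
  (wnorm_subst_le hW ha f).trans (ENNReal.tsum_le_tsum fun d =>
    mul_le_mul_right (finsupp_prod_pow_le h d) _)

/-- Without constant terms the norms tend to zero with the radius, so finitely many series can be
brought into the polydisc where another series converges. -/
theorem Convergent.exists_wnorm_le {ι : Type*} [Finite ι] {a : ι → MvPowerSeries (Fin n) ℂ}
    (ha : ∀ i, constantCoeff (a i) = 0) (hc : ∀ i, Convergent (a i)) {R : ℝ≥0} (hR : 0 < R) :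
    ∃ r : ℝ≥0, 0 < r ∧ ∀ i, wnorm (degWeight (Fin n) r) (a i) ≤ R := by
  have := Fintype.ofFinite ι
  have h1 : ∀ i, ∃ r : ℝ≥0, 0 < r ∧ wnorm (degWeight (Fin n) r) (a i) ≤ R := by
    intro i
    obtain ⟨s, hs, h⟩ := (convergent_iff _).1 (hc i)
    lift wnorm (degWeight (Fin n) s) (a i) to ℝ≥0 using h with M hM
    -- The radius shrinks by a factor of at most `R / (M + 1)`, which brings the norm `M` below `R`;
    -- the `+ 1` covers `M = 0`.
    refine ⟨min s (s * (R / (M + 1))), lt_min hs (by positivity), ?_⟩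
    refine (wnorm_degWeight_le_mul (min_le_left _ _) (ha i)).trans ?_
    rw [← hM, ← ENNReal.coe_mul, ENNReal.coe_le_coe]
    have : min s (s * (R / (M + 1))) / s ≤ R / (M + 1) := by
      rw [div_le_iff₀ hs, mul_comm]; exact min_le_right _ _
    refine (mul_le_mul_left this M).trans ?_
    rw [div_mul_eq_mul_div, div_le_iff₀ (by positivity)]
    exact mul_le_mul_right (by simp) R
  choose r hr h using h1
  rcases isEmpty_or_nonempty ι with hι | hι
  · exact ⟨1, one_pos, fun i => hι.elim i⟩
  · refine ⟨Finset.univ.inf' Finset.univ_nonempty r, ?_, fun i => ?_⟩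
    · rw [Finset.lt_inf'_iff]; exact fun i _ => hr i
    · exact (wnorm_degWeight_mono (Finset.inf'_le _ (Finset.mem_univ i)) _).trans (h i)

theorem Convergent.subst {f : MvPowerSeries (Fin m) ℂ} (hf : Convergent f)
    {a : Fin m → MvPowerSeries (Fin n) ℂ} (ha : ∀ i, constantCoeff (a i) = 0)
    (hc : ∀ i, Convergent (a i)) : Convergent (subst a f) := by
  obtain ⟨R, hR, h⟩ := (convergent_iff _).1 hf
  obtain ⟨r, hr, h'⟩ := Convergent.exists_wnorm_le ha hc hR
  exact (convergent_iff _).2 ⟨r, hr, ne_top_of_le_ne_top h (wnorm_subst_le_of_le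
    (isSubmul_degWeight r) (MvPowerSeries.hasSubst_of_constantCoeff_zero ha) h' f)⟩

/-- The inverse is the geometric series with `1 - f` substituted, and `1 - f` has no constant term.
-/
theorem Convergent.inv (hf : Convergent f) (h1 : constantCoeff f = 1) : Convergent f⁻¹ := by
  let geo : MvPowerSeries (Fin 1) ℂ := fun _ => 1
  have hgeo : (1 - MvPowerSeries.X 0) * geo = 1 := by
    classical
    ext d
    rw [sub_mul, one_mul, map_sub, MvPowerSeries.X_def, MvPowerSeries.coeff_monomial_mul,
      MvPowerSeries.coeff_one]
    have hg : ∀ e, coeff e geo = 1 := fun e => rfl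
    rw [hg, hg]
    by_cases hd : d = 0
    · subst hd; simp
    · have : Finsupp.single 0 1 ≤ d := by
        rw [Finsupp.single_le_iff]
        by_contra h
        apply hd
        ext
        simpa using h
      simp [hd, this]
  have hgc : Convergent geo := by
    refine ⟨1 / 2, by norm_num, ?_⟩
    have : Summable fun n : ℕ => (1 / 2 : ℝ) ^ n := summable_geometric_two
    refine ((Equiv.summable_iff (Finsupp.uniqueEquiv (M := ℕ) (0 : Fin 1)).symm).1 ?_)
    refine this.congr fun k => ?_
    have hg : ∀ e, coeff e geo = 1 := fun e => rfl
    simp [hg, Finsupp.degree_single]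
  have ha : ∀ i : Fin 1, constantCoeff ((fun _ => 1 - f : Fin 1 → MvPowerSeries (Fin n) ℂ) i) = 0 := by
    intro i; simp [h1]
  have hs := MvPowerSeries.hasSubst_of_constantCoeff_zero ha
  have h2 := congrArg (MvPowerSeries.subst (fun _ => 1 - f : Fin 1 → MvPowerSeries (Fin n) ℂ)) hgeo
  rw [← MvPowerSeries.coe_substAlgHom hs, map_mul, map_sub, map_one,
    MvPowerSeries.substAlgHom_X, sub_sub_cancel, MvPowerSeries.coe_substAlgHom] at h2
  rw [(MvPowerSeries.inv_eq_iff_mul_eq_one (by simp [h1])).2 ((mul_comm _ _).trans h2)]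
  exact hgc.subst ha fun _ => Convergent.one.sub hf

end Convergent

/-! ### Series in the jet variables and the ideal of nonlinear terms -/

/-- Power series in `z, w, ζ` and eight further variables `f, p, θf, u, q, θu, b_U, b_F` standing
for (combinations of) the derivatives of the components of a map. -/
abbrev JetSeries := MvPowerSeries (Fin 11) ℂ

/-- The degree in the eight jet variables. -/
def jetDeg (d : Fin 11 →₀ ℕ) : ℕ := ∑ i, if 3 ≤ i then d i else 0

theorem jetDeg_add (d e : Fin 11 →₀ ℕ) : jetDeg (d + e) = jetDeg d + jetDeg e := by
  simp only [jetDeg, ← Finset.sum_add_distrib, Finsupp.add_apply]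
  refine Finset.sum_congr rfl fun i _ => ?_
  split_ifs <;> simp

theorem jetDeg_single (i : Fin 11) (n : ℕ) :
    jetDeg (Finsupp.single i n) = if 3 ≤ i then n else 0 := by
  rw [jetDeg, Finset.sum_eq_single i]
  · simp
  · intro j _ hj; simp [hj.symm]
  · simp

/-- The ideal of the series all of whose terms are divisible by `w` or at least quadratic in the
jet variables. -/
def nonlinIdeal : Ideal JetSeries where
  carrier := {A | ∀ d, d 1 = 0 → jetDeg d ≤ 1 → coeff d A = 0}
  add_mem' ha hb d h h' := by rw [map_add, ha d h h', hb d h h', add_zero]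
  zero_mem' d _ _ := map_zero _
  smul_mem' c a ha d h h' := by
    classical
    rw [smul_eq_mul, MvPowerSeries.coeff_mul]
    refine Finset.sum_eq_zero fun p hp => ?_
    rw [Finset.HasAntidiagonal.mem_antidiagonal] at hp
    rw [← hp] at h h'
    rw [jetDeg_add] at h'
    rw [ha p.2 (by simp at h; exact h.2) (by omega), mul_zero]

theorem X_one_mem_nonlinIdeal : (X 1 : JetSeries) ∈ nonlinIdeal := by
  classical
  intro d h _
  rw [MvPowerSeries.coeff_X, if_neg]
  rintro rfl
  simp at h

theorem X_mul_X_mem_nonlinIdeal {i j : Fin 11} (hi : 3 ≤ i) (hj : 3 ≤ j) :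
    (X i * X j : JetSeries) ∈ nonlinIdeal := by
  classical
  intro d _ h
  rw [MvPowerSeries.X_def, MvPowerSeries.X_def, MvPowerSeries.monomial_mul_monomial,
    MvPowerSeries.coeff_monomial, if_neg]
  rintro rfl
  simp [jetDeg_add, jetDeg_single, hi, hj] at h

/-- Each surviving monomial contains either a factor `w`, which gains `s`, or two jets, which gain
`e ^ 2`. This quadratic smallness drives the convergence proof. -/
theorem wnorm_subst_nonlin_le {σ : Type*} {W : (σ →₀ ℕ) → ℝ≥0∞} (hW : IsSubmul W)
    {a : Fin 11 → MvPowerSeries σ ℂ} (ha : HasSubst a) {R s e : ℝ≥0} (hs : s ≤ 1) (he : e ≤ 1)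
    (h0 : wnorm W (a 0) ≤ R) (h1 : wnorm W (a 1) ≤ R * s) (h2 : wnorm W (a 2) ≤ R)
    (h3 : ∀ i, 3 ≤ i → wnorm W (a i) ≤ R * e) {A : JetSeries} (hA : A ∈ nonlinIdeal) :
    wnorm W (subst a A) ≤ wnorm (degWeight (Fin 11) R) A * (s + e ^ 2) := by
  refine (wnorm_subst_le hW ha A).trans ?_
  rw [wnorm, ← ENNReal.tsum_mul_right]
  refine ENNReal.tsum_le_tsum fun d => ?_
  by_cases hd : d 1 = 0 ∧ jetDeg d ≤ 1
  · rw [hA d hd.1 hd.2]; simp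
  rw [mul_assoc]
  refine mul_le_mul_right ?_ _
  -- The gain of each variable over the common radius `R`.
  let t : Fin 11 → ℝ≥0 := fun i => if 3 ≤ i then e else if i = 1 then s else 1
  have ht1 : ∀ i, t i ≤ 1 := by intro i; simp only [t]; split_ifs <;> simp [hs, he]
  have ht : ∀ i, wnorm W (a i) ≤ (R : ℝ≥0∞) * t i := by
    intro i
    by_cases hi : 3 ≤ i
    · simpa [t, hi] using h3 i hi
    · have : i = 0 ∨ i = 1 ∨ i = 2 := by omega
      rcases this with rfl | rfl | rfl <;> simp [t, h0, h1, h2]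
  have hdeg : degWeight (Fin 11) R d = ∏ i, (R : ℝ≥0∞) ^ d i := by
    rw [degWeight, Finsupp.degree_eq_sum, ← Finset.prod_pow_eq_pow_sum]
  rw [Finsupp.prod_fintype _ _ (by simp), hdeg]
  refine (Finset.prod_le_prod' fun i _ => pow_le_pow_left' (ht i) _).trans ?_
  simp_rw [mul_pow]
  rw [Finset.prod_mul_distrib]
  refine mul_le_mul_right ?_ _
  norm_cast
  by_cases hd1 : d 1 = 0
  · have hj : 2 ≤ jetDeg d := by
      by_contra h; exact hd ⟨hd1, by omega⟩
    have h4 : ∏ i, t i ^ d i = e ^ jetDeg d := by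
      rw [jetDeg, ← Finset.prod_pow_eq_pow_sum]
      refine Finset.prod_congr rfl fun i _ => ?_
      by_cases hi : 3 ≤ i
      · simp [t, hi]
      · by_cases hi1 : i = 1
        · subst hi1; simp [hd1, t]
        · simp [t, hi, hi1]
    rw [h4]
    exact (pow_le_pow_right_of_le_one' he hj).trans le_add_self
  · rw [← Finset.mul_prod_erase _ _ (Finset.mem_univ 1)]
    have h4 : ∏ i ∈ Finset.univ.erase 1, t i ^ d i ≤ 1 :=
      Finset.prod_le_one' fun i _ => pow_le_one' (ht1 i) _
    refine (mul_le_of_le_one_right' h4).trans ?_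
    refine (pow_le_of_le_one zero_le (ht1 1) hd1).trans ?_
    simp [t]

/-! ### Dependence of the nonlinear part on lower powers of `w` only -/

section Causality

/-- The number of factors divisible by `w` in a monomial in the jets. -/
def wGrade (d : Fin 11 →₀ ℕ) : ℕ := d 1 + jetDeg d

/-- Two products of at least two factors divisible by `w`, whose factors agree modulo `w ^ k`, agree
modulo `w ^ (k + 1)`: telescoping leaves one difference times at least one further factor `w`. -/
theorem X_pow_dvd_subst_sub {k : ℕ} {a b : Fin 11 → Series3} (ha : HasSubst a) (hb : HasSubst b)
    (h0 : a 0 = b 0) (h1 : a 1 = X 1) (h1' : b 1 = X 1) (h2 : a 2 = b 2)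
    (h3 : ∀ i, 3 ≤ i → (X 1 : Series3) ∣ a i) (h3' : ∀ i, 3 ≤ i → (X 1 : Series3) ∣ b i)
    (h : ∀ i, 3 ≤ i → (X 1 : Series3) ^ k ∣ a i - b i) {A : JetSeries} (hA : A ∈ nonlinIdeal) :
    (X 1 : Series3) ^ (k + 1) ∣ subst a A - subst b A := by
  -- The true divisibility of the difference is by `w ^ (k + wGrade d - 1)`; the extra factor `X 1`
  -- avoids the truncated subtraction. Monomials without jets do not change at all.
  have key : ∀ d : Fin 11 →₀ ℕ,
      (X 1 : Series3) ^ wGrade d ∣ (d.prod fun i n => a i ^ n) ∧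
      (X 1 : Series3) ^ wGrade d ∣ (d.prod fun i n => b i ^ n) ∧
      (X 1 : Series3) ^ (k + wGrade d) ∣
        X 1 * ((d.prod fun i n => a i ^ n) - d.prod fun i n => b i ^ n) ∧
      (jetDeg d = 0 → (d.prod fun i n => a i ^ n) = d.prod fun i n => b i ^ n) := by
    intro d
    induction d using Finsupp.induction_linear with
    | zero => simp [wGrade, jetDeg]
    | add d e hd he =>
      obtain ⟨p1, p2, p3, p4⟩ := hd
      obtain ⟨q1, q2, q3, q4⟩ := he
      have hg : wGrade (d + e) = wGrade d + wGrade e := by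
        simp [wGrade, jetDeg_add]; ring
      have hpa : ∀ c : Fin 11 → Series3, ((d + e).prod fun i n => c i ^ n) =
          (d.prod fun i n => c i ^ n) * e.prod fun i n => c i ^ n := fun c =>
        Finsupp.prod_add_index' (by simp) (fun _ _ _ => pow_add _ _ _)
      rw [hpa, hpa, hg]
      refine ⟨?_, ?_, ?_, ?_⟩
      · rw [pow_add]; exact mul_dvd_mul p1 q1
      · rw [pow_add]; exact mul_dvd_mul p2 q2
      · have : ∀ x y x' y' w : Series3, w * (x * y - x' * y') =
            x * (w * (y - y')) + (w * (x - x')) * y' := by intros; ring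
        rw [this]
        refine dvd_add ?_ ?_
        · rw [show k + (wGrade d + wGrade e) = wGrade d + (k + wGrade e) by ring, pow_add]
          exact mul_dvd_mul p1 q3
        · rw [← add_assoc, pow_add]
          exact mul_dvd_mul p3 q2
      · intro hj
        rw [jetDeg_add] at hj
        rw [p4 (by omega), q4 (by omega)]
    | single i n =>
      have hpa : ∀ c : Fin 11 → Series3, ((Finsupp.single i n).prod fun i n => c i ^ n) =
          c i ^ n := fun c => Finsupp.prod_single_index (by simp)
      rw [hpa, hpa]
      by_cases hi : 3 ≤ i
      · have hg : wGrade (Finsupp.single i n) = n := by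
          have : i ≠ 1 := by rintro rfl; exact absurd hi (by decide)
          simp [wGrade, jetDeg_single, hi, this]
        rw [hg]
        refine ⟨pow_dvd_pow_of_dvd (h3 i hi) n, pow_dvd_pow_of_dvd (h3' i hi) n, ?_, ?_⟩
        · induction n with
          | zero => simp
          | succ n ih =>
            have hg : wGrade (Finsupp.single i n) = n := by
              have : i ≠ 1 := by rintro rfl; exact absurd hi (by decide)
              simp [wGrade, jetDeg_single, hi, this]
            have ih' := ih (fun c => Finsupp.prod_single_index (by simp)) hg
            have : ∀ x y : Series3, X 1 * (x ^ (n + 1) - y ^ (n + 1)) =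
                x ^ n * (X 1 * (x - y)) + (X 1 * (x ^ n - y ^ n)) * y := by intros; ring
            rw [this]
            refine dvd_add ?_ ?_
            · rw [show k + (n + 1) = n + (1 + k) by ring, pow_add, pow_add, pow_one]
              exact mul_dvd_mul (pow_dvd_pow_of_dvd (h3 i hi) n) (mul_dvd_mul_left _ (h i hi))
            · rw [← add_assoc, pow_succ]
              exact mul_dvd_mul ih' (h3' i hi)
        · intro hj
          simp [jetDeg_single, hi] at hj
          simp [hj]
      · have hab : a i = b i := by
          have : i = 0 ∨ i = 1 ∨ i = 2 := by omega
          rcases this with rfl | rfl | rfl <;> simp [h0, h1, h1', h2]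
        have hdv : (X 1 : Series3) ^ wGrade (Finsupp.single i n) ∣ b i ^ n := by
          by_cases hi1 : i = 1
          · subst hi1; simp [wGrade, jetDeg_single, h1']
          · simp [wGrade, jetDeg_single, hi, hi1]
        simp [hab, hdv]
  rw [MvPowerSeries.X_pow_dvd_iff]
  intro e he
  rw [map_sub, MvPowerSeries.coeff_subst ha, MvPowerSeries.coeff_subst hb, sub_eq_zero]
  refine finsum_congr fun d => ?_
  obtain ⟨-, -, p3, p4⟩ := key d
  by_cases hj : jetDeg d = 0
  · rw [p4 hj]
  by_cases hd : d 1 = 0 ∧ jetDeg d ≤ 1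
  · rw [hA d hd.1 hd.2]; simp
  -- A jet is present; membership in `nonlinIdeal` forces a second jet or a factor `w`.
  have hg : 2 ≤ wGrade d := by rw [wGrade]; omega
  have h5 : (X 1 : Series3) * X 1 ^ (k + 1) ∣
      X 1 * ((d.prod fun i n => a i ^ n) - d.prod fun i n => b i ^ n) := by
    rw [← pow_succ']
    exact (pow_dvd_pow _ (by omega)).trans p3
  have hX : (X 1 : Series3) ≠ 0 := by
    intro h
    have := congrArg (coeff (Finsupp.single 1 1)) h
    simp at this
  have h6 := MvPowerSeries.X_pow_dvd_iff.1 ((mul_dvd_mul_iff_left hX).1 h5) e he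
  rw [map_sub, sub_eq_zero] at h6
  rw [h6]

end Causality

/-! ### First order Taylor expansion of substitutions -/

section Taylor
variable {n : ℕ}

/-- First order Taylor expansion of a substitution, up to terms in an ideal that contains all
products of two increments. -/
theorem subst_add_sub_mem_polynomial {τ : Type*} (I : Ideal (MvPowerSeries τ ℂ))
    {a h : Fin n → MvPowerSeries τ ℂ} (ha : HasSubst a) (hah : HasSubst (a + h))
    (hh : ∀ i j, h i * h j ∈ I) (T : MvPolynomial (Fin n) ℂ) :
    subst (a + h) (T : MvPowerSeries (Fin n) ℂ) - subst a (T : MvPowerSeries (Fin n) ℂ) -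
      ∑ i, subst a (MvPowerSeries.pderiv ℂ i (T : MvPowerSeries (Fin n) ℂ)) * h i ∈ I := by
  induction T using MvPolynomial.induction_on with
  | C c =>
    simp only [MvPolynomial.coe_C, MvPowerSeries.pderiv_C]
    rw [← MvPowerSeries.coe_substAlgHom ha, ← MvPowerSeries.coe_substAlgHom hah]
    simp only [MvPowerSeries.c_eq_algebraMap, AlgHom.commutes, map_zero, zero_mul,
      Finset.sum_const_zero, sub_self, I.zero_mem]
  | add p q hp hq =>
    have := I.add_mem hp hq
    convert this using 1
    simp only [MvPolynomial.coe_add, map_add]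
    rw [← MvPowerSeries.coe_substAlgHom ha, ← MvPowerSeries.coe_substAlgHom hah]
    simp only [map_add, add_mul, Finset.sum_add_distrib]
    ring
  | mul_X p j hp =>
    have h1 := I.mul_mem_right (a j + h j) hp
    have h2 : (∑ i, subst a (MvPowerSeries.pderiv ℂ i (p : MvPowerSeries (Fin n) ℂ)) * h i) * h j
        ∈ I := by
      rw [Finset.sum_mul]
      refine I.sum_mem fun i _ => ?_
      rw [mul_assoc]
      exact I.mul_mem_left _ (hh i j)
    convert I.add_mem h1 h2 using 1
    rw [← MvPowerSeries.coe_substAlgHom ha, ← MvPowerSeries.coe_substAlgHom hah]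
    simp only [MvPolynomial.coe_mul, MvPolynomial.coe_X, Derivation.leibniz, smul_eq_mul, map_add,
      map_mul, MvPowerSeries.substAlgHom_X, add_mul, Finset.sum_add_distrib]
    have h3 : ∑ i, (MvPowerSeries.substAlgHom ha) (p : MvPowerSeries (Fin n) ℂ) *
        (MvPowerSeries.substAlgHom ha) (MvPowerSeries.pderiv ℂ i (X j)) * h i =
        (MvPowerSeries.substAlgHom ha) (p : MvPowerSeries (Fin n) ℂ) * h j := by
      rw [Finset.sum_eq_single j]
      · rw [MvPowerSeries.pderiv_X_self, map_one, mul_one]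
      · intro i _ hi
        rw [MvPowerSeries.pderiv_X_of_ne hi.symm, map_zero, mul_zero, zero_mul]
      · simp
    rw [h3]
    simp only [mul_assoc, ← Finset.mul_sum, Pi.add_apply]
    ring

/-- Substituting series without constant term does not lower the order. -/
theorem coeff_subst_eq_zero_of_order {τ : Type*} {a : Fin n → MvPowerSeries τ ℂ}
    (ha : ∀ i, constantCoeff (a i) = 0) {f : MvPowerSeries (Fin n) ℂ} {d : τ →₀ ℕ}
    (hf : ∀ e : Fin n →₀ ℕ, e.degree ≤ d.degree → coeff e f = 0) : coeff d (subst a f) = 0 := by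
  apply MvPowerSeries.coeff_of_lt_order
  refine lt_of_lt_of_le ?_ (MvPowerSeries.le_order_subst
    (MvPowerSeries.hasSubst_of_constantCoeff_zero ha) f)
  have h1 : (1 : ℕ∞) ≤ ⨅ i, (a i).order := by
    refine le_iInf fun i => ?_
    rw [MvPowerSeries.one_le_order_iff_constCoeff_eq_zero]
    exact ha i
  have h2 : ((d.degree + 1 : ℕ) : ℕ∞) ≤ f.order :=
    MvPowerSeries.nat_le_order fun e he => hf e (by omega)
  calc (d.degree : ℕ∞) < ((d.degree + 1 : ℕ) : ℕ∞) := by exact_mod_cast Nat.lt_succ_self _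
    _ ≤ f.order := h2
    _ ≤ _ := le_mul_of_one_le_left' h1

/-- Membership in `nonlinIdeal` is tested coefficient by coefficient, and one coefficient sees only
finitely many terms of `Φ`, so the polynomial case suffices. -/
theorem subst_add_sub_mem {a h : Fin n → JetSeries} (ha : ∀ i, constantCoeff (a i) = 0)
    (hc : ∀ i, constantCoeff (h i) = 0) (hh : ∀ i j, h i * h j ∈ nonlinIdeal)
    (Φ : MvPowerSeries (Fin n) ℂ) :
    subst (a + h) Φ - subst a Φ - ∑ i, subst a (MvPowerSeries.pderiv ℂ i Φ) * h i
      ∈ nonlinIdeal := by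
  have hah : ∀ i, constantCoeff ((a + h) i) = 0 := by intro i; simp [ha, hc]
  have sa := MvPowerSeries.hasSubst_of_constantCoeff_zero ha
  have sah := MvPowerSeries.hasSubst_of_constantCoeff_zero hah
  intro d hd hd'
  -- Degrees up to `d.degree + 1` are kept, one more than for `Φ` itself, because the partial
  -- derivatives lower the degree by one.
  let T := MvPowerSeries.truncTotal (d.degree + 2) Φ
  have hE : ∀ e : Fin n →₀ ℕ, e.degree ≤ d.degree + 1 →
      coeff e (Φ - (T : MvPowerSeries (Fin n) ℂ)) = 0 := by
    intro e he
    rw [map_sub, MvPolynomial.coeff_coe, MvPowerSeries.coeff_truncTotal _ (by omega), sub_self]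
  have hT := subst_add_sub_mem_polynomial nonlinIdeal sa sah hh T d hd hd'
  have hΦ : Φ = T + (Φ - (T : MvPowerSeries (Fin n) ℂ)) := by ring
  set E := Φ - (T : MvPowerSeries (Fin n) ℂ) with hEdef
  have h4 : coeff d (∑ i, subst a (MvPowerSeries.pderiv ℂ i E) * h i) = 0 := by
    classical
    rw [map_sum]
    refine Finset.sum_eq_zero fun i _ => ?_
    rw [MvPowerSeries.coeff_mul]
    refine Finset.sum_eq_zero fun p hp => ?_
    rw [Finset.HasAntidiagonal.mem_antidiagonal] at hp
    rw [coeff_subst_eq_zero_of_order ha, zero_mul]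
    intro e he
    rw [MvPowerSeries.coeff_pderiv, hE, zero_mul]
    rw [← hp]
    simp only [map_add, Finsupp.degree_single]
    omega
  have h5 : coeff d (subst a E) = 0 :=
    coeff_subst_eq_zero_of_order ha fun e he => hE e (by omega)
  have h6 : coeff d (subst (a + h) E) = 0 :=
    coeff_subst_eq_zero_of_order hah fun e he => hE e (by omega)
  rw [hΦ]
  have h7 : ∑ i, subst a (MvPowerSeries.pderiv ℂ i ((T : MvPowerSeries (Fin n) ℂ) + E)) * h i =
      ∑ i, subst a (MvPowerSeries.pderiv ℂ i (T : MvPowerSeries (Fin n) ℂ)) * h i +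
      ∑ i, subst a (MvPowerSeries.pderiv ℂ i E) * h i := by
    rw [← Finset.sum_add_distrib]
    refine Finset.sum_congr rfl fun i _ => ?_
    rw [map_add, MvPowerSeries.subst_add sa, add_mul]
  rw [MvPowerSeries.subst_add sa, MvPowerSeries.subst_add sah, h7]
  simp only [map_sub, map_add] at hT h4 h5 h6 ⊢
  rw [h4, h5, h6]
  linear_combination hT

end Taylor

/-! ### The source equation as a function of the jet, and its linear part -/

section JetFormula

/-- The factor `U = G / w`. -/
def jetU : JetSeries := 1 + X 6
/-- The total derivative `P` of `F`. -/
def jetP : JetSeries := 1 + X 4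
/-- The transformed slope `Z`. -/
def jetZ : JetSeries := (X 2 * jetU + X 7) * (jetU * jetP)⁻¹
/-- The Jacobian factor. -/
def jetK : JetSeries := jetU + X 8 - X 5 * (jetU * jetZ)
/-- The arguments of the target equation. -/
def jetTarget : Fin 3 → JetSeries := ![X 0 + X 3, X 1 * jetU, jetZ]
/-- The right-hand side of the source equation as a function of the jet of the map into the
equation given by `Φ`. -/
def jetSource (Φ : Series3) : JetSeries :=
  X 2 ^ 2 + jetK⁻¹ * (jetP ^ 2 * jetU * subst jetTarget Φ - X 2 ^ 2 * jetU - 2 * X 2 * X 7 - X 9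
    + X 10 * (jetU * jetZ))

theorem constantCoeff_jetU : constantCoeff jetU = 1 := by simp [jetU]
theorem constantCoeff_jetP : constantCoeff jetP = 1 := by simp [jetP]
theorem constantCoeff_jetZ : constantCoeff jetZ = 0 := by simp [jetZ]
theorem constantCoeff_jetK : constantCoeff jetK = 1 := by simp [jetK, constantCoeff_jetU]

theorem constantCoeff_jetTarget (i : Fin 3) : constantCoeff (jetTarget i) = 0 := by
  fin_cases i <;> simp [jetTarget, constantCoeff_jetZ]

theorem jetU_mul_jetP_mul_jetZ : jetU * jetP * jetZ = X 2 * jetU + X 7 := by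
  have : (jetU * jetP) * (jetU * jetP)⁻¹ = 1 := MvPowerSeries.mul_inv_cancel _
    (by simp [constantCoeff_jetU, constantCoeff_jetP])
  rw [jetZ]
  linear_combination (X 2 * jetU + X 7) * this

theorem jetK_mul_jetSource (Φ : Series3) :
    jetK * (jetSource Φ - X 2 ^ 2) = jetP ^ 2 * jetU * subst jetTarget Φ - X 2 ^ 2 * jetU
      - 2 * X 2 * X 7 - X 9 + X 10 * (jetU * jetZ) := by
  have : jetK * jetK⁻¹ = 1 := MvPowerSeries.mul_inv_cancel _ (by simp [constantCoeff_jetK])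
  rw [jetSource, add_sub_cancel_left, ← mul_assoc, this, one_mul]

theorem Convergent.jetSource {Φ : Series3} (hΦ : Convergent Φ) : Convergent (jetSource Φ) := by
  have hX : ∀ i, Convergent (MvPowerSeries.X i : JetSeries) := Convergent.X
  have hU : Convergent jetU := Convergent.one.add (hX 6)
  have hP : Convergent jetP := Convergent.one.add (hX 4)
  have hZ : Convergent jetZ := (((hX 2).mul hU).add (hX 7)).mul
    ((hU.mul hP).inv (by simp [constantCoeff_jetU, constantCoeff_jetP]))
  have hK : Convergent jetK := (hU.add (hX 8)).sub ((hX 5).mul (hU.mul hZ))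
  have h2 : Convergent (2 : JetSeries) := by
    rw [← one_add_one_eq_two]; exact Convergent.one.add Convergent.one
  have hT : Convergent (MvPowerSeries.subst jetTarget Φ) := by
    refine hΦ.subst constantCoeff_jetTarget fun i => ?_
    fin_cases i
    · exact (hX 0).add (hX 3)
    · exact (hX 1).mul hU
    · exact hZ
  exact ((hX 2).pow 2).add ((hK.inv constantCoeff_jetK).mul
    ((((((hP.pow 2).mul hU).mul hT).sub (((hX 2).pow 2).mul hU)).sub
      ((h2.mul (hX 2)).mul (hX 7))).sub (hX 9) |>.add ((hX 10).mul (hU.mul hZ))))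

/-- The inclusion of the series in `z, w, ζ` into the series in the jet variables. -/
def baseVars : Fin 3 → JetSeries := ![X 0, X 1, X 2]

theorem constantCoeff_baseVars (i : Fin 3) : constantCoeff (baseVars i) = 0 := by
  fin_cases i <;> simp [baseVars]

theorem hasSubst_baseVars : HasSubst baseVars :=
  MvPowerSeries.hasSubst_of_constantCoeff_zero constantCoeff_baseVars

theorem hasSubst_jetTarget : HasSubst jetTarget :=
  MvPowerSeries.hasSubst_of_constantCoeff_zero constantCoeff_jetTarget

/-- The restriction `Φ(z, 0, ζ)`. -/
def restrict (Φ : Series3) : Series3 := fun d => if d 1 = 0 then coeff d Φ else 0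

theorem coeff_restrict (Φ : Series3) (d : Fin 3 →₀ ℕ) :
    coeff d (restrict Φ) = if d 1 = 0 then coeff d Φ else 0 := rfl

theorem X_one_dvd_sub_restrict (Φ : Series3) : (X 1 : Series3) ∣ Φ - restrict Φ := by
  rw [MvPowerSeries.X_dvd_iff]
  intro d hd
  rw [map_sub, coeff_restrict, if_pos hd, sub_self]

/-- The part of `jetSource Φ` of order at most one in the jet variables, at `w = 0`. -/
def jetLinear (Φ : Series3) : JetSeries :=
  subst baseVars (restrict Φ)
    + (subst baseVars (restrict Φ) - X 2 ^ 2) * (2 * X 4 + X 2 * X 5 - X 8)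
    + X 3 * subst baseVars (MvPowerSeries.pderiv ℂ 0 (restrict Φ))
    + (subst baseVars (MvPowerSeries.pderiv ℂ 2 (restrict Φ)) - 2 * X 2) * (X 7 - X 2 * X 4)
    - X 9 + X 2 * X 10

/-- The first order expansion, carried out in a ring where products of two jets vanish. There `Z = ζ
+ q - ζ p` and `K = 1 + u + v - ζ t`, and the claim follows on multiplying by the unit `K`. It will
be used in the quotient by `nonlinIdeal`; an abstract ring keeps the computation purely algebraic.
-/
theorem lin_aux {Q : Type*} [CommRing Q] {ζ f p t u q v bU bF Z K S Φ0 Φz Φζ Ψ : Q}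
    (hpp : p * p = 0) (hpu : p * u = 0) (hpq : p * q = 0) (huq : u * q = 0)
    (htu : t * u = 0) (htq : t * q = 0) (htp : t * p = 0)
    (huu : u * u = 0)  (hpf : p * f = 0)
    (hFq : bF * q = 0) (hFp : bF * p = 0) (hFu : bF * u = 0)
    (hv : v * p = 0) (hvt : v * t = 0) (hvv : v * v = 0) (hvq : v * q = 0) (hvf : v * f = 0)
    (hvu : v * u = 0) (hvU : v * bU = 0) (hvF : v * bF = 0) (huU : u * bU = 0) (htU : t * bU = 0)
    (htF : t * bF = 0) (htf : t * f = 0) (htt : t * t = 0)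
    (hUP : IsUnit ((1 + u) * (1 + p))) (hK : IsUnit K)
    (hZ : (1 + u) * (1 + p) * Z = ζ * (1 + u) + q) (hKe : K = 1 + u + v - t * (1 + u) * Z)
    (hΨ : Ψ = Φ0 + f * Φz + (q - ζ * p) * Φζ)
    (hS : K * (S - ζ ^ 2) = (1 + p) ^ 2 * (1 + u) * Ψ - ζ ^ 2 * (1 + u) - 2 * ζ * q - bU
      + bF * (1 + u) * Z) :
    S = Φ0 + (Φ0 - ζ ^ 2) * (2 * p + ζ * t - v) + f * Φz + (Φζ - 2 * ζ) * (q - ζ * p) - bU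
      + ζ * bF := by
  have hZ' : Z = ζ + q - ζ * p := by
    apply hUP.mul_left_cancel
    rw [hZ]
    linear_combination (-1 : Q) * huq - hpq + ζ * hpp + (ζ * u * hpp) - q * hpu
  have hKe' : K = 1 + u + v - ζ * t := by
    rw [hKe, hZ']
    linear_combination (-ζ + ζ * p - q) * htu - htq + ζ * htp
  rw [← sub_left_inj (a := ζ ^ 2)]
  apply hK.mul_left_cancel
  rw [hS, hΨ, hZ', hKe']
  grind

/-- After multiplication by the unit `jetU * jetP` the difference is a polynomial, all of whose
terms contain two jets. -/
theorem jetZ_sub_mem : jetZ - (X 2 + (X 7 - X 2 * X 4)) ∈ nonlinIdeal := by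
  have h1 : ∀ i j : Fin 11, 3 ≤ i → 3 ≤ j → (X i * X j : JetSeries) ∈ nonlinIdeal :=
    fun i j => X_mul_X_mem_nonlinIdeal
  have h2 : (jetU * jetP) * (jetU * jetP)⁻¹ = 1 := MvPowerSeries.mul_inv_cancel _
    (by simp [constantCoeff_jetU, constantCoeff_jetP])
  have h3 : jetZ - (X 2 + (X 7 - X 2 * X 4)) = (jetU * jetP)⁻¹ *
      (-(X 6 * X 7) - X 4 * X 7 + X 2 * (X 4 * X 4) + (X 2 * X 6) * (X 4 * X 4)
        - X 7 * (X 4 * X 6)) := by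
    have h4 := jetU_mul_jetP_mul_jetZ
    have h5 : jetZ = (jetU * jetP)⁻¹ * (X 2 * jetU + X 7) := by rw [jetZ, mul_comm]
    rw [h5]
    have h6 : (X 2 + (X 7 - X 2 * X 4) : JetSeries) = (jetU * jetP)⁻¹ * ((jetU * jetP) *
      (X 2 + (X 7 - X 2 * X 4))) := by linear_combination (-(X 2 + (X 7 - X 2 * X 4))) * h2
    rw [h6, ← mul_sub, jetU, jetP]
    ring
  rw [h3]
  refine Ideal.mul_mem_left _ _ ?_
  refine sub_mem (add_mem (add_mem (sub_mem (neg_mem ?_) ?_) ?_) ?_) ?_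
  · exact h1 _ _ (by decide) (by decide)
  · exact h1 _ _ (by decide) (by decide)
  · exact Ideal.mul_mem_left _ _ (h1 _ _ (by decide) (by decide))
  · exact Ideal.mul_mem_left _ _ (h1 _ _ (by decide) (by decide))
  · exact Ideal.mul_mem_left _ _ (h1 _ _ (by decide) (by decide))

/-- Taylor expansion at `(z, w, ζ)`. The increment of the second argument is `w u`, hence
negligible, and those of the other two are `f` and, to first order, `q - ζ p`. Replacing `Φ` by its
restriction to `w = 0` costs a multiple of `w`. -/
theorem subst_jetTarget_sub_mem (Φ : Series3) :
    subst jetTarget Φ - (subst baseVars (restrict Φ)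
      + X 3 * subst baseVars (MvPowerSeries.pderiv ℂ 0 (restrict Φ))
      + (X 7 - X 2 * X 4) * subst baseVars (MvPowerSeries.pderiv ℂ 2 (restrict Φ)))
      ∈ nonlinIdeal := by
  have hX : ∀ i j : Fin 11, 3 ≤ i → 3 ≤ j → (X i * X j : JetSeries) ∈ nonlinIdeal :=
    fun i j => X_mul_X_mem_nonlinIdeal
  have h1 : subst jetTarget Φ - subst jetTarget (restrict Φ) ∈ nonlinIdeal := by
    obtain ⟨Ψ, hΨ⟩ := X_one_dvd_sub_restrict Φ
    rw [← MvPowerSeries.subst_sub hasSubst_jetTarget, hΨ,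
      MvPowerSeries.subst_mul hasSubst_jetTarget, MvPowerSeries.subst_X hasSubst_jetTarget]
    refine Ideal.mul_mem_right _ _ ?_
    exact Ideal.mul_mem_right _ _ X_one_mem_nonlinIdeal
  let h : Fin 3 → JetSeries := jetTarget - baseVars
  have hadd : baseVars + h = jetTarget := by simp [h]
  have hh0 : h 0 = X 3 := by simp [h, jetTarget, baseVars]
  have hh1 : h 1 ∈ nonlinIdeal := by
    have : h 1 = X 1 * X 6 := by simp [h, jetTarget, baseVars, jetU]; ring
    rw [this]
    exact Ideal.mul_mem_right _ _ X_one_mem_nonlinIdeal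
  have hh2 : h 2 - (X 7 - X 2 * X 4) ∈ nonlinIdeal := by
    have : h 2 - (X 7 - X 2 * X 4) = jetZ - (X 2 + (X 7 - X 2 * X 4)) := by
      simp [h, jetTarget, baseVars]; ring
    rw [this]; exact jetZ_sub_mem
  have hl : ∀ i, 3 ≤ i → X i * h 2 ∈ nonlinIdeal := by
    intro i hi
    have : X i * h 2 = X i * (h 2 - (X 7 - X 2 * X 4)) + X i * X 7 - X 2 * (X i * X 4) := by ring
    rw [this]
    exact sub_mem (add_mem (Ideal.mul_mem_left _ _ hh2) (hX _ _ hi (by decide)))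
      (Ideal.mul_mem_left _ _ (hX _ _ hi (by decide)))
  have h22 : h 2 * h 2 ∈ nonlinIdeal := by
    have : h 2 * h 2 = h 2 * (h 2 - (X 7 - X 2 * X 4)) + X 7 * h 2 - X 2 * (X 4 * h 2) := by ring
    rw [this]
    exact sub_mem (add_mem (Ideal.mul_mem_left _ _ hh2) (hl 7 (by decide)))
      (Ideal.mul_mem_left _ _ (hl 4 (by decide)))
  have h2 := subst_add_sub_mem (a := baseVars) (h := h) constantCoeff_baseVars
    (by intro i; simp [h, constantCoeff_baseVars, constantCoeff_jetTarget]) (by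
      intro i j
      fin_cases i <;> fin_cases j
      · simpa [hh0] using hX 3 3 (by decide) (by decide)
      · exact Ideal.mul_mem_left _ _ hh1
      · simpa [hh0] using hl 3 (by decide)
      · exact Ideal.mul_mem_right _ _ hh1
      · exact Ideal.mul_mem_right _ _ hh1
      · exact Ideal.mul_mem_right _ _ hh1
      · simpa [hh0, mul_comm] using hl 3 (by decide)
      · exact Ideal.mul_mem_left _ _ hh1
      · exact h22) (restrict Φ)
  rw [hadd, Fin.sum_univ_three, hh0] at h2
  have h3 := add_mem (add_mem (add_mem h1 h2)
    (Ideal.mul_mem_left _ (subst baseVars (MvPowerSeries.pderiv ℂ 1 (restrict Φ))) hh1))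
    (Ideal.mul_mem_left _ (subst baseVars (MvPowerSeries.pderiv ℂ 2 (restrict Φ))) hh2)
  convert h3 using 1
  ring

/-- This transports `lin_aux` to the quotient ring: the defining relations of `jetZ` and
`jetSource`, together with the Taylor expansion of the target, determine the class of `jetSource Φ`.
-/
theorem jetSource_sub_jetLinear_mem (Φ : Series3) :
    jetSource Φ - jetLinear Φ ∈ nonlinIdeal := by
  rw [← Ideal.Quotient.eq]
  let π := Ideal.Quotient.mk nonlinIdeal
  have hX : ∀ i j : Fin 11, 3 ≤ i → 3 ≤ j → π (X i) * π (X j) = 0 := fun i j hi hj => by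
    rw [← map_mul]; exact Ideal.Quotient.eq_zero_iff_mem.2 (X_mul_X_mem_nonlinIdeal hi hj)
  have hΨ := Ideal.Quotient.eq.2 (subst_jetTarget_sub_mem Φ)
  have hunit : ∀ A : JetSeries, constantCoeff A = 1 → IsUnit (π A) := fun A hA =>
    (MvPowerSeries.isUnit_iff_constantCoeff.2 (by simp [hA])).map π
  have hUP := hunit (jetU * jetP) (by simp [constantCoeff_jetU, constantCoeff_jetP])
  have hZ := congrArg π jetU_mul_jetP_mul_jetZ
  have hS := congrArg π (jetK_mul_jetSource Φ)
  have hKe : π jetK = π (jetU + X 8 - X 5 * (jetU * jetZ)) := rfl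
  simp only [jetU, jetP, map_add, map_mul, map_sub, map_one, map_pow, map_ofNat] at hUP hZ hS hKe
  have key := lin_aux (Q := JetSeries ⧸ nonlinIdeal) (ζ := π (X 2)) (f := π (X 3))
    (p := π (X 4)) (t := π (X 5)) (u := π (X 6)) (q := π (X 7)) (v := π (X 8)) (bU := π (X 9))
    (bF := π (X 10)) (Z := π jetZ) (K := π jetK) (S := π (jetSource Φ))
    (Φ0 := π (subst baseVars (restrict Φ)))
    (Φz := π (subst baseVars (MvPowerSeries.pderiv ℂ 0 (restrict Φ))))
    (Φζ := π (subst baseVars (MvPowerSeries.pderiv ℂ 2 (restrict Φ))))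
    (Ψ := π (subst jetTarget Φ))
    (by exact hX _ _ (by decide) (by decide)) (by exact hX _ _ (by decide) (by decide))
    (by exact hX _ _ (by decide) (by decide)) (by exact hX _ _ (by decide) (by decide))
    (by exact hX _ _ (by decide) (by decide)) (by exact hX _ _ (by decide) (by decide))
    (by exact hX _ _ (by decide) (by decide)) (by exact hX _ _ (by decide) (by decide))
    (by exact hX _ _ (by decide) (by decide)) (by exact hX _ _ (by decide) (by decide))
    (by exact hX _ _ (by decide) (by decide)) (by exact hX _ _ (by decide) (by decide))
    (by exact hX _ _ (by decide) (by decide)) (by exact hX _ _ (by decide) (by decide))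
    (by exact hX _ _ (by decide) (by decide)) (by exact hX _ _ (by decide) (by decide))
    (by exact hX _ _ (by decide) (by decide)) (by exact hX _ _ (by decide) (by decide))
    (by exact hX _ _ (by decide) (by decide)) (by exact hX _ _ (by decide) (by decide))
    (by exact hX _ _ (by decide) (by decide)) (by exact hX _ _ (by decide) (by decide))
    (by exact hX _ _ (by decide) (by decide)) (by exact hX _ _ (by decide) (by decide))
    (by exact hX _ _ (by decide) (by decide))
    hUP (hunit _ constantCoeff_jetK)
    hZ (by rw [hKe]; ring) (by rw [hΨ]; simp only [map_add, map_mul, map_sub]; rfl)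
    (by rw [hS]; ring)
  refine key.trans ?_
  simp only [jetLinear, map_add, map_mul, map_sub, map_pow, map_ofNat]
  rfl

end JetFormula
end SingODE
end

noncomputable section
namespace SingODE
open scoped ENNReal NNReal
open MvPowerSeries (coeff constantCoeff subst HasSubst X pderiv)

/-! ### Coefficients and the derivations `∂_z` and `w ∂_w` -/

section Coefficients

/-- The exponent of the monomial `z ^ i * w ^ k`. -/
def ex (i k : ℕ) : Fin 2 →₀ ℕ := Finsupp.equivFunOnFinite.symm ![i, k]

/-- The coefficient of `z ^ i * w ^ k`. -/
def c2 (f : Series2) (i k : ℕ) : ℂ := coeff (ex i k) f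

@[simp] theorem ex_zero (i k : ℕ) : ex i k 0 = i := rfl
@[simp] theorem ex_one (i k : ℕ) : ex i k 1 = k := rfl
@[simp] theorem expo_zero (a b c : ℕ) : expo a b c 0 = a := rfl
@[simp] theorem expo_one (a b c : ℕ) : expo a b c 1 = b := rfl
@[simp] theorem expo_two (a b c : ℕ) : expo a b c 2 = c := rfl

theorem ex_eq (d : Fin 2 →₀ ℕ) : ex (d 0) (d 1) = d := by
  ext i; fin_cases i <;> rfl

theorem expo_eq (d : Fin 3 →₀ ℕ) : expo (d 0) (d 1) (d 2) = d := by
  ext i; fin_cases i <;> rfl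

theorem coeff_eq_c2 (f : Series2) (d : Fin 2 →₀ ℕ) : coeff d f = c2 f (d 0) (d 1) := by
  rw [c2, ex_eq]

theorem coeff_eq_cf (f : Series3) (d : Fin 3 →₀ ℕ) : coeff d f = cf f (d 0) (d 1) (d 2) := by
  rw [cf, expo_eq]

theorem series2_ext {f g : Series2} (h : ∀ i k, c2 f i k = c2 g i k) : f = g := by
  ext d; rw [coeff_eq_c2, coeff_eq_c2, h]

theorem series3_ext {f g : Series3} (h : ∀ a b c, cf f a b c = cf g a b c) : f = g := by
  ext d; rw [coeff_eq_cf, coeff_eq_cf, h]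

theorem c2_add (f g : Series2) (i k : ℕ) : c2 (f + g) i k = c2 f i k + c2 g i k := map_add _ _ _
theorem c2_sub (f g : Series2) (i k : ℕ) : c2 (f - g) i k = c2 f i k - c2 g i k := map_sub _ _ _
theorem c2_neg (f : Series2) (i k : ℕ) : c2 (-f) i k = -c2 f i k := map_neg _ _
theorem c2_zero (i k : ℕ) : c2 0 i k = 0 := map_zero _
theorem cf_add (f g : Series3) (a b c : ℕ) : cf (f + g) a b c = cf f a b c + cf g a b c :=
  map_add _ _ _
theorem cf_sub (f g : Series3) (a b c : ℕ) : cf (f - g) a b c = cf f a b c - cf g a b c :=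
  map_sub _ _ _
theorem cf_zero (a b c : ℕ) : cf 0 a b c = 0 := map_zero _

theorem X_one_pow_dvd_iff₂ {n : ℕ} {f : Series2} :
    (X 1 : Series2) ^ n ∣ f ↔ ∀ i k, k < n → c2 f i k = 0 := by
  rw [MvPowerSeries.X_pow_dvd_iff]
  exact ⟨fun h i k hk => h _ hk, fun h d hd => by rw [coeff_eq_c2]; exact h _ _ hd⟩

theorem X_one_dvd_iff₂ {f : Series2} : (X 1 : Series2) ∣ f ↔ ∀ i, c2 f i 0 = 0 := by
  rw [← pow_one (X 1 : Series2), X_one_pow_dvd_iff₂]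
  exact ⟨fun h i => h i 0 one_pos, fun h i k hk => by
    obtain rfl : k = 0 := by omega
    exact h i⟩

theorem X_one_pow_dvd_iff₃ {n : ℕ} {f : Series3} :
    (X 1 : Series3) ^ n ∣ f ↔ ∀ a b c, b < n → cf f a b c = 0 := by
  rw [MvPowerSeries.X_pow_dvd_iff]
  exact ⟨fun h i k c hk => h _ hk, fun h d hd => by rw [coeff_eq_cf]; exact h _ _ _ hd⟩

theorem X_two_sq_dvd_iff {f : Series3} :
    (X 2 : Series3) ^ 2 ∣ f ↔ ∀ a b, cf f a b 0 = 0 ∧ cf f a b 1 = 0 := by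
  rw [MvPowerSeries.X_pow_dvd_iff]
  refine ⟨fun h a b => ⟨h _ (by simp), h _ (by simp)⟩, fun h d hd => ?_⟩
  rw [coeff_eq_cf]
  have : d 2 = 0 ∨ d 2 = 1 := by omega
  rcases this with h2 | h2 <;> rw [h2]
  · exact (h _ _).1
  · exact (h _ _).2

theorem cf_lift (f : Series2) (a b c : ℕ) : cf (lift f) a b c = if c = 0 then c2 f a b else 0 := by
  let e : Fin 2 ↪ Fin 3 := ⟨Fin.castSucc, Fin.castSucc_injective 2⟩
  split_ifs with h
  · subst h
    have h1 : expo a b 0 = (ex a b).embDomain e := by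
      ext i
      fin_cases i
      · exact (Finsupp.embDomain_apply_self e (ex a b) 0).symm
      · exact (Finsupp.embDomain_apply_self e (ex a b) 1).symm
      · refine (Finsupp.embDomain_of_notMem_range e (ex a b) 2 ?_).symm
        rintro ⟨j, hj⟩
        exact absurd hj (Fin.castSucc_lt_last j).ne
    rw [cf, h1]
    exact MvPowerSeries.coeff_embDomain_rename e f _
  · refine MvPowerSeries.coeff_rename_eq_zero (f := (Fin.castSucc : Fin 2 → Fin 3)) f ?_
    rintro ⟨d, hd⟩
    apply h
    have h2 := DFunLike.congr_fun hd 2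
    rw [expo_two] at h2
    rw [← h2]
    refine Finsupp.mapDomain_of_notMem_range _ _ ?_
    rintro ⟨j, hj⟩
    exact absurd hj (Fin.castSucc_lt_last j).ne

theorem lift_add (f g : Series2) : lift (f + g) = lift f + lift g := map_add _ _ _
theorem lift_sub (f g : Series2) : lift (f - g) = lift f - lift g := map_sub _ _ _
theorem lift_mul (f g : Series2) : lift (f * g) = lift f * lift g := map_mul _ _ _
theorem lift_one : lift 1 = 1 := map_one _
theorem lift_zero : lift 0 = 0 := map_zero _
theorem lift_X_zero : lift (X 0) = X 0 := MvPowerSeries.rename_X _ _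
theorem lift_X_one : lift (X 1) = X 1 := MvPowerSeries.rename_X _ _

theorem constantCoeff_lift (f : Series2) : constantCoeff (lift f) = constantCoeff f :=
  MvPowerSeries.constantCoeff_rename _ f

theorem X_one_dvd_lift {f : Series2} {n : ℕ} (h : (X 1 : Series2) ^ n ∣ f) :
    (X 1 : Series3) ^ n ∣ lift f := by
  obtain ⟨g, rfl⟩ := h
  rw [lift_mul, lift, map_pow, ← lift, lift_X_one]
  exact dvd_mul_right _ _

theorem ex_add_single_zero (i k : ℕ) : ex i k + Finsupp.single 0 1 = ex (i + 1) k := by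
  ext j; fin_cases j <;> simp [ex]

theorem ex_add_single_one (i k : ℕ) : ex i k + Finsupp.single 1 1 = ex i (k + 1) := by
  ext j; fin_cases j <;> simp [ex]

theorem expo_add_single_zero (a b c : ℕ) : expo a b c + Finsupp.single 0 1 = expo (a + 1) b c := by
  ext j; fin_cases j <;> simp [expo]

theorem expo_add_single_one (a b c : ℕ) : expo a b c + Finsupp.single 1 1 = expo a (b + 1) c := by
  ext j; fin_cases j <;> simp [expo]

theorem expo_add_single_two (a b c : ℕ) : expo a b c + Finsupp.single 2 1 = expo a b (c + 1) := by
  ext j; fin_cases j <;> simp [expo]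

/-- The derivative with respect to `z`. -/
def dz (f : Series2) : Series2 := pderiv ℂ 0 f
/-- The Euler derivative `w ∂/∂w`. -/
def th (f : Series2) : Series2 := X 1 * pderiv ℂ 1 f

theorem c2_dz (f : Series2) (i k : ℕ) : c2 (dz f) i k = (i + 1) * c2 f (i + 1) k := by
  rw [c2, dz, MvPowerSeries.coeff_pderiv, ex_add_single_zero, ex_zero, mul_comm]; rfl

theorem c2_pderiv_one (f : Series2) (i k : ℕ) :
    c2 (pderiv ℂ 1 f) i k = (k + 1) * c2 f i (k + 1) := by
  rw [c2, MvPowerSeries.coeff_pderiv, ex_add_single_one, ex_one, mul_comm]; rfl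

theorem c2_X_one_mul (f : Series2) (i k : ℕ) : c2 (X 1 * f) i (k + 1) = c2 f i k := by
  rw [c2, MvPowerSeries.X_def, ← ex_add_single_one, add_comm, MvPowerSeries.coeff_add_monomial_mul,
    one_mul]; rfl

theorem c2_X_one_mul_zero (f : Series2) (i : ℕ) : c2 (X 1 * f) i 0 = 0 :=
  X_one_dvd_iff₂.1 (dvd_mul_right _ _) i

theorem c2_th (f : Series2) (i k : ℕ) : c2 (th f) i k = k * c2 f i k := by
  cases k with
  | zero => simp [th, c2_X_one_mul_zero]
  | succ k => rw [th, c2_X_one_mul, c2_pderiv_one]; push_cast; ring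

theorem cf_pderiv_zero (f : Series3) (a b c : ℕ) :
    cf (pderiv ℂ 0 f) a b c = (a + 1) * cf f (a + 1) b c := by
  rw [cf, MvPowerSeries.coeff_pderiv, expo_add_single_zero, expo_zero, mul_comm]; rfl

theorem cf_pderiv_one (f : Series3) (a b c : ℕ) :
    cf (pderiv ℂ 1 f) a b c = (b + 1) * cf f a (b + 1) c := by
  rw [cf, MvPowerSeries.coeff_pderiv, expo_add_single_one, expo_one, mul_comm]; rfl

theorem cf_pderiv_two (f : Series3) (a b c : ℕ) :
    cf (pderiv ℂ 2 f) a b c = (c + 1) * cf f a b (c + 1) := by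
  rw [cf, MvPowerSeries.coeff_pderiv, expo_add_single_two, expo_two, mul_comm]; rfl

theorem pderiv_zero_lift (f : Series2) : pderiv ℂ 0 (lift f) = lift (dz f) := by
  refine series3_ext fun a b c => ?_
  rw [cf_pderiv_zero, cf_lift, cf_lift, c2_dz]; split_ifs <;> simp

theorem X_one_mul_pderiv_one_lift (f : Series2) : X 1 * pderiv ℂ 1 (lift f) = lift (th f) := by
  rw [th, lift_mul, lift_X_one]
  congr 1
  refine series3_ext fun a b c => ?_
  rw [cf_pderiv_one, cf_lift, cf_lift, c2_pderiv_one]; split_ifs <;> simp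

theorem pderiv_two_lift (f : Series2) : pderiv ℂ 2 (lift f) = 0 := by
  refine series3_ext fun a b c => ?_
  rw [cf_pderiv_two, cf_lift, cf_zero]; simp

theorem dz_th (f : Series2) : dz (th f) = th (dz f) := series2_ext fun i k => by
  simp only [c2_dz, c2_th]; ring

theorem X_one_pow_dvd_dz {n : ℕ} {f : Series2} (h : (X 1 : Series2) ^ n ∣ f) :
    (X 1 : Series2) ^ n ∣ dz f := by
  rw [X_one_pow_dvd_iff₂] at h ⊢
  intro i k hk; rw [c2_dz, h _ _ hk, mul_zero]

theorem X_one_pow_dvd_th {n : ℕ} {f : Series2} (h : (X 1 : Series2) ^ n ∣ f) :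
    (X 1 : Series2) ^ n ∣ th f := by
  rw [X_one_pow_dvd_iff₂] at h ⊢
  intro i k hk; rw [c2_th, h _ _ hk, mul_zero]

theorem dz_add (f g : Series2) : dz (f + g) = dz f + dz g := map_add _ _ _
theorem dz_sub (f g : Series2) : dz (f - g) = dz f - dz g := map_sub _ _ _
theorem th_sub (f g : Series2) : th (f - g) = th f - th g := by simp [th, mul_sub]

end Coefficients

/-! ### The transformation rule in terms of jets -/

section TotalDerivative

theorem totalDeriv_mul (N A B : Series3) :
    totalDeriv N (A * B) = totalDeriv N A * B + A * totalDeriv N B := by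
  simp only [totalDeriv, Derivation.leibniz, smul_eq_mul]; ring

theorem totalDeriv_add (N A B : Series3) :
    totalDeriv N (A + B) = totalDeriv N A + totalDeriv N B := by
  simp only [totalDeriv, map_add]; ring

theorem totalDeriv_X_one (N : Series3) : totalDeriv N (X 1) = X 1 * X 2 := by
  rw [totalDeriv, MvPowerSeries.pderiv_X_of_ne (by decide), MvPowerSeries.pderiv_X_self,
    MvPowerSeries.pderiv_X_of_ne (by decide)]; ring

theorem totalDeriv_X_two (N : Series3) : totalDeriv N (X 2) = N - X 2 ^ 2 := by
  rw [totalDeriv, MvPowerSeries.pderiv_X_of_ne (by decide), MvPowerSeries.pderiv_X_self,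
    MvPowerSeries.pderiv_X_of_ne (by decide)]; ring

/-- The part of the total derivative of a series in `z, w` along the solutions. -/
def jet1 (f : Series2) : Series3 := lift (dz f) + X 2 * lift (th f)

/-- The second total derivative of a series in `z, w` at constant `ζ`. -/
def jet2 (f : Series2) : Series3 :=
  lift (dz (dz f)) + 2 * X 2 * lift (th (dz f)) + X 2 ^ 2 * lift (th (th f))

theorem totalDeriv_lift (N : Series3) (f : Series2) : totalDeriv N (lift f) = jet1 f := by
  rw [totalDeriv, pderiv_zero_lift, pderiv_two_lift, mul_right_comm, X_one_mul_pderiv_one_lift,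
    jet1]; ring

theorem totalDeriv_jet1 (N : Series3) (f : Series2) :
    totalDeriv N (jet1 f) = jet2 f + (N - X 2 ^ 2) * lift (th f) := by
  rw [jet1, totalDeriv_add, totalDeriv_mul, totalDeriv_X_two, totalDeriv_lift, totalDeriv_lift,
    jet1, jet1, jet2, dz_th]; ring

theorem dz_X_zero_add (f : Series2) : dz (X 0 + f) = 1 + dz f := by
  rw [dz_add, dz, MvPowerSeries.pderiv_X_self]

theorem th_X_zero_add (f : Series2) : th (X 0 + f) = th f := by
  rw [th, map_add, MvPowerSeries.pderiv_X_of_ne (by decide), zero_add, th]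

theorem jet1_X_zero_add (f : Series2) : jet1 (X 0 + f) = 1 + jet1 f := by
  rw [jet1, dz_X_zero_add, th_X_zero_add, lift_add, lift_one, jet1]; ring

theorem dz_one_add (f : Series2) : dz (1 + f) = dz f := by
  rw [dz_add, dz, MvPowerSeries.pderiv_one, zero_add]

theorem th_one_add (f : Series2) : th (1 + f) = th f := by
  rw [th, map_add, MvPowerSeries.pderiv_one, zero_add, th]

theorem jet1_one_add (f : Series2) : jet1 (1 + f) = jet1 f := by
  rw [jet1, dz_one_add, th_one_add, jet1]

theorem X_one_ne_zero : (X 1 : Series3) ≠ 0 := fun h => by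
  have := congrArg (coeff (Finsupp.single 1 1)) h
  simp at this

/-- The transformation rule, with the powers of `w` cancelled. -/
theorem transforms_iff_exists {N Φ : Series3} {f u : Series2}
    (hP : constantCoeff (jet1 f) = 0) :
    Transforms N Φ (X 0 + f) (X 1 * (1 + u)) ↔
    ∃ Z : Series3, (1 + lift u) * (1 + jet1 f) * Z = X 2 * (1 + lift u) + jet1 u ∧
      (1 + lift u + lift (th u) - lift (th f) * ((1 + lift u) * Z)) * (N - X 2 ^ 2) =
      (1 + jet1 f) ^ 2 * (1 + lift u) * subst ![X 0 + lift f, X 1 * (1 + lift u), Z] Φ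
        - X 2 ^ 2 * (1 + lift u) - 2 * X 2 * jet1 u - jet2 u + jet2 f * ((1 + lift u) * Z) := by
  have hF : lift (X 0 + f) = X 0 + lift f := by rw [lift_add, lift_X_zero]
  have hU : lift (1 + u) = 1 + lift u := by rw [lift_add, lift_one]
  have hG : lift (X 1 * (1 + u)) = X 1 * (1 + lift u) := by rw [lift_mul, lift_X_one, hU]
  have hDF : totalDeriv N (X 0 + lift f) = 1 + jet1 f := by
    rw [← hF, totalDeriv_lift, jet1_X_zero_add]
  have hDU : totalDeriv N (1 + lift u) = jet1 u := by
    rw [← hU, totalDeriv_lift, jet1_one_add]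
  have hDP : totalDeriv N (1 + jet1 f) = jet2 f + (N - X 2 ^ 2) * lift (th f) := by
    rw [← jet1_X_zero_add, totalDeriv_jet1, jet2, jet2, th_X_zero_add, dz_X_zero_add, dz_one_add,
      th_one_add]
  have hDG : totalDeriv N (X 1 * (1 + lift u)) = X 1 * (X 2 * (1 + lift u) + jet1 u) := by
    rw [totalDeriv_mul, totalDeriv_X_one, hDU]; ring
  have hDDG : totalDeriv N (X 1 * (X 2 * (1 + lift u) + jet1 u)) =
      X 1 * (X 2 * (X 2 * (1 + lift u) + jet1 u) + (N - X 2 ^ 2) * (1 + lift u) + X 2 * jet1 u +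
        (jet2 u + (N - X 2 ^ 2) * lift (th u))) := by
    rw [totalDeriv_mul, totalDeriv_X_one, totalDeriv_add, totalDeriv_mul, totalDeriv_X_two, hDU,
      totalDeriv_jet1]; ring
  have hP0 : (1 + jet1 f : Series3) ≠ 0 := fun h => by
    have := congrArg constantCoeff h
    simp [hP] at this
  unfold Transforms
  rw [hF, hG, hDF, hDG]
  refine exists_congr fun Z => ?_
  have h1 : (X 1 * (X 2 * (1 + lift u) + jet1 u) = (1 + jet1 f) * (X 1 * (1 + lift u) * Z)) ↔
      (1 + lift u) * (1 + jet1 f) * Z = X 2 * (1 + lift u) + jet1 u := by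
    rw [show (1 + jet1 f) * (X 1 * (1 + lift u) * Z) =
      X 1 * ((1 + lift u) * (1 + jet1 f) * Z) by ring, mul_right_inj' X_one_ne_zero, eq_comm]
  rw [h1]
  refine and_congr_right fun hZ => ?_
  -- Differentiating `D G = D F * (G Z)` removes `D (G Z)`: multiplied by `D F`, the second relation
  -- becomes `D² G - D² F * (G Z) = (D F)² G Ψ`, where `N` enters only through `D² F` and `D² G`,
  -- and affinely.
  have h2 := congrArg (totalDeriv N) (h1.2 hZ)
  rw [hDDG, totalDeriv_mul, hDP] at h2
  rw [← mul_right_inj' hP0, ← mul_right_inj' X_one_ne_zero (b := (1 + lift u + lift (th u) -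
    lift (th f) * ((1 + lift u) * Z)) * (N - X 2 ^ 2))]
  constructor
  · intro h
    linear_combination h2 + h
  · intro h
    linear_combination h - h2

/-- The values of the eleven variables of `jetSource` at the map `(z + f, w + w u)`. -/
def jetVars (f u : Series2) : Fin 11 → Series3 :=
  ![X 0, X 1, X 2, lift f, jet1 f, lift (th f), lift u, jet1 u, lift (th u), jet2 u, jet2 f]

theorem X_one_pow_dvd_jet1 {n : ℕ} {f : Series2} (h : (X 1 : Series2) ^ n ∣ f) :
    (X 1 : Series3) ^ n ∣ jet1 f :=
  dvd_add (X_one_dvd_lift (X_one_pow_dvd_dz h))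
    ((X_one_dvd_lift (X_one_pow_dvd_th h)).mul_left _)

theorem X_one_pow_dvd_jet2 {n : ℕ} {f : Series2} (h : (X 1 : Series2) ^ n ∣ f) :
    (X 1 : Series3) ^ n ∣ jet2 f :=
  dvd_add (dvd_add (X_one_dvd_lift (X_one_pow_dvd_dz (X_one_pow_dvd_dz h)))
    ((X_one_dvd_lift (X_one_pow_dvd_th (X_one_pow_dvd_dz h))).mul_left _))
    ((X_one_dvd_lift (X_one_pow_dvd_th (X_one_pow_dvd_th h))).mul_left _)

theorem X_one_dvd_jetVars {f u : Series2} (hf : (X 1 : Series2) ∣ f) (hu : (X 1 : Series2) ∣ u)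
    (i : Fin 11) (hi : 3 ≤ i) : (X 1 : Series3) ∣ jetVars f u i := by
  rw [← pow_one (X 1 : Series2)] at hf hu
  rw [← pow_one (X 1 : Series3)]
  fin_cases i
  iterate 3 exact absurd hi (by decide)
  · exact X_one_dvd_lift hf
  · exact X_one_pow_dvd_jet1 hf
  · exact X_one_dvd_lift (X_one_pow_dvd_th hf)
  · exact X_one_dvd_lift hu
  · exact X_one_pow_dvd_jet1 hu
  · exact X_one_dvd_lift (X_one_pow_dvd_th hu)
  · exact X_one_pow_dvd_jet2 hu
  · exact X_one_pow_dvd_jet2 hf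

theorem constantCoeff_eq_zero_of_X_one_dvd {A : Series3} (h : (X 1 : Series3) ∣ A) :
    constantCoeff A = 0 := by
  obtain ⟨B, rfl⟩ := h; simp

theorem hasSubst_jetVars {f u : Series2} (hf : (X 1 : Series2) ∣ f) (hu : (X 1 : Series2) ∣ u) :
    HasSubst (jetVars f u) := by
  refine MvPowerSeries.hasSubst_of_constantCoeff_zero fun i => ?_
  by_cases hi : 3 ≤ i
  · exact constantCoeff_eq_zero_of_X_one_dvd (X_one_dvd_jetVars hf hu i hi)
  · have : i = 0 ∨ i = 1 ∨ i = 2 := by omega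
    rcases this with rfl | rfl | rfl <;> simp [jetVars]

/-- A map determines the source equation. -/
theorem transforms_iff {N Φ : Series3} {f u : Series2}
    (hf : (X 1 : Series2) ∣ f) (hu : (X 1 : Series2) ∣ u) :
    Transforms N Φ (X 0 + f) (X 1 * (1 + u)) ↔ N = subst (jetVars f u) (jetSource Φ) := by
  have hs := hasSubst_jetVars hf hu
  have hp0 := constantCoeff_eq_zero_of_X_one_dvd (X_one_dvd_jetVars hf hu 4 (by decide))
  have hu0 := constantCoeff_eq_zero_of_X_one_dvd (X_one_dvd_jetVars hf hu 6 (by decide))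
  have hv0 := constantCoeff_eq_zero_of_X_one_dvd (X_one_dvd_jetVars hf hu 8 (by decide))
  have ht0 := constantCoeff_eq_zero_of_X_one_dvd (X_one_dvd_jetVars hf hu 5 (by decide))
  replace hp0 : constantCoeff (jet1 f) = 0 := hp0
  replace hu0 : constantCoeff (lift u) = 0 := hu0
  replace hv0 : constantCoeff (lift (th u)) = 0 := hv0
  replace ht0 : constantCoeff (lift (th f)) = 0 := ht0
  rw [transforms_iff_exists hp0]
  have hφ : ∀ i, subst (jetVars f u) (X i : JetSeries) = jetVars f u i :=
    MvPowerSeries.subst_X hs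
  have hone : subst (jetVars f u) (1 : JetSeries) = 1 := by
    rw [← MvPowerSeries.coe_substAlgHom hs, map_one]
  have htwo : subst (jetVars f u) (2 : JetSeries) = 2 := by
    rw [← MvPowerSeries.coe_substAlgHom hs, map_ofNat]
  have hφU : subst (jetVars f u) jetU = 1 + lift u := by
    rw [jetU, MvPowerSeries.subst_add hs, hone, hφ]; rfl
  have hφP : subst (jetVars f u) jetP = 1 + jet1 f := by
    rw [jetP, MvPowerSeries.subst_add hs, hone, hφ]; rfl
  set Z₀ := subst (jetVars f u) jetZ with hZ₀
  have hφZ : (1 + lift u) * (1 + jet1 f) * Z₀ = X 2 * (1 + lift u) + jet1 u := by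
    have := congrArg (subst (jetVars f u)) jetU_mul_jetP_mul_jetZ
    simp only [MvPowerSeries.subst_mul hs, MvPowerSeries.subst_add hs, hφU, hφP, hφ] at this
    exact this
  have hφK : subst (jetVars f u) jetK =
      1 + lift u + lift (th u) - lift (th f) * ((1 + lift u) * Z₀) := by
    rw [jetK, MvPowerSeries.subst_sub hs, MvPowerSeries.subst_add hs, hφU, MvPowerSeries.subst_mul hs,
      MvPowerSeries.subst_mul hs, hφU, hφ, hφ]; rfl
  have hφT : subst (jetVars f u) (subst jetTarget Φ) =
      subst ![X 0 + lift f, X 1 * (1 + lift u), Z₀] Φ := by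
    rw [MvPowerSeries.subst_comp_subst_apply hasSubst_jetTarget hs]
    congr 1
    funext i
    fin_cases i
    · simp only [jetTarget, Fin.zero_eta, Matrix.cons_val_zero, MvPowerSeries.subst_add hs, hφ]; rfl
    · simp only [jetTarget, Fin.mk_one, Matrix.cons_val_one, Matrix.cons_val_zero,
        MvPowerSeries.subst_mul hs, hφ, hφU]; rfl
    · rfl
  have hφS := congrArg (subst (jetVars f u)) (jetK_mul_jetSource Φ)
  simp only [MvPowerSeries.subst_mul hs, MvPowerSeries.subst_add hs, MvPowerSeries.subst_sub hs,
    MvPowerSeries.subst_pow hs, hφU, hφP, hφK, hφT, hφ, htwo] at hφS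
  change _ * (_ - X 2 ^ 2) = _ - X 2 ^ 2 * _ - 2 * X 2 * jet1 u - jet2 u +
    jet2 f * ((1 + lift u) * Z₀) at hφS
  have hUP0 : ((1 + lift u) * (1 + jet1 f) : Series3) ≠ 0 := fun h => by
    have := congrArg constantCoeff h
    simp [hp0, hu0] at this
  -- The coefficient of `N - ζ²` has constant term `1`, so the relation determines `N`.
  have hK0 : (1 + lift u + lift (th u) - lift (th f) * ((1 + lift u) * Z₀) : Series3) ≠ 0 :=
    fun h => by
      have := congrArg constantCoeff h
      simp [hv0, hu0, ht0] at this
  constructor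
  · rintro ⟨Z, hZ, hN⟩
    obtain rfl : Z = Z₀ := mul_left_cancel₀ hUP0 (hZ.trans hφZ.symm)
    have := mul_left_cancel₀ hK0 (hN.trans hφS.symm)
    linear_combination this
  · rintro rfl
    exact ⟨Z₀, hφZ, hφS⟩

end TotalDerivative

/-! ### Normalized maps are the identity on `w = 0` -/

section Normalized

theorem normalized_of_dvd {f u : Series2} (hf : (X 1 : Series2) ∣ f) (hu : (X 1 : Series2) ∣ u) :
    Normalized (X 0 + f) (X 1 * (1 + u)) := by
  refine ⟨?_, ?_, ?_⟩
  · obtain ⟨g, rfl⟩ := hf; simp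
  · rw [map_add, MvPowerSeries.coeff_index_single_self_X, MvPowerSeries.X_dvd_iff.1 hf _ (by simp),
      add_zero]
  · obtain ⟨g, rfl⟩ := hu
    exact ⟨g, by ring⟩

/-- A normalized map between two equations is the identity on `w = 0`. -/
theorem exists_of_mem_hom {N Φ : Series3} (hN : N ∈ ODE1) (hΦ : Φ ∈ ODE1) {F G : Series2}
    (h : (F, G) ∈ Hom N Φ) :
    ∃ f u : Series2, (X 1 : Series2) ∣ f ∧ (X 1 : Series2) ∣ u ∧ F = X 0 + f ∧
      G = X 1 * (1 + u) := by
  obtain ⟨⟨hF0, hF1, k, hk⟩, hT⟩ := h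
  simp only at hF0 hF1 hk hT
  set f := F - X 0 with hf
  set u := X 1 * k with hu
  have hFf : F = X 0 + f := by rw [hf]; ring
  have hGu : G = X 1 * (1 + u) := by rw [hu]; linear_combination hk
  have hu1 : (X 1 : Series2) ^ 1 ∣ u := by rw [pow_one]; exact dvd_mul_right _ _
  refine ⟨f, u, ?_, dvd_mul_right _ _, hFf, hGu⟩
  have hf00 : c2 f 0 0 = 0 := by
    have : ex 0 0 = 0 := by ext i; fin_cases i <;> rfl
    rw [c2, this, MvPowerSeries.coeff_zero_eq_constantCoeff_apply, hf, map_sub, hF0]; simp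
  have hf10 : c2 f 1 0 = 0 := by
    have : ex 1 0 = Finsupp.single 0 1 := by ext i; fin_cases i <;> simp [ex]
    rw [c2, this, hf, map_sub, hF1, MvPowerSeries.coeff_index_single_self_X, sub_self]
  have hconst : ∀ g : Series2, constantCoeff g = c2 g 0 0 := by
    intro g
    have : ex 0 0 = 0 := by ext i; fin_cases i <;> rfl
    rw [c2, this, MvPowerSeries.coeff_zero_eq_constantCoeff_apply]
  have hp0 : constantCoeff (jet1 f) = 0 := by
    rw [jet1, map_add, map_mul, MvPowerSeries.constantCoeff_X, zero_mul, add_zero,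
      constantCoeff_lift, hconst, c2_dz, hf10, mul_zero]
  rw [hFf, hGu, transforms_iff_exists hp0] at hT
  obtain ⟨Z, hZ, hE⟩ := hT
  have hlu : (X 1 : Series3) ∣ lift u := by simpa using X_one_dvd_lift hu1
  have hlv : (X 1 : Series3) ∣ lift (th u) := by simpa using X_one_dvd_lift (X_one_pow_dvd_th hu1)
  have hlt : ∀ g, (X 1 : Series3) ∣ lift (th g) := fun g => by
    rw [th, lift_mul, lift_X_one]; exact dvd_mul_right _ _
  have hlq : (X 1 : Series3) ∣ jet1 u := by simpa using X_one_pow_dvd_jet1 hu1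
  have hlb : (X 1 : Series3) ∣ jet2 u := by simpa using X_one_pow_dvd_jet2 hu1
  have hZ0 : constantCoeff Z = 0 := by
    have := congrArg constantCoeff hZ
    simpa [constantCoeff_eq_zero_of_X_one_dvd hlu, hp0,
      constantCoeff_eq_zero_of_X_one_dvd hlq] using this
  have hsub : HasSubst ![X 0 + lift f, X 1 * (1 + lift u), Z] := by
    refine MvPowerSeries.hasSubst_of_constantCoeff_zero fun i => ?_
    fin_cases i
    · simp [constantCoeff_lift, hconst, hf00]
    · simp
    · simpa using hZ0
  obtain ⟨N', rfl⟩ := hN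
  obtain ⟨Φ', rfl⟩ := hΦ
  rw [MvPowerSeries.subst_mul hsub, MvPowerSeries.subst_pow hsub, MvPowerSeries.subst_X hsub,
    show (![X 0 + lift f, X 1 * (1 + lift u), Z] : Fin 3 → Series3) 2 = Z from rfl] at hE
  set Ψ := subst ![X 0 + lift f, X 1 * (1 + lift u), Z] Φ'
  have hb : (X 1 : Series3) ∣ jet2 f - lift (dz (dz f)) := by
    rw [jet2, add_sub_right_comm, add_sub_right_comm, sub_self, zero_add]
    exact dvd_add ((hlt _).mul_left _) ((hlt _).mul_left _)
  -- Modulo `w` one has `u = 0`, `θf = 0` and `P Z = ζ` with `P = 1 + f_z`, while `N = ζ² N'` and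
  -- the substituted target is `Z² Ψ`. The rule times `P` becomes `ζ f_zz = ζ² P (N' - Ψ)`, so
  -- `f_zz` vanishes on `w = 0`.
  have key : ∃ A : Series3, (X 1 : Series3) ∣ X 2 * lift (dz (dz f)) - X 2 ^ 2 * A := by
    refine ⟨(1 + jet1 f) * N' - (1 + jet1 f) * Ψ, ?_⟩
    obtain ⟨u', hu'⟩ := hlu
    obtain ⟨v', hv'⟩ := hlv
    obtain ⟨t', ht'⟩ := hlt f
    obtain ⟨q', hq'⟩ := hlq
    obtain ⟨b', hb'⟩ := hlb
    obtain ⟨c', hc'⟩ := hb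
    rw [sub_eq_iff_eq_add] at hc'
    rw [hu', hv', ht', hq', hb', hc'] at hE
    rw [hu', hq'] at hZ
    rw [← Ideal.mem_span_singleton, ← Ideal.Quotient.eq_zero_iff_mem]
    have hw : Ideal.Quotient.mk (Ideal.span {(X 1 : Series3)}) (X 1) = 0 :=
      Ideal.Quotient.eq_zero_iff_mem.2 (Ideal.mem_span_singleton_self _)
    have hE' := congrArg (Ideal.Quotient.mk (Ideal.span {(X 1 : Series3)})) hE
    have hZ' := congrArg (Ideal.Quotient.mk (Ideal.span {(X 1 : Series3)})) hZ
    simp only [map_add, map_mul, map_sub, map_one, map_pow, map_ofNat, hw, zero_mul, mul_zero,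
      add_zero, sub_zero, mul_one, zero_add, one_mul] at hE' hZ' ⊢
    generalize Ideal.Quotient.mk (Ideal.span {(X 1 : Series3)}) = π at hE' hZ' ⊢
    grind
  obtain ⟨A, hA⟩ := key
  rw [X_one_dvd_iff₂]
  intro i
  match i with
  | 0 => exact hf00
  | 1 => exact hf10
  | i + 2 =>
    have h1 := MvPowerSeries.X_dvd_iff.1 hA (expo i 0 1) rfl
    have h2 : coeff (expo i 0 1) (X 2 * lift (dz (dz f))) = c2 (dz (dz f)) i 0 := by
      rw [MvPowerSeries.X_def, ← expo_add_single_two, add_comm,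
        MvPowerSeries.coeff_add_monomial_mul, one_mul]
      exact cf_lift _ i 0 0
    have h3 : coeff (expo i 0 1) (X 2 ^ 2 * A) = 0 :=
      MvPowerSeries.X_pow_dvd_iff.1 (dvd_mul_right _ _) _ (by simp)
    rw [map_sub, h2, h3, sub_zero, c2_dz, c2_dz] at h1
    have h4 : ((i : ℂ) + 1) ≠ 0 := by exact_mod_cast Nat.succ_ne_zero i
    have h5 : (((i + 1 : ℕ) : ℂ) + 1) ≠ 0 := by exact_mod_cast Nat.succ_ne_zero (i + 1)
    exact (mul_eq_zero.1 ((mul_eq_zero.1 h1).resolve_left h4)).resolve_left h5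

end Normalized

/-! ### Expansion in powers of `ζ` -/

section ZetaCoefficients

/-- The coefficient of `ζ ^ c` as a series in `z, w`. -/
def zc (c : ℕ) (A : Series3) : Series2 := fun d => cf A (d 0) (d 1) c

/-- The quotient of `A - A(z, w, 0)` by `ζ`. -/
def zshift (A : Series3) : Series3 := fun d => cf A (d 0) (d 1) (d 2 + 1)

theorem c2_zc (c : ℕ) (A : Series3) (i k : ℕ) : c2 (zc c A) i k = cf A i k c := rfl

theorem cf_zshift (A : Series3) (a b c : ℕ) : cf (zshift A) a b c = cf A a b (c + 1) := rfl

theorem zc_add (c : ℕ) (A B : Series3) : zc c (A + B) = zc c A + zc c B :=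
  series2_ext fun i k => by rw [c2_add, c2_zc, c2_zc, c2_zc, cf_add]

theorem cf_X_two_mul (A : Series3) (a b c : ℕ) :
    cf (X 2 * A) a b c = if c = 0 then 0 else cf A a b (c - 1) := by
  cases c with
  | zero =>
    exact MvPowerSeries.X_dvd_iff.1 (dvd_mul_right _ _) _ rfl
  | succ c =>
    rw [cf, MvPowerSeries.X_def, ← expo_add_single_two, add_comm,
      MvPowerSeries.coeff_add_monomial_mul, one_mul]; rfl

theorem eq_lift_add_zshift (A : Series3) : A = lift (zc 0 A) + X 2 * zshift A := by
  refine series3_ext fun a b c => ?_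
  rw [cf_add, cf_lift, cf_X_two_mul]
  cases c with
  | zero => simp [c2_zc]
  | succ c => simp [cf_zshift]

theorem zc_zero_lift_add (f : Series2) (A : Series3) : zc 0 (lift f + X 2 * A) = f :=
  series2_ext fun i k => by rw [c2_zc, cf_add, cf_lift, cf_X_two_mul]; simp

theorem zc_succ_lift_add (c : ℕ) (f : Series2) (A : Series3) :
    zc (c + 1) (lift f + X 2 * A) = zc c A :=
  series2_ext fun i k => by rw [c2_zc, cf_add, cf_lift, cf_X_two_mul, c2_zc]; simp

end ZetaCoefficients

/-! ### The linear part and its coefficients of `ζ^0, …, ζ^3` -/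

section LinearPart

/-- The coefficient of `ζ ^ c` in `Φ(z, 0, ζ)`. -/
def ax (Φ : Series3) (c : ℕ) : Series2 := zc c (restrict Φ)

theorem c2_ax (Φ : Series3) (c i k : ℕ) : c2 (ax Φ c) i k = if k = 0 then cf Φ i 0 c else 0 := by
  rw [ax, c2_zc, cf, coeff_restrict, expo_one]
  split_ifs with h
  · rw [h]; rfl
  · rfl

/-- A factor independent of `w` acts on each power of `w` separately, by the Cauchy product in `z`.
-/
theorem c2_mul_of_level_zero {g : Series2} (hg : ∀ i k, k ≠ 0 → c2 g i k = 0) (f : Series2)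
    (i k : ℕ) : c2 (g * f) i k =
      ∑ p ∈ Finset.HasAntidiagonal.antidiagonal i, c2 g p.1 0 * c2 f p.2 k := by
  classical
  rw [c2, MvPowerSeries.coeff_mul]
  symm
  refine Finset.sum_of_injOn (fun p => (ex p.1 0, ex p.2 k)) ?_ ?_ ?_ ?_
  · rintro p - q - h
    have h1 := DFunLike.congr_fun (congrArg Prod.fst h) 0
    have h2 := DFunLike.congr_fun (congrArg Prod.snd h) 0
    exact Prod.ext h1 h2
  · rintro p hp
    have hp' := Finset.HasAntidiagonal.mem_antidiagonal.1 hp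
    refine Finset.HasAntidiagonal.mem_antidiagonal.2 ?_
    ext j
    fin_cases j
    · exact hp'
    · simp
  · rintro ⟨d, e⟩ hde hnot
    have hde' := Finset.HasAntidiagonal.mem_antidiagonal.1 hde
    have h0 := DFunLike.congr_fun hde' 0
    have h1 := DFunLike.congr_fun hde' 1
    simp only [Finsupp.add_apply, ex_zero, ex_one] at h0 h1
    by_cases hd : d 1 = 0
    · exfalso
      apply hnot
      refine ⟨(d 0, e 0), ?_, ?_⟩
      · exact Finset.HasAntidiagonal.mem_antidiagonal.2 h0
      · have : e 1 = k := by omega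
        simp only
        rw [← this, ← hd, ex_eq, ex_eq]
    · rw [coeff_eq_c2 g, hg _ _ hd, zero_mul]
  · intro p _; rfl

/-- The value of `jetLinear Φ` at a map. -/
def linSource (Φ : Series3) (f u : Series2) : Series3 :=
  restrict Φ + (restrict Φ - X 2 ^ 2) * (2 * jet1 f + X 2 * lift (th f) - lift (th u))
    + lift f * pderiv ℂ 0 (restrict Φ)
    + (pderiv ℂ 2 (restrict Φ) - 2 * X 2) * (jet1 u - X 2 * jet1 f) - jet2 u + X 2 * jet2 f

theorem subst_jetLinear (Φ : Series3) {f u : Series2} (hf : (X 1 : Series2) ∣ f)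
    (hu : (X 1 : Series2) ∣ u) : subst (jetVars f u) (jetLinear Φ) = linSource Φ f u := by
  have hs := hasSubst_jetVars hf hu
  have hφ : ∀ i, subst (jetVars f u) (X i : JetSeries) = jetVars f u i :=
    MvPowerSeries.subst_X hs
  have htwo : subst (jetVars f u) (2 : JetSeries) = 2 := by
    rw [← MvPowerSeries.coe_substAlgHom hs, map_ofNat]
  have hb : ∀ A : Series3, subst (jetVars f u) (subst baseVars A) = A := by
    intro A
    rw [MvPowerSeries.subst_comp_subst_apply hasSubst_baseVars hs]
    have : (fun s => subst (jetVars f u) (baseVars s)) = (X : Fin 3 → Series3) := by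
      funext i
      fin_cases i <;> exact hφ _
    rw [this, MvPowerSeries.subst_self]; rfl
  simp only [jetLinear, MvPowerSeries.subst_mul hs, MvPowerSeries.subst_add hs,
    MvPowerSeries.subst_sub hs, MvPowerSeries.subst_pow hs, hφ, htwo, hb]
  rfl

/-- The coefficients of `ζ ^ 0, …, ζ ^ 3` of the part of `linSource` linear in the map. -/
def lin0 (u : Series2) : Series2 := -dz (dz u)
def lin1 (Φ : Series3) (f u : Series2) : Series2 :=
  2 * (ax Φ 2 * dz u) - 2 * dz u - 2 * th (dz u) + dz (dz f)
def lin2 (Φ : Series3) (f u : Series2) : Series2 :=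
  dz (ax Φ 2) * f + ax Φ 2 * th u - th u + 3 * (ax Φ 3 * dz u) - th (th u) + 2 * th (dz f)
def lin3 (Φ : Series3) (f u : Series2) : Series2 :=
  th (th f) + ax Φ 2 * th f - th f + dz (ax Φ 3) * f - ax Φ 3 * dz f + 2 * (ax Φ 3 * th u)
    + 4 * (ax Φ 4 * dz u)

theorem restrict_mem {Φ : Series3} (hΦ : Φ ∈ ODE1) : restrict Φ ∈ ODE1 := by
  have h := X_two_sq_dvd_iff.1 hΦ
  refine X_two_sq_dvd_iff.2 fun a b => ⟨?_, ?_⟩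
  · rw [cf, coeff_restrict]; split_ifs
    · exact (h a b).1
    · rfl
  · rw [cf, coeff_restrict]; split_ifs
    · exact (h a b).2
    · rfl

/-- Since `Φ(z, 0, ζ)` starts with `ζ²`, its coefficients of `ζ², ζ³, ζ⁴` suffice: `ζ⁴` enters the
coefficient of `ζ³` through `∂Φ/∂ζ` times `u_z`. All higher terms go into `B`. -/
theorem linSource_eq {Φ : Series3} (hΦ : Φ ∈ ODE1) (f u : Series2) :
    ∃ B : Series3, linSource Φ f u = restrict Φ + (lift (lin0 u) + X 2 * (lift (lin1 Φ f u) + X 2 *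
      (lift (lin2 Φ f u) + X 2 * (lift (lin3 Φ f u) + X 2 * B)))) := by
  have h := X_two_sq_dvd_iff.1 (restrict_mem hΦ)
  obtain ⟨Q, hQ⟩ : ∃ Q : Series3, restrict Φ =
      X 2 ^ 2 * lift (ax Φ 2) + X 2 ^ 3 * lift (ax Φ 3) + X 2 ^ 4 * lift (ax Φ 4) + X 2 ^ 5 * Q := by
    have h0 : zc 0 (restrict Φ) = 0 := series2_ext fun i k => by rw [c2_zc, (h i k).1, c2_zero]
    have h1 : zc 0 (zshift (restrict Φ)) = 0 :=
      series2_ext fun i k => by rw [c2_zc, cf_zshift, (h i k).2, c2_zero]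
    have e0 := eq_lift_add_zshift (restrict Φ)
    have e1 := eq_lift_add_zshift (zshift (restrict Φ))
    have e2 := eq_lift_add_zshift (zshift (zshift (restrict Φ)))
    have e3 := eq_lift_add_zshift (zshift (zshift (zshift (restrict Φ))))
    have e4 := eq_lift_add_zshift (zshift (zshift (zshift (zshift (restrict Φ)))))
    rw [h0, lift_zero] at e0
    rw [h1, lift_zero] at e1
    refine ⟨zshift (zshift (zshift (zshift (zshift (restrict Φ))))), ?_⟩
    change _ = lift (ax Φ 2) + _ at e2
    change _ = lift (ax Φ 3) + _ at e3
    change _ = lift (ax Φ 4) + _ at e4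
    linear_combination e0 + X 2 * e1 + X 2 ^ 2 * e2 + X 2 ^ 3 * e3 + X 2 ^ 4 * e4
  have hX0 : ∀ n : ℕ, pderiv ℂ 0 ((X 2 : Series3) ^ n) = 0 := fun n => by
    rw [MvPowerSeries.pderiv_pow, MvPowerSeries.pderiv_X_of_ne (by decide), mul_zero]
  have hX2 : ∀ n : ℕ, pderiv ℂ 2 ((X 2 : Series3) ^ n) = (n : Series3) * X 2 ^ (n - 1) := fun n => by
    rw [MvPowerSeries.pderiv_pow, MvPowerSeries.pderiv_X_self, mul_one]
  have hz : pderiv ℂ 0 (restrict Φ) = X 2 ^ 2 * lift (dz (ax Φ 2)) + X 2 ^ 3 * lift (dz (ax Φ 3))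
      + X 2 ^ 4 * (lift (dz (ax Φ 4)) + X 2 * pderiv ℂ 0 Q) := by
    rw [hQ]
    simp only [map_add, Derivation.leibniz, smul_eq_mul, hX0, pderiv_zero_lift]
    ring
  have hζ : pderiv ℂ 2 (restrict Φ) = 2 * X 2 * lift (ax Φ 2) + 3 * X 2 ^ 2 * lift (ax Φ 3)
      + 4 * X 2 ^ 3 * lift (ax Φ 4) + X 2 ^ 4 * (5 * Q + X 2 * pderiv ℂ 2 Q) := by
    rw [hQ]
    simp only [map_add, Derivation.leibniz, smul_eq_mul, hX2, pderiv_two_lift]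
    push_cast
    ring
  refine ⟨(lift (ax Φ 3) + X 2 * lift (ax Φ 4) + X 2 ^ 2 * Q) * (3 * lift (th f))
      + (lift (ax Φ 4) + X 2 * Q) * (2 * lift (dz f) - lift (th u))
      + lift f * (lift (dz (ax Φ 4)) + X 2 * pderiv ℂ 0 Q)
      - (3 * lift (ax Φ 3) + 4 * X 2 * lift (ax Φ 4) + X 2 ^ 2 * (5 * Q + X 2 * pderiv ℂ 2 Q)) *
        lift (th f)
      + (4 * lift (ax Φ 4) + X 2 * (5 * Q + X 2 * pderiv ℂ 2 Q)) *
        (lift (th u) - lift (dz f))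
      + (5 * Q + X 2 * pderiv ℂ 2 Q) * lift (dz u), ?_⟩
  have l2 : lift 2 = 2 := map_ofNat (MvPowerSeries.rename _) 2
  have l3 : lift 3 = 3 := map_ofNat (MvPowerSeries.rename _) 3
  have l4 : lift 4 = 4 := map_ofNat (MvPowerSeries.rename _) 4
  have ln : ∀ g, lift (-g) = -lift g := map_neg (MvPowerSeries.rename _)
  rw [linSource, hz, hζ]
  simp only [lin0, lin1, lin2, lin3, lift_add, lift_sub, lift_mul, l2, l3, l4, ln, jet1, jet2]
  rw [hQ]
  ring

theorem zc_linSource {Φ : Series3} (hΦ : Φ ∈ ODE1) (f u : Series2) :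
    zc 0 (linSource Φ f u) = lin0 u ∧ zc 1 (linSource Φ f u) = lin1 Φ f u ∧
    zc 2 (linSource Φ f u) = ax Φ 2 + lin2 Φ f u ∧ zc 3 (linSource Φ f u) = ax Φ 3 + lin3 Φ f u := by
  obtain ⟨B, hB⟩ := linSource_eq hΦ f u
  have h := X_two_sq_dvd_iff.1 (restrict_mem hΦ)
  have h0 : zc 0 (restrict Φ) = 0 := series2_ext fun i k => by rw [c2_zc, (h i k).1, c2_zero]
  have h1 : zc 1 (restrict Φ) = 0 := series2_ext fun i k => by rw [c2_zc, (h i k).2, c2_zero]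
  simp only [hB, zc_add _ (restrict Φ)]
  refine ⟨?_, ?_, ?_, ?_⟩
  · rw [zc_zero_lift_add, h0, zero_add]
  · rw [zc_succ_lift_add, zc_zero_lift_add, h1, zero_add]
  · rw [zc_succ_lift_add, zc_succ_lift_add, zc_zero_lift_add, ax]
  · rw [zc_succ_lift_add, zc_succ_lift_add, zc_succ_lift_add, zc_zero_lift_add, ax]

end LinearPart

/-! ### Reduction of each level to a four-dimensional linear system -/

section LevelSystem

/-- The linearized conditions for a normal form, in degree `k` in `w`, with inhomogeneity `R`. -/
def LevelEq (Φ : Series3) (f u : Series2) (R : Series3) (k : ℕ) : Prop :=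
  (∀ i, c2 (lin0 u + zc 0 R) i k = 0) ∧ (∀ i, c2 (lin1 Φ f u + zc 1 R) i k = 0) ∧
  (∀ i < 2, c2 (lin2 Φ f u + zc 2 R) i k = 0) ∧ (∀ i < 2, c2 (lin3 Φ f u + zc 3 R) i k = 0)

/-- The matrix of the level `k` system for `(u₀, u₁, f₀, f₁)`. -/
def levelMatrix (Φ : Series3) (k : ℕ) : Matrix (Fin 4) (Fin 4) ℂ :=
  ((k : ℂ) ^ 2) • 1 - (k : ℂ) • (1 + TG Φ) - TH Φ

/-- The first two coefficients in `z` at level `k`. -/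
def cauchyData (f u : Series2) (k : ℕ) : Fin 4 → ℂ := ![c2 u 0 k, c2 u 1 k, c2 f 0 k, c2 f 1 k]

/-- The right-hand side of the level `k` system for the Cauchy data. -/
def levelRhs (Φ R : Series3) (k : ℕ) : Fin 4 → ℂ :=
  ![cf R 0 k 2,
    -(cf R 1 k 2 - 2 * k * cf R 0 k 1 + 3 * cf Φ 0 0 3 * cf R 0 k 0) / 3,
    -cf R 0 k 3,
    -(cf R 1 k 3 + cf Φ 0 0 3 * cf R 0 k 1 + 4 * cf Φ 0 0 4 * cf R 0 k 0)]

theorem c2_ax_mul (Φ : Series3) (c : ℕ) (g : Series2) (i k : ℕ) :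
    c2 (ax Φ c * g) i k =
      ∑ p ∈ Finset.HasAntidiagonal.antidiagonal i, cf Φ p.1 0 c * c2 g p.2 k := by
  rw [c2_mul_of_level_zero (fun i k hk => by rw [c2_ax, if_neg hk])]
  simp [c2_ax]

theorem c2_dz_ax_mul (Φ : Series3) (c : ℕ) (g : Series2) (i k : ℕ) :
    c2 (dz (ax Φ c) * g) i k =
      ∑ p ∈ Finset.HasAntidiagonal.antidiagonal i, (p.1 + 1) * cf Φ (p.1 + 1) 0 c * c2 g p.2 k := by
  rw [c2_mul_of_level_zero (fun i k hk => by rw [c2_dz, c2_ax, if_neg hk, mul_zero])]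
  simp [c2_dz, c2_ax]

theorem c2_natCast_mul (n : ℕ) (f : Series2) (i k : ℕ) :
    c2 ((n : Series2) * f) i k = n * c2 f i k := by
  rw [← nsmul_eq_mul, ← nsmul_eq_mul]; exact map_nsmul _ _ _

theorem c2_two_mul (f : Series2) (i k : ℕ) : c2 (2 * f) i k = 2 * c2 f i k := by
  simpa using c2_natCast_mul 2 f i k
theorem c2_three_mul (f : Series2) (i k : ℕ) : c2 (3 * f) i k = 3 * c2 f i k := by
  simpa using c2_natCast_mul 3 f i k
theorem c2_four_mul (f : Series2) (i k : ℕ) : c2 (4 * f) i k = 4 * c2 f i k := by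
  simpa using c2_natCast_mul 4 f i k

/-- The conditions at `ζ^0` and `ζ^1` are recursions in the power of `z` for `u` and `f`. Their
first instances express the coefficients of `z²` by the Cauchy data; inserting these into the
conditions at `ζ^2` and `ζ^3` produces the matrix and the corrections in `levelRhs`. -/
theorem levelEq_iff (Φ : Series3) (f u : Series2) (R : Series3) (k : ℕ) :
    LevelEq Φ f u R k ↔
      (∀ i : ℕ, ((i : ℂ) + 1) * ((i : ℂ) + 2) * c2 u (i + 2) k = cf R i k 0) ∧
      (∀ i : ℕ, ((i : ℂ) + 1) * ((i : ℂ) + 2) * c2 f (i + 2) k =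
        2 * (k + 1) * (i + 1) * c2 u (i + 1) k - 2 * c2 (ax Φ 2 * dz u) i k - cf R i k 1) ∧
      (levelMatrix Φ k).mulVec (cauchyData f u k) = levelRhs Φ R k := by
  have h0 : (∀ i, c2 (lin0 u + zc 0 R) i k = 0) ↔
      (∀ i : ℕ, ((i : ℂ) + 1) * ((i : ℂ) + 2) * c2 u (i + 2) k = cf R i k 0) := by
    refine forall_congr' fun i => ?_
    rw [lin0, c2_add, c2_neg, c2_dz, c2_dz, c2_zc]
    push_cast
    constructor <;> intro h <;> linear_combination -h
  have h1 : (∀ i, c2 (lin1 Φ f u + zc 1 R) i k = 0) ↔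
      (∀ i : ℕ, ((i : ℂ) + 1) * ((i : ℂ) + 2) * c2 f (i + 2) k =
        2 * (k + 1) * (i + 1) * c2 u (i + 1) k - 2 * c2 (ax Φ 2 * dz u) i k - cf R i k 1) := by
    refine forall_congr' fun i => ?_
    rw [lin1, c2_add, c2_add, c2_sub, c2_sub, c2_two_mul, c2_two_mul, c2_two_mul, c2_th,
      c2_dz (dz f), c2_dz f, c2_zc, c2_dz u]
    push_cast
    constructor <;> intro h <;> linear_combination h
  rw [LevelEq, h0, h1]
  refine and_congr_right fun hu => and_congr_right fun hf => ?_
  have hu0 := hu 0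
  have hf0 := hf 0
  rw [c2_ax_mul] at hf0
  have s0 : Finset.HasAntidiagonal.antidiagonal 0 = {((0, 0) : ℕ × ℕ)} := rfl
  have s1 : Finset.HasAntidiagonal.antidiagonal 1 = {((0, 1) : ℕ × ℕ), (1, 0)} := rfl
  simp only [s0, Finset.sum_singleton, c2_dz] at hf0
  push_cast at hu0 hf0
  have e20 : c2 (lin2 Φ f u + zc 2 R) 0 k = cf Φ 1 0 2 * c2 f 0 k + (cf Φ 0 0 2 - 1) * k * c2 u 0 k
      + 3 * cf Φ 0 0 3 * c2 u 1 k - k ^ 2 * c2 u 0 k + 2 * k * c2 f 1 k + cf R 0 k 2 := by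
    simp only [lin2, c2_add, c2_sub, c2_two_mul, c2_three_mul, c2_ax_mul, c2_dz_ax_mul, c2_th, c2_dz, c2_zc, s0,
      Finset.sum_singleton]
    push_cast
    ring
  have e21 : c2 (lin2 Φ f u + zc 2 R) 1 k = 2 * cf Φ 2 0 2 * c2 f 0 k + cf Φ 1 0 2 * c2 f 1 k
      + cf Φ 1 0 2 * k * c2 u 0 k + (cf Φ 0 0 2 - 1) * k * c2 u 1 k
      + 3 * cf Φ 1 0 3 * c2 u 1 k + 6 * cf Φ 0 0 3 * c2 u 2 k
      - k ^ 2 * c2 u 1 k + 4 * k * c2 f 2 k + cf R 1 k 2 := by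
    simp only [lin2, c2_add, c2_sub, c2_two_mul, c2_three_mul, c2_ax_mul, c2_dz_ax_mul, c2_th, c2_dz, c2_zc, s1]
    simp only [Finset.sum_insert (show ((0, 1) : ℕ × ℕ) ∉ ({(1, 0)} : Finset (ℕ × ℕ)) by decide),
      Finset.sum_singleton]
    push_cast
    ring
  have e30 : c2 (lin3 Φ f u + zc 3 R) 0 k = k ^ 2 * c2 f 0 k + (cf Φ 0 0 2 - 1) * k * c2 f 0 k
      + cf Φ 1 0 3 * c2 f 0 k - cf Φ 0 0 3 * c2 f 1 k + 2 * cf Φ 0 0 3 * k * c2 u 0 k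
      + 4 * cf Φ 0 0 4 * c2 u 1 k + cf R 0 k 3 := by
    simp only [lin3, c2_add, c2_sub, c2_two_mul, c2_four_mul, c2_ax_mul, c2_dz_ax_mul, c2_th, c2_dz, c2_zc, s0,
      Finset.sum_singleton]
    push_cast
    ring
  have e31 : c2 (lin3 Φ f u + zc 3 R) 1 k = k ^ 2 * c2 f 1 k + (cf Φ 0 0 2 - 1) * k * c2 f 1 k
      + cf Φ 1 0 2 * k * c2 f 0 k + 2 * cf Φ 2 0 3 * c2 f 0 k - 2 * cf Φ 0 0 3 * c2 f 2 k
      + 2 * cf Φ 0 0 3 * k * c2 u 1 k + 2 * cf Φ 1 0 3 * k * c2 u 0 k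
      + 4 * cf Φ 1 0 4 * c2 u 1 k + 8 * cf Φ 0 0 4 * c2 u 2 k + cf R 1 k 3 := by
    simp only [lin3, c2_add, c2_sub, c2_two_mul, c2_four_mul, c2_ax_mul, c2_dz_ax_mul, c2_th, c2_dz, c2_zc, s1]
    simp only [Finset.sum_insert (show ((0, 1) : ℕ × ℕ) ∉ ({(1, 0)} : Finset (ℕ × ℕ)) by decide),
      Finset.sum_singleton]
    push_cast
    ring
  have hA : ∀ v : Fin 4 → ℂ, (levelMatrix Φ k).mulVec v =
      (k : ℂ) ^ 2 • v - (k : ℂ) • (v + (TG Φ).mulVec v) - (TH Φ).mulVec v := by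
    intro v
    simp [levelMatrix, Matrix.sub_mulVec, Matrix.smul_mulVec, Matrix.add_mulVec]
  rw [hA]
  have hlt : ∀ p : ℕ → Prop, (∀ i < 2, p i) ↔ p 0 ∧ p 1 := by
    intro p
    refine ⟨fun h => ⟨h 0 (by omega), h 1 (by omega)⟩, fun h i hi => ?_⟩
    interval_cases i
    exacts [h.1, h.2]
  rw [hlt, hlt, e20, e21, e30, e31, funext_iff, Fin.forall_fin_succ, Fin.forall_fin_succ,
    Fin.forall_fin_succ, Fin.forall_fin_succ]
  simp only [cauchyData, levelRhs, TG, TH, Matrix.mulVec, dotProduct, Fin.sum_univ_four,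
    Pi.sub_apply, Pi.smul_apply, Pi.add_apply, smul_eq_mul]
  simp
  rw [and_assoc]
  refine and_congr ?_ (and_congr ?_ (and_congr ?_ ?_))
  · constructor <;> intro h <;> linear_combination -h
  -- Eliminating the `z²` coefficient of `f` turns `-k² u₁ + 4 k f₂` into `3 k² u₁` plus lower
  -- powers of `k`; hence the division by `3` in this row.
  · constructor
    · intro h
      linear_combination (1 / 3 : ℂ) * h - cf Φ 0 0 3 * hu0 - (2 / 3 : ℂ) * k * hf0
    · intro h
      linear_combination (3 : ℂ) * h + 3 * cf Φ 0 0 3 * hu0 + 2 * k * hf0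
  · constructor <;> intro h <;> linear_combination h
  · constructor
    · intro h
      linear_combination h - 4 * cf Φ 0 0 4 * hu0 + cf Φ 0 0 3 * hf0
    · intro h
      linear_combination h + 4 * cf Φ 0 0 4 * hu0 - cf Φ 0 0 3 * hf0

end LevelSystem

/-! ### Solvability of the level systems without resonance -/

section LevelSolve

/-- A kernel vector `v` makes `(v, k v)` an eigenvector of the companion-type matrix `linMatrix`
with eigenvalue `k`. -/
theorem levelMatrix_mulVec_injective {Φ : Series3} (h : NonResonant Φ) {k : ℕ} (hk : 0 < k)
    {v : Fin 4 → ℂ} (hv : (levelMatrix Φ k).mulVec v = 0) : v = 0 := by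
  by_contra hne
  apply h k hk
  have hA : (levelMatrix Φ k).mulVec v =
      (k : ℂ) ^ 2 • v - (k : ℂ) • (v + (TG Φ).mulVec v) - (TH Φ).mulVec v := by
    simp [levelMatrix, Matrix.sub_mulVec, Matrix.smul_mulVec, Matrix.add_mulVec]
  rw [hA] at hv
  refine Module.End.hasEigenvalue_of_hasEigenvector (x := Sum.elim v ((k : ℂ) • v)) ⟨?_, ?_⟩
  · rw [Module.End.mem_eigenspace_iff, Matrix.toLin'_apply, linMatrix, Matrix.fromBlocks_mulVec]
    have : (k : ℂ) • Sum.elim v ((k : ℂ) • v) = Sum.elim ((k : ℂ) • v) ((k : ℂ) ^ 2 • v) := by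
      ext (i | i)
      · rfl
      · simp [pow_two, mul_assoc]
    rw [this]
    congr 1
    · simp
    · rw [sub_sub, sub_eq_zero] at hv
      rw [hv]
      simp [Matrix.add_mulVec, Matrix.mulVec_smul, add_comm]
  · intro h0
    apply hne
    funext i
    exact congrFun h0 (Sum.inl i)

theorem levelMatrix_mulVec_surjective {Φ : Series3} (h : NonResonant Φ) {k : ℕ} (hk : 0 < k)
    (b : Fin 4 → ℂ) : ∃ v, (levelMatrix Φ k).mulVec v = b := by
  have hinj : Function.Injective (Matrix.toLin' (levelMatrix Φ k)) := by
    rw [injective_iff_map_eq_zero]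
    intro v hv
    exact levelMatrix_mulVec_injective h hk (by rwa [Matrix.toLin'_apply] at hv)
  obtain ⟨v, hv⟩ := (LinearMap.injective_iff_surjective.1 hinj) b
  exact ⟨v, by rwa [Matrix.toLin'_apply] at hv⟩

/-- Agreement of the coefficients of degree `k` in `w`. -/
def AgreeAt (k : ℕ) (f g : Series2) : Prop := ∀ i, c2 f i k = c2 g i k

theorem AgreeAt.ax_mul {k : ℕ} {f g : Series2} (h : AgreeAt k f g) (Φ : Series3) (c : ℕ) :
    AgreeAt k (ax Φ c * dz f) (ax Φ c * dz g) := by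
  intro i
  rw [c2_ax_mul, c2_ax_mul]
  refine Finset.sum_congr rfl fun p _ => ?_
  rw [c2_dz, c2_dz, h]

/-- The operators `∂_z`, `w ∂_w` and multiplication by series in `z` all preserve the degree in `w`,
so only level `k` of the data matters. -/
theorem LevelEq.congr {Φ : Series3} {f u f' u' : Series2} {R R' : Series3} {k : ℕ}
    (h : LevelEq Φ f u R k) (hf : AgreeAt k f f') (hu : AgreeAt k u u')
    (hR : ∀ i c, cf R i k c = cf R' i k c) : LevelEq Φ f' u' R' k := by
  rw [levelEq_iff] at h ⊢
  have hc : cauchyData f' u' k = cauchyData f u k := by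
    rw [cauchyData, cauchyData, hu, hu, hf, hf]
  have hr : levelRhs Φ R' k = levelRhs Φ R k := by simp only [levelRhs, hR]
  rw [hc, hr]
  refine ⟨fun i => ?_, fun i => ?_, h.2.2⟩
  · rw [← hu, ← hR]; exact h.1 i
  · rw [← hf, ← hu, ← hR, ← hu.ax_mul]; exact h.2.1 i

/-- The Cauchy data agree by injectivity of the level matrix; the recursions at `ζ^0` and `ζ^1` then
fix all higher coefficients in `z`, first for `u` and then for `f`. -/
theorem LevelEq.unique {Φ : Series3} (hres : NonResonant Φ) {f u f' u' : Series2} {R : Series3}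
    {k : ℕ} (hk : 0 < k) (h : LevelEq Φ f u R k) (h' : LevelEq Φ f' u' R k) :
    AgreeAt k f f' ∧ AgreeAt k u u' := by
  rw [levelEq_iff] at h h'
  obtain ⟨h1, h2, h3⟩ := h
  obtain ⟨h1', h2', h3'⟩ := h'
  have hc : cauchyData f u k = cauchyData f' u' k := by
    rw [← sub_eq_zero]
    refine levelMatrix_mulVec_injective hres hk ?_
    rw [Matrix.mulVec_sub, h3, h3', sub_self]
  have hpos : ∀ i : ℕ, ((i : ℂ) + 1) * ((i : ℂ) + 2) ≠ 0 := fun i => by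
    have h1 : ((i : ℂ) + 1) ≠ 0 := by exact_mod_cast Nat.succ_ne_zero i
    have h2 : ((i : ℂ) + 2) ≠ 0 := by exact_mod_cast Nat.succ_ne_zero (i + 1)
    exact mul_ne_zero h1 h2
  have hu : AgreeAt k u u' := by
    intro i
    match i with
    | 0 => exact congrFun hc 0
    | 1 => exact congrFun hc 1
    | i + 2 => exact mul_left_cancel₀ (hpos i) ((h1 i).trans (h1' i).symm)
  refine ⟨fun i => ?_, hu⟩
  match i with
  | 0 => exact congrFun hc 2
  | 1 => exact congrFun hc 3
  | i + 2 =>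
    refine mul_left_cancel₀ (hpos i) ((h2 i).trans ?_)
    rw [h2' i, hu, hu.ax_mul]

/-- The series with coefficients `a i k`. -/
def mk2 (a : ℕ → ℕ → ℂ) : Series2 := fun d => a (d 0) (d 1)

theorem exists_levelEq {Φ : Series3} (hres : NonResonant Φ) (R : Series3) {k : ℕ} (hk : 0 < k) :
    ∃ p : Series2 × Series2, LevelEq Φ p.1 p.2 R k := by
  obtain ⟨v, hv⟩ := levelMatrix_mulVec_surjective hres hk (levelRhs Φ R k)
  have hpos : ∀ i : ℕ, ((i : ℂ) + 1) * ((i : ℂ) + 2) ≠ 0 := fun i => by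
    have h1 : ((i : ℂ) + 1) ≠ 0 := by exact_mod_cast Nat.succ_ne_zero i
    have h2 : ((i : ℂ) + 2) ≠ 0 := by exact_mod_cast Nat.succ_ne_zero (i + 1)
    exact mul_ne_zero h1 h2
  -- The same coefficients are used at every level, since only level `k` is tested.
  let u : Series2 := mk2 fun i _ => match i with
    | 0 => v 0
    | 1 => v 1
    | i + 2 => cf R i k 0 / (((i : ℂ) + 1) * ((i : ℂ) + 2))
  let f : Series2 := mk2 fun i _ => match i with
    | 0 => v 2
    | 1 => v 3
    | i + 2 => (2 * (k + 1) * (i + 1) * c2 u (i + 1) k - 2 * c2 (ax Φ 2 * dz u) i k - cf R i k 1) /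
        (((i : ℂ) + 1) * ((i : ℂ) + 2))
  refine ⟨(f, u), (levelEq_iff _ _ _ _ _).2 ⟨fun i => ?_, fun i => ?_, ?_⟩⟩
  · exact mul_div_cancel₀ _ (hpos i)
  · exact mul_div_cancel₀ _ (hpos i)
  · have : cauchyData f u k = v := by
      funext i; fin_cases i <;> rfl
    rw [this, hv]

end LevelSolve

/-! ### Existence and uniqueness of the formal normalization -/

section Formal

/-- The part of `jetSource Φ` at a map which is nonlinear or divisible by `w`. -/
def nonlin (Φ : Series3) (f u : Series2) : Series3 :=
  subst (jetVars f u) (jetSource Φ - jetLinear Φ)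

theorem subst_jetSource_eq (Φ : Series3) {f u : Series2} (hf : (X 1 : Series2) ∣ f)
    (hu : (X 1 : Series2) ∣ u) :
    subst (jetVars f u) (jetSource Φ) = linSource Φ f u + nonlin Φ f u := by
  rw [nonlin, MvPowerSeries.subst_sub (hasSubst_jetVars hf hu), subst_jetLinear Φ hf hu]; ring

theorem jet1_sub (f g : Series2) : jet1 (f - g) = jet1 f - jet1 g := by
  rw [jet1, dz_sub, th_sub, lift_sub, lift_sub, jet1, jet1]; ring

theorem jet2_sub (f g : Series2) : jet2 (f - g) = jet2 f - jet2 g := by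
  simp only [jet2, dz_sub, th_sub, lift_sub]; ring

theorem X_one_pow_dvd_jetVars_sub {n : ℕ} {f u f' u' : Series2} (hf : (X 1 : Series2) ^ n ∣ f - f')
    (hu : (X 1 : Series2) ^ n ∣ u - u') (i : Fin 11) (hi : 3 ≤ i) :
    (X 1 : Series3) ^ n ∣ jetVars f u i - jetVars f' u' i := by
  fin_cases i
  iterate 3 exact absurd hi (by decide)
  · change _ ∣ lift f - lift f'
    rw [← lift_sub]; exact X_one_dvd_lift hf
  · change _ ∣ jet1 f - jet1 f'
    rw [← jet1_sub]; exact X_one_pow_dvd_jet1 hf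
  · change _ ∣ lift (th f) - lift (th f')
    rw [← lift_sub, ← th_sub]; exact X_one_dvd_lift (X_one_pow_dvd_th hf)
  · change _ ∣ lift u - lift u'
    rw [← lift_sub]; exact X_one_dvd_lift hu
  · change _ ∣ jet1 u - jet1 u'
    rw [← jet1_sub]; exact X_one_pow_dvd_jet1 hu
  · change _ ∣ lift (th u) - lift (th u')
    rw [← lift_sub, ← th_sub]; exact X_one_dvd_lift (X_one_pow_dvd_th hu)
  · change _ ∣ jet2 u - jet2 u'
    rw [← jet2_sub]; exact X_one_pow_dvd_jet2 hu
  · change _ ∣ jet2 f - jet2 f'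
    rw [← jet2_sub]; exact X_one_pow_dvd_jet2 hf

/-- The nonlinear part at level `n` depends only on the levels below `n`. -/
theorem cf_nonlin_congr (Φ : Series3) {n : ℕ} {f u f' u' : Series2} (hf : (X 1 : Series2) ∣ f)
    (hu : (X 1 : Series2) ∣ u) (hf' : (X 1 : Series2) ∣ f') (hu' : (X 1 : Series2) ∣ u')
    (h1 : ∀ k < n, AgreeAt k f f') (h2 : ∀ k < n, AgreeAt k u u') {k : ℕ} (hk : k ≤ n) (i c : ℕ) :
    cf (nonlin Φ f u) i k c = cf (nonlin Φ f' u') i k c := by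
  have hd : ∀ g g' : Series2, (∀ k < n, AgreeAt k g g') → (X 1 : Series2) ^ n ∣ g - g' :=
    fun g g' h => X_one_pow_dvd_iff₂.2 fun i k hk => by rw [c2_sub, h k hk i, sub_self]
  have e0 : ∀ g v, jetVars g v 0 = X 0 := fun g v => by rw [jetVars]; rfl
  have e1 : ∀ g v, jetVars g v 1 = X 1 := fun g v => by rw [jetVars]; rfl
  have e2 : ∀ g v, jetVars g v 2 = X 2 := fun g v => by rw [jetVars]; rfl
  have := X_pow_dvd_subst_sub (hasSubst_jetVars hf hu) (hasSubst_jetVars hf' hu')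
    ((e0 _ _).trans (e0 _ _).symm) (e1 _ _) (e1 _ _) ((e2 _ _).trans (e2 _ _).symm)
    (X_one_dvd_jetVars hf hu) (X_one_dvd_jetVars hf' hu')
    (X_one_pow_dvd_jetVars_sub (hd _ _ h1) (hd _ _ h2)) (jetSource_sub_jetLinear_mem Φ)
  rw [← nonlin, ← nonlin, X_one_pow_dvd_iff₃] at this
  rw [← sub_eq_zero, ← cf_sub]
  exact this i k c (by omega)

/-- The formal solutions of the normalization problem. -/
def IsNormalizing (Φ : Series3) (f u : Series2) : Prop :=
  (X 1 : Series2) ∣ f ∧ (X 1 : Series2) ∣ u ∧ ∀ k, 0 < k → LevelEq Φ f u (nonlin Φ f u) k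

/-- Induction on the level: agreement below `k` gives the same inhomogeneity at level `k`. -/
theorem IsNormalizing.unique {Φ : Series3} (hres : NonResonant Φ) {f u f' u' : Series2}
    (h : IsNormalizing Φ f u) (h' : IsNormalizing Φ f' u') : f = f' ∧ u = u' := by
  have key : ∀ k, AgreeAt k f f' ∧ AgreeAt k u u' := by
    intro k
    induction k using Nat.strong_induction_on with
    | _ k ih =>
      rcases Nat.eq_zero_or_pos k with rfl | hk
      · refine ⟨fun i => ?_, fun i => ?_⟩
        · rw [X_one_dvd_iff₂.1 h.1, X_one_dvd_iff₂.1 h'.1]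
        · rw [X_one_dvd_iff₂.1 h.2.1, X_one_dvd_iff₂.1 h'.2.1]
      · refine LevelEq.unique hres hk (h.2.2 k hk) ((h'.2.2 k hk).congr (fun _ => rfl)
          (fun _ => rfl) fun i c => ?_)
        exact cf_nonlin_congr Φ h'.1 h'.2.1 h.1 h.2.1 (fun j hj i => ((ih j hj).1 i).symm)
          (fun j hj i => ((ih j hj).2 i).symm) le_rfl i c
  exact ⟨series2_ext fun i k => (key k).1 i, series2_ext fun i k => (key k).2 i⟩

/-- The truncation to the levels below `n`. -/
def truncW (n : ℕ) (f : Series2) : Series2 := mk2 fun i k => if k < n then c2 f i k else 0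

theorem c2_truncW (n : ℕ) (f : Series2) (i k : ℕ) :
    c2 (truncW n f) i k = if k < n then c2 f i k else 0 := rfl

theorem X_one_dvd_truncW {f : Series2} (hf : (X 1 : Series2) ∣ f) (n : ℕ) :
    (X 1 : Series2) ∣ truncW n f := by
  rw [X_one_dvd_iff₂] at hf ⊢
  intro i
  rw [c2_truncW, hf, ite_self]

/-- Replacement of the coefficients at level `n`. -/
def setLevel (n : ℕ) (f g : Series2) : Series2 :=
  mk2 fun i k => if k = n then c2 g i k else c2 f i k

theorem c2_setLevel (n : ℕ) (f g : Series2) (i k : ℕ) :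
    c2 (setLevel n f g) i k = if k = n then c2 g i k else c2 f i k := rfl

/-- The successive approximations of the formal solution, correct below level `n + 1`. -/
def approx {Φ : Series3} (hres : NonResonant Φ) : ℕ → Series2 × Series2
  | 0 => 0
  | n + 1 =>
    let p := approx hres n
    let q := (exists_levelEq hres (nonlin Φ p.1 p.2) n.succ_pos).choose
    (setLevel (n + 1) p.1 q.1, setLevel (n + 1) p.2 q.2)

theorem approx_agree {Φ : Series3} (hres : NonResonant Φ) {m n k : ℕ} (hkm : k ≤ m) (hmn : m ≤ n) :
    AgreeAt k (approx hres n).1 (approx hres m).1 ∧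
      AgreeAt k (approx hres n).2 (approx hres m).2 := by
  induction n, hmn using Nat.le_induction with
  | base => exact ⟨fun _ => rfl, fun _ => rfl⟩
  | succ n hmn ih =>
    refine ⟨fun i => ?_, fun i => ?_⟩
    · rw [← ih.1 i, approx, c2_setLevel, if_neg (by omega)]
    · rw [← ih.2 i, approx, c2_setLevel, if_neg (by omega)]

/-- The diagonal limit of `approx`. Level `n + 1` is solved with the inhomogeneity of the `n`-th
approximation, and later changes, all at higher levels, do not affect that inhomogeneity. -/
theorem exists_isNormalizing {Φ : Series3} (hres : NonResonant Φ) :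
    ∃ f u, IsNormalizing Φ f u := by
  let f : Series2 := mk2 fun i k => c2 (approx hres k).1 i k
  let u : Series2 := mk2 fun i k => c2 (approx hres k).2 i k
  have hag : ∀ {k n}, k ≤ n → AgreeAt k (approx hres n).1 f ∧ AgreeAt k (approx hres n).2 u :=
    fun h => ⟨fun i => (approx_agree hres le_rfl h).1 i, fun i => (approx_agree hres le_rfl h).2 i⟩
  have h0 : (approx hres 0).1 = 0 ∧ (approx hres 0).2 = 0 := ⟨rfl, rfl⟩
  have hd : ∀ n, (X 1 : Series2) ∣ (approx hres n).1 ∧ (X 1 : Series2) ∣ (approx hres n).2 := by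
    intro n
    refine ⟨X_one_dvd_iff₂.2 fun i => ?_, X_one_dvd_iff₂.2 fun i => ?_⟩
    · rw [(approx_agree hres le_rfl (Nat.zero_le n)).1 i, h0.1, c2_zero]
    · rw [(approx_agree hres le_rfl (Nat.zero_le n)).2 i, h0.2, c2_zero]
  have hf : (X 1 : Series2) ∣ f := X_one_dvd_iff₂.2 fun i => by
    rw [← (hag (Nat.zero_le 0)).1 i, h0.1, c2_zero]
  have hu : (X 1 : Series2) ∣ u := X_one_dvd_iff₂.2 fun i => by
    rw [← (hag (Nat.zero_le 0)).2 i, h0.2, c2_zero]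
  refine ⟨f, u, hf, hu, fun k hk => ?_⟩
  obtain ⟨n, rfl⟩ := Nat.exists_eq_succ_of_ne_zero hk.ne'
  have hq := (exists_levelEq hres (nonlin Φ (approx hres n).1 (approx hres n).2)
    n.succ_pos).choose_spec
  refine hq.congr (fun i => ?_) (fun i => ?_) fun i c => ?_
  · rw [← (hag le_rfl).1 i, approx, c2_setLevel, if_pos rfl]
  · rw [← (hag le_rfl).2 i, approx, c2_setLevel, if_pos rfl]
  · exact cf_nonlin_congr Φ (hd n).1 (hd n).2 hf hu (fun j hj => (hag (by omega)).1)
      (fun j hj => (hag (by omega)).2) le_rfl i c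

theorem X_one_dvd_nonlin (Φ : Series3) {f u : Series2} (hf : (X 1 : Series2) ∣ f)
    (hu : (X 1 : Series2) ∣ u) : (X 1 : Series3) ∣ nonlin Φ f u := by
  have hs := hasSubst_jetVars hf hu
  rw [← pow_one (X 1 : Series3), MvPowerSeries.X_pow_dvd_iff]
  intro e he
  rw [nonlin, MvPowerSeries.coeff_subst hs]
  refine finsum_eq_zero_of_forall_eq_zero fun d => ?_
  by_cases hd : d 1 = 0 ∧ jetDeg d ≤ 1
  · rw [jetSource_sub_jetLinear_mem Φ d hd.1 hd.2, zero_smul]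
  have : ∃ i, d i ≠ 0 ∧ (X 1 : Series3) ∣ jetVars f u i := by
    by_cases h1 : d 1 = 0
    · have h2 : jetDeg d ≠ 0 := by omega
      rw [jetDeg] at h2
      obtain ⟨i, -, hi⟩ := Finset.exists_ne_zero_of_sum_ne_zero h2
      have h3 : 3 ≤ i := by by_contra h; simp [h] at hi
      exact ⟨i, by simpa [h3] using hi, X_one_dvd_jetVars hf hu i h3⟩
    · exact ⟨1, h1, dvd_rfl⟩
  obtain ⟨i, hi, hX⟩ := this
  have h4 : (X 1 : Series3) ^ 1 ∣ d.prod fun i n => jetVars f u i ^ n := by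
    rw [pow_one]
    exact (dvd_pow hX hi).trans (Finset.dvd_prod_of_mem _ (Finsupp.mem_support_iff.2 hi))
  rw [MvPowerSeries.X_pow_dvd_iff.1 h4 e he, smul_zero]

/-- The source equation of a map is a normal form iff the map solves the linearized conditions
with the nonlinear part as inhomogeneity. -/
theorem mem_NF1_iff {Φ : Series3} (hΦ : Φ ∈ ODE1) {f u : Series2} (hf : (X 1 : Series2) ∣ f)
    (hu : (X 1 : Series2) ∣ u) :
    subst (jetVars f u) (jetSource Φ) ∈ NF1 ↔ IsNormalizing Φ f u := by
  obtain ⟨e0, e1, e2, e3⟩ := zc_linSource hΦ f u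
  have hR := X_one_dvd_nonlin Φ hf hu
  rw [subst_jetSource_eq Φ hf hu]
  have hz : ∀ c, zc c (linSource Φ f u + nonlin Φ f u) =
      zc c (linSource Φ f u) + zc c (nonlin Φ f u) := fun c => zc_add c _ _
  have h0 : ∀ c i, c2 (zc c (nonlin Φ f u)) i 0 = 0 := fun c i => by
    rw [c2_zc]
    exact MvPowerSeries.X_dvd_iff.1 hR _ rfl
  have hl0 : (X 1 : Series2) ∣ lin0 u := by
    rw [← pow_one (X 1 : Series2)] at hu ⊢
    exact (X_one_pow_dvd_dz (X_one_pow_dvd_dz hu)).neg_right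
  have hl1 : (X 1 : Series2) ∣ lin1 Φ f u := by
    rw [← pow_one (X 1 : Series2)] at hu hf ⊢
    exact dvd_add (dvd_sub (dvd_sub (((X_one_pow_dvd_dz hu).mul_left _).mul_left _)
      ((X_one_pow_dvd_dz hu).mul_left _)) ((X_one_pow_dvd_th (X_one_pow_dvd_dz hu)).mul_left _))
      (X_one_pow_dvd_dz (X_one_pow_dvd_dz hf))
  have key : ∀ c k, 0 < k → ∀ (g : Series2), zc c (linSource Φ f u) = ax Φ c + g →
      ∀ i, cf (linSource Φ f u + nonlin Φ f u) i k c = c2 (g + zc c (nonlin Φ f u)) i k := by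
    intro c k hk g hg i
    rw [← c2_zc, hz, hg, c2_add, c2_add, c2_add, c2_ax, if_neg hk.ne', zero_add]
  constructor
  · rintro ⟨h1, h2⟩
    have h1' := X_two_sq_dvd_iff.1 h1
    refine ⟨hf, hu, fun k hk => ⟨fun i => ?_, fun i => ?_, fun i hi => ?_, fun i hi => ?_⟩⟩
    · rw [← e0, ← hz]; exact (h1' i k).1
    · rw [← e1, ← hz]; exact (h1' i k).2
    · rw [← key 2 k hk _ e2]
      interval_cases i
      · exact (h2 k hk).1
      · exact (h2 k hk).2.1
    · rw [← key 3 k hk _ e3]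
      interval_cases i
      · exact (h2 k hk).2.2.1
      · exact (h2 k hk).2.2.2
  · rintro ⟨-, -, h⟩
    refine ⟨X_two_sq_dvd_iff.2 fun i k => ?_, fun k hk => ?_⟩
    · rw [← c2_zc, ← c2_zc, hz, hz, e0, e1]
      -- At level zero nothing has to be solved: `lin0`, `lin1` and the nonlinear part are all
      -- divisible by `w`.
      rcases Nat.eq_zero_or_pos k with rfl | hk
      · rw [c2_add, c2_add, h0, h0, X_one_dvd_iff₂.1 hl0, X_one_dvd_iff₂.1 hl1]; simp
      · exact ⟨(h k hk).1 i, (h k hk).2.1 i⟩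
    · rw [key 2 k hk _ e2, key 2 k hk _ e2, key 3 k hk _ e3, key 3 k hk _ e3]
      exact ⟨(h k hk).2.2.1 0 (by omega), (h k hk).2.2.1 1 (by omega),
        (h k hk).2.2.2 0 (by omega), (h k hk).2.2.2 1 (by omega)⟩

end Formal

/-! ### Weights in which `∂_z` dominates `w ∂_w` -/

section Weights

/-- The weight of `z ^ i * w ^ k`. The binomial coefficient makes `∂/∂z` dominate `w ∂/∂w`. -/
def wt (r ρ : ℝ≥0) (i k : ℕ) : ℝ≥0 := r ^ i * ρ ^ k / (i + k).choose i

/-- One term of Vandermonde's identity: `binom(i+k, i) binom(i'+k', i') ≤ binom(i+i'+k+k', i+i')`.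
-/
theorem wt_add_le (r ρ : ℝ≥0) (i k i' k' : ℕ) :
    wt r ρ (i + i') (k + k') ≤ wt r ρ i k * wt r ρ i' k' := by
  have h : (i + k).choose i * (i' + k').choose i' ≤ (i + i' + (k + k')).choose (i + i') := by
    rw [show i + i' + (k + k') = (i + k) + (i' + k') by ring,
      Nat.add_choose_eq (i + k) (i' + k') (i + i')]
    exact Finset.single_le_sum (f := fun p : ℕ × ℕ => (i + k).choose p.1 * (i' + k').choose p.2)
      (fun _ _ => Nat.zero_le _) (Finset.HasAntidiagonal.mem_antidiagonal.2 rfl :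
        (i, i') ∈ Finset.HasAntidiagonal.antidiagonal (i + i'))
  have h1 : 0 < (i + k).choose i * (i' + k').choose i' :=
    Nat.mul_pos (Nat.choose_pos (by omega)) (Nat.choose_pos (by omega))
  rw [wt, wt, wt, div_mul_div_comm]
  rw [show r ^ (i + i') * ρ ^ (k + k') = r ^ i * ρ ^ k * (r ^ i' * ρ ^ k') by ring]
  refine div_le_div_of_nonneg_left (by positivity) (by exact_mod_cast h1) (by exact_mod_cast h)

theorem wt_zero (r ρ : ℝ≥0) (k : ℕ) : wt r ρ 0 k = ρ ^ k := by simp [wt]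
theorem wt_level_zero (r ρ : ℝ≥0) (i : ℕ) : wt r ρ i 0 = r ^ i := by simp [wt]

theorem wt_one (r ρ : ℝ≥0) (k : ℕ) : wt r ρ 1 k = r * ρ ^ k / (k + 1) := by
  simp [wt, add_comm]

/-- From `(i+1) binom(i+1+k, i+1) = (i+k+1) binom(i+k, i)` and `k ≤ i+k+1`. This is the comparison
of `w ∂_w` with `∂_z` on single monomials. -/
theorem mul_wt_succ_le {r : ℝ≥0} (hr : r ≤ 1) (ρ : ℝ≥0) (i k : ℕ) :
    k * wt r ρ (i + 1) k ≤ (i + 1) * wt r ρ i k := by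
  have h := Nat.add_one_mul_choose_eq (i + k) i
  have hp : 0 < (i + k).choose i := Nat.choose_pos (by omega)
  have hq : 0 < (i + 1 + k).choose (i + 1) := Nat.choose_pos (by omega)
  rw [show i + k + 1 = i + 1 + k by ring] at h
  have h' : k * (i + k).choose i ≤ (i + 1) * (i + 1 + k).choose (i + 1) := by
    rw [mul_comm (i + 1), ← h]
    exact Nat.mul_le_mul_right _ (by omega)
  rw [wt, wt, ← mul_div_assoc, ← mul_div_assoc, div_le_div_iff₀ (by exact_mod_cast hq)
    (by exact_mod_cast hp)]
  have h'' : ((k * (i + k).choose i : ℕ) : ℝ≥0) ≤ (((i + 1) * (i + 1 + k).choose (i + 1) : ℕ) : ℝ≥0) :=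
    Nat.cast_le.2 h'
  push_cast at h''
  calc (k : ℝ≥0) * (r ^ (i + 1) * ρ ^ k) * ((i + k).choose i)
      = (r ^ (i + 1) * ρ ^ k) * (k * (i + k).choose i) := by ring
    _ ≤ (r ^ i * ρ ^ k) * ((i + 1) * (i + 1 + k).choose (i + 1)) := by
        refine mul_le_mul ?_ h'' (zero_le) (zero_le)
        refine mul_le_mul_left ?_ _
        rw [pow_succ]
        exact mul_le_of_le_one_right' hr
    _ = _ := by ring

/-- The weight on series in `z, w`. -/
def W2 (r ρ : ℝ≥0) (d : Fin 2 →₀ ℕ) : ℝ≥0∞ := wt r ρ (d 0) (d 1)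
/-- The weight on series in `z, w, ζ`. -/
def W3 (r ρ τ : ℝ≥0) (d : Fin 3 →₀ ℕ) : ℝ≥0∞ := (wt r ρ (d 0) (d 1) : ℝ≥0∞) * (τ : ℝ≥0∞) ^ d 2

theorem isSubmul_W2 (r ρ : ℝ≥0) : IsSubmul (W2 r ρ) where
  zero_le_one := by simp [W2, wt]
  add_le d e := by
    simp only [W2, Finsupp.add_apply, ← ENNReal.coe_mul, ENNReal.coe_le_coe]
    exact wt_add_le _ _ _ _ _ _

theorem isSubmul_W3 (r ρ τ : ℝ≥0) : IsSubmul (W3 r ρ τ) where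
  zero_le_one := by simp [W3, wt]
  add_le d e := by
    simp only [W3, Finsupp.add_apply, pow_add]
    rw [mul_mul_mul_comm]
    refine mul_le_mul_left ?_ _
    rw [← ENNReal.coe_mul, ENNReal.coe_le_coe]
    exact wt_add_le _ _ _ _ _ _

variable (r ρ τ : ℝ≥0)

/-- The weighted norms. -/
def N2 (f : Series2) : ℝ≥0∞ := wnorm (W2 r ρ) f
def N3 (A : Series3) : ℝ≥0∞ := wnorm (W3 r ρ τ) A

theorem N2_eq (f : Series2) :
    N2 r ρ f = ∑' k, ∑' i, ‖c2 f i k‖ₑ * (wt r ρ i k : ℝ≥0∞) := by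
  let e : ℕ × ℕ ≃ (Fin 2 →₀ ℕ) :=
    ⟨fun p => ex p.2 p.1, fun d => (d 1, d 0), fun p => rfl, fun d => ex_eq d⟩
  rw [N2, wnorm, ← e.tsum_eq, ENNReal.tsum_prod']
  rfl

theorem N3_eq (A : Series3) : N3 r ρ τ A = ∑' c, (τ : ℝ≥0∞) ^ c * N2 r ρ (zc c A) := by
  let e : ℕ × (Fin 2 →₀ ℕ) ≃ (Fin 3 →₀ ℕ) :=
    ⟨fun p => expo (p.2 0) (p.2 1) p.1, fun d => (d 2, ex (d 0) (d 1)),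
      fun p => by simp [ex_eq], fun d => expo_eq d⟩
  rw [N3, wnorm, ← e.tsum_eq, ENNReal.tsum_prod']
  refine tsum_congr fun c => ?_
  rw [N2, wnorm, ← ENNReal.tsum_mul_left]
  refine tsum_congr fun d => ?_
  rw [W3, W2]
  change ‖cf A (d 0) (d 1) c‖ₑ * ((wt r ρ (d 0) (d 1) : ℝ≥0∞) * (τ : ℝ≥0∞) ^ c) =
    (τ : ℝ≥0∞) ^ c * (‖coeff d (zc c A)‖ₑ * (wt r ρ (d 0) (d 1) : ℝ≥0∞))
  rw [coeff_eq_c2, c2_zc]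
  ring

theorem N2_zc_le (c : ℕ) (A : Series3) : (τ : ℝ≥0∞) ^ c * N2 r ρ (zc c A) ≤ N3 r ρ τ A := by
  rw [N3_eq]; exact ENNReal.le_tsum c

theorem N3_lift (f : Series2) : N3 r ρ τ (lift f) = N2 r ρ f := by
  rw [N3_eq, tsum_eq_single 0]
  · have : zc 0 (lift f) = f := series2_ext fun i k => by rw [c2_zc, cf_lift, if_pos rfl]
    rw [this]; simp
  · intro c hc
    have : zc c (lift f) = 0 := series2_ext fun i k => by rw [c2_zc, cf_lift, if_neg hc, c2_zero]
    rw [this, N2, wnorm_zero, mul_zero]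

variable {r ρ τ}

theorem N2_mono {f g : Series2} (h : ∀ i k, ‖c2 f i k‖ₑ ≤ ‖c2 g i k‖ₑ) : N2 r ρ f ≤ N2 r ρ g :=
  wnorm_mono fun d => by rw [coeff_eq_c2, coeff_eq_c2]; exact h _ _

theorem N2_le_th {g : Series2} (hg : (X 1 : Series2) ∣ g) : N2 r ρ g ≤ N2 r ρ (th g) := by
  refine N2_mono fun i k => ?_
  rw [c2_th, enorm_mul]
  rcases Nat.eq_zero_or_pos k with rfl | hk
  · rw [X_one_dvd_iff₂.1 hg]; simp
  · refine le_mul_of_one_le_left' ?_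
    rw [← ofReal_norm, Complex.norm_natCast, ENNReal.one_le_ofReal]
    exact_mod_cast hk

theorem enorm_natCast (n : ℕ) : ‖(n : ℂ)‖ₑ = n := by
  rw [← ofReal_norm, Complex.norm_natCast, ENNReal.ofReal_natCast]

/-- The Euler derivative is controlled by the `z`-derivative and the restriction to `z = 0`. -/
theorem N2_th_le (hr : r ≤ 1) (g : Series2) :
    N2 r ρ (th g) ≤ ∑' k : ℕ, (k : ℝ≥0∞) * ‖c2 g 0 k‖ₑ * (ρ : ℝ≥0∞) ^ k + N2 r ρ (dz g) := by
  rw [N2_eq, N2_eq, ← ENNReal.tsum_add]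
  refine ENNReal.tsum_le_tsum fun k => ?_
  -- The term `z^0` has no antiderivative partner and gives the restriction to `z = 0`; the terms
  -- `z^(i+1)` are compared with `z^i` in `∂_z g`.
  rw [tsum_eq_zero_add' ENNReal.summable]
  refine add_le_add ?_ (ENNReal.tsum_le_tsum fun i => ?_)
  · rw [c2_th, enorm_mul, enorm_natCast, wt_zero, ENNReal.coe_pow]
  · have h : ((k * wt r ρ (i + 1) k : ℝ≥0) : ℝ≥0∞) ≤ (((i + 1) * wt r ρ i k : ℝ≥0) : ℝ≥0∞) :=
      ENNReal.coe_le_coe.2 (mul_wt_succ_le hr ρ i k)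
    push_cast at h
    have e1 : ‖(i : ℂ) + 1‖ₑ = (i : ℝ≥0∞) + 1 := by
      have := enorm_natCast (i + 1)
      push_cast at this
      exact this
    rw [c2_th, c2_dz, enorm_mul, enorm_mul, enorm_natCast, e1]
    calc (k : ℝ≥0∞) * ‖c2 g (i + 1) k‖ₑ * wt r ρ (i + 1) k
        = ‖c2 g (i + 1) k‖ₑ * (k * wt r ρ (i + 1) k) := by ring
      _ ≤ ‖c2 g (i + 1) k‖ₑ * ((i + 1) * wt r ρ i k) := mul_le_mul_right h _
      _ = _ := by ring

end Weights

/-! ### A norm controlling the 2-jet -/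

section JetNorm

/-- The contribution of level `k` to the norm which controls all derivatives up to order two. -/
def jetLevel (r ρ : ℝ≥0) (f : Series2) (k : ℕ) : ℝ≥0∞ :=
  (k : ℝ≥0∞) ^ 2 * ‖c2 f 0 k‖ₑ * (ρ : ℝ≥0∞) ^ k + (k : ℝ≥0∞) * ‖c2 f 1 k‖ₑ * (ρ : ℝ≥0∞) ^ k
    + ∑' i, ‖c2 (dz (dz f)) i k‖ₑ * (wt r ρ i k : ℝ≥0∞)

/-- The norm which controls all derivatives up to order two. -/
def jetNorm (r ρ : ℝ≥0) (f : Series2) : ℝ≥0∞ := ∑' k, jetLevel r ρ f k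

variable {r ρ τ : ℝ≥0}

theorem jetNorm_eq (f : Series2) : jetNorm r ρ f =
    ∑' k : ℕ, (k : ℝ≥0∞) ^ 2 * ‖c2 f 0 k‖ₑ * (ρ : ℝ≥0∞) ^ k +
    ∑' k : ℕ, (k : ℝ≥0∞) * ‖c2 f 1 k‖ₑ * (ρ : ℝ≥0∞) ^ k + N2 r ρ (dz (dz f)) := by
  rw [jetNorm, N2_eq, ← ENNReal.tsum_add, ← ENNReal.tsum_add]; rfl

variable {f : Series2}

theorem N2_dz_dz_le : N2 r ρ (dz (dz f)) ≤ jetNorm r ρ f := by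
  rw [jetNorm_eq]; exact le_add_self

theorem N2_th_dz_le (hr : r ≤ 1) : N2 r ρ (th (dz f)) ≤ jetNorm r ρ f := by
  refine (N2_th_le hr _).trans ?_
  rw [jetNorm_eq]
  refine add_le_add ?_ le_rfl
  simp only [c2_dz, CharP.cast_eq_zero, zero_add, one_mul]
  exact le_add_self

/-- `N2_th_le` is applied twice, trading each `w ∂_w` for `∂_z`; the two boundary terms are those
built into `jetNorm`. -/
theorem N2_th_th_le (hr : r ≤ 1) : N2 r ρ (th (th f)) ≤ jetNorm r ρ f := by
  refine (N2_th_le hr _).trans ?_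
  rw [jetNorm_eq, dz_th, add_assoc]
  refine add_le_add (ENNReal.tsum_le_tsum fun k => ?_) ?_
  · rw [c2_th, enorm_mul, enorm_natCast]
    exact le_of_eq (by ring)
  · refine (N2_th_le hr _).trans (add_le_add ?_ le_rfl)
    simp only [c2_dz, CharP.cast_eq_zero, zero_add, one_mul]
    exact le_rfl

theorem X_one_dvd_dz (hf : (X 1 : Series2) ∣ f) : (X 1 : Series2) ∣ dz f := by
  rw [← pow_one (X 1 : Series2)] at *; exact X_one_pow_dvd_dz hf

theorem N2_dz_le (hr : r ≤ 1) (hf : (X 1 : Series2) ∣ f) : N2 r ρ (dz f) ≤ jetNorm r ρ f :=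
  (N2_le_th (X_one_dvd_dz hf)).trans (N2_th_dz_le hr)

theorem N2_th_le_jetNorm (hr : r ≤ 1) : N2 r ρ (th f) ≤ jetNorm r ρ f :=
  (N2_le_th (dvd_mul_right _ _)).trans (N2_th_th_le hr)

theorem N2_le_jetNorm (hr : r ≤ 1) (hf : (X 1 : Series2) ∣ f) : N2 r ρ f ≤ jetNorm r ρ f :=
  (N2_le_th hf).trans (N2_th_le_jetNorm hr)

theorem N3_X_two_le : N3 r ρ τ (X 2) ≤ τ := by
  rw [N3, wnorm_X]; simp [W3, wt]

theorem N3_X_two_mul_le (hτ : τ ≤ 1) (A : Series3) : N3 r ρ τ (X 2 * A) ≤ N3 r ρ τ A := by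
  refine (wnorm_mul_le (isSubmul_W3 r ρ τ) _ _).trans ?_
  refine (mul_le_mul_left (N3_X_two_le.trans (ENNReal.coe_le_coe.2 hτ)) _).trans ?_
  simp [N3]

theorem N3_jet1_le (hr : r ≤ 1) (hτ : τ ≤ 1) (hf : (X 1 : Series2) ∣ f) :
    N3 r ρ τ (jet1 f) ≤ 4 * jetNorm r ρ f := by
  refine (wnorm_add_le _ _).trans ?_
  have h1 : N3 r ρ τ (lift (dz f)) ≤ jetNorm r ρ f := by rw [N3_lift]; exact N2_dz_le hr hf
  have h2 : N3 r ρ τ (X 2 * lift (th f)) ≤ jetNorm r ρ f :=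
    (N3_X_two_mul_le hτ _).trans (by rw [N3_lift]; exact N2_th_le_jetNorm hr)
  refine (add_le_add h1 h2).trans ?_
  rw [← two_mul]
  exact mul_le_mul_left (by norm_num) _

theorem N3_jet2_le (hr : r ≤ 1) (hτ : τ ≤ 1) : N3 r ρ τ (jet2 f) ≤ 4 * jetNorm r ρ f := by
  have h1 : N3 r ρ τ (lift (dz (dz f))) ≤ jetNorm r ρ f := by rw [N3_lift]; exact N2_dz_dz_le
  have h2 : N3 r ρ τ (X 2 * lift (th (dz f))) ≤ jetNorm r ρ f :=
    (N3_X_two_mul_le hτ _).trans (by rw [N3_lift]; exact N2_th_dz_le hr)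
  have h3 : N3 r ρ τ (X 2 * (X 2 * lift (th (th f)))) ≤ jetNorm r ρ f :=
    (N3_X_two_mul_le hτ _).trans ((N3_X_two_mul_le hτ _).trans
      (by rw [N3_lift]; exact N2_th_th_le hr))
  have h4 : jet2 f = lift (dz (dz f)) + (X 2 * lift (th (dz f)) + X 2 * lift (th (dz f)))
      + X 2 * (X 2 * lift (th (th f))) := by rw [jet2]; ring
  rw [h4]
  refine (wnorm_add_le _ _).trans (le_trans (add_le_add ((wnorm_add_le _ _).trans
    (add_le_add h1 ((wnorm_add_le _ _).trans (add_le_add h2 h2)))) h3) (le_of_eq ?_))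
  ring

theorem N3_jetVars_le (hr : r ≤ 1) (hτ : τ ≤ 1) {u : Series2} (hf : (X 1 : Series2) ∣ f)
    (hu : (X 1 : Series2) ∣ u) (i : Fin 11) (hi : 3 ≤ i) :
    wnorm (W3 r ρ τ) (jetVars f u i) ≤ 4 * (jetNorm r ρ f + jetNorm r ρ u) := by
  have h1 : ∀ a : ℝ≥0∞, a ≤ jetNorm r ρ f → a ≤ 4 * (jetNorm r ρ f + jetNorm r ρ u) := fun a ha =>
    (ha.trans le_self_add).trans (le_mul_of_one_le_left' (by norm_num))
  have h2 : ∀ a : ℝ≥0∞, a ≤ jetNorm r ρ u → a ≤ 4 * (jetNorm r ρ f + jetNorm r ρ u) := fun a ha =>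
    (ha.trans le_add_self).trans (le_mul_of_one_le_left' (by norm_num))
  have h3 : 4 * jetNorm r ρ f ≤ 4 * (jetNorm r ρ f + jetNorm r ρ u) :=
    mul_le_mul_right le_self_add _
  have h4 : 4 * jetNorm r ρ u ≤ 4 * (jetNorm r ρ f + jetNorm r ρ u) :=
    mul_le_mul_right le_add_self _
  have hl : ∀ g, wnorm (W3 r ρ τ) (lift g) = N2 r ρ g := N3_lift r ρ τ
  fin_cases i
  iterate 3 exact absurd hi (by decide)
  · exact h1 _ ((hl _).trans_le (N2_le_jetNorm hr hf))
  · exact (N3_jet1_le hr hτ hf).trans h3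
  · exact h1 _ ((hl _).trans_le (N2_th_le_jetNorm hr))
  · exact h2 _ ((hl _).trans_le (N2_le_jetNorm hr hu))
  · exact (N3_jet1_le hr hτ hu).trans h4
  · exact h2 _ ((hl _).trans_le (N2_th_le_jetNorm hr))
  · exact (N3_jet2_le hr hτ).trans h4
  · exact (N3_jet2_le hr hτ).trans h3

end JetNorm

/-! ### Finite weighted norm implies convergence -/

section ConvergenceOfNorms

/-- The binomial coefficient is at most `2 ^ (i + k)`, so halving the radii absorbs it. -/
theorem pow_le_wt {r ρ s : ℝ≥0} (hr : 2 * s ≤ r) (hρ : 2 * s ≤ ρ) (i k : ℕ) :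
    s ^ (i + k) ≤ wt r ρ i k := by
  have hp : (0 : ℝ≥0) < (i + k).choose i := by exact_mod_cast Nat.choose_pos (by omega)
  rw [wt, le_div_iff₀ hp]
  have h1 : (((i + k).choose i : ℕ) : ℝ≥0) ≤ 2 ^ (i + k) := by
    exact_mod_cast Nat.choose_le_two_pow _ _
  calc s ^ (i + k) * ((i + k).choose i) ≤ s ^ (i + k) * 2 ^ (i + k) := mul_le_mul_right h1 _
    _ = (2 * s) ^ i * (2 * s) ^ k := by rw [← mul_pow, mul_comm s, pow_add]
    _ ≤ r ^ i * ρ ^ k := mul_le_mul' (pow_le_pow_left' hr i) (pow_le_pow_left' hρ k)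

theorem convergent_of_N2 {r ρ : ℝ≥0} (hr : 0 < r) (hρ : 0 < ρ) {f : Series2}
    (h : N2 r ρ f ≠ ∞) : Convergent f := by
  refine (convergent_iff f).2 ⟨min r ρ / 2, by positivity, ne_top_of_le_ne_top h ?_⟩
  refine ENNReal.tsum_le_tsum fun d => mul_le_mul_right ?_ _
  rw [degWeight, W2, ← ENNReal.coe_pow, ENNReal.coe_le_coe, Finsupp.degree_eq_sum,
    Fin.sum_univ_two]
  have h2 : 2 * (min r ρ / 2) = min r ρ := mul_div_cancel₀ _ two_ne_zero
  exact pow_le_wt (h2.trans_le (min_le_left _ _)) (h2.trans_le (min_le_right _ _)) _ _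

theorem convergent_of_N3 {r ρ τ : ℝ≥0} (hr : 0 < r) (hρ : 0 < ρ) (hτ : 0 < τ) {A : Series3}
    (h : N3 r ρ τ A ≠ ∞) : Convergent A := by
  refine (convergent_iff A).2 ⟨min (min r ρ / 2) τ, by positivity, ne_top_of_le_ne_top h ?_⟩
  refine ENNReal.tsum_le_tsum fun d => mul_le_mul_right ?_ _
  rw [degWeight, W3, ← ENNReal.coe_pow, ← ENNReal.coe_pow, ← ENNReal.coe_mul, ENNReal.coe_le_coe,
    Finsupp.degree_eq_sum, Fin.sum_univ_three, pow_add]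
  have h2 : 2 * (min r ρ / 2) = min r ρ := mul_div_cancel₀ _ two_ne_zero
  refine mul_le_mul' ((pow_le_pow_left' (min_le_left _ _) _).trans ?_)
    (pow_le_pow_left' (min_le_right _ _) _)
  exact pow_le_wt (h2.trans_le (min_le_left _ _)) (h2.trans_le (min_le_right _ _)) _ _

end ConvergenceOfNorms

/-! ### Uniform bounds for the inverse level matrices -/

section MatrixBound

theorem norm_mul_le_of_le {c x : ℂ} {m : ℝ} (h : ‖x‖ ≤ m) : ‖c * x‖ ≤ ‖c‖ * m := by
  rw [norm_mul]; exact mul_le_mul_of_nonneg_left h (norm_nonneg _)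

/-- The level systems gain the factor `k ^ 2` for large `k`. -/
theorem levelMatrix_bound_of_large (Φ : Series3) : ∃ M : ℝ, 0 < M ∧ ∀ k : ℕ, 12 * M ≤ k →
    ∀ v b : Fin 4 → ℂ, (levelMatrix Φ k).mulVec v = b →
      (k : ℝ) ^ 2 * ‖v 0‖ + k * ‖v 1‖ + (k : ℝ) ^ 2 * ‖v 2‖ + k * ‖v 3‖ ≤
        6 * (‖b 0‖ + ‖b 1‖ / k + ‖b 2‖ + ‖b 3‖ / k) := by
  set α := fun j : ℕ => cf Φ j 0 2
  set β := fun j : ℕ => cf Φ j 0 3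
  set γ := fun j : ℕ => cf Φ j 0 4
  set B0 : ℝ := ‖α 0 - 1‖ + ‖3 * β 0‖ + ‖α 1‖ with hB0
  set B1 : ℝ := ‖(1 / 3) * α 1‖ + ‖α 0 - 1‖ + ‖β 1‖ + ‖(2 / 3) * α 2‖ + ‖(1 / 3) * α 1‖ with hB1
  set B2 : ℝ := ‖2 * β 0‖ + ‖1 - α 0‖ + ‖4 * γ 0‖ + ‖β 1‖ + ‖β 0‖ with hB2
  set B3 : ℝ := ‖2 * β 1‖ + ‖α 1‖ + ‖1 - α 0‖ + ‖4 * γ 1 + 2 * β 0 * (α 0 - 1)‖ + ‖2 * β 2‖ with hB3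
  have hB0' : 0 ≤ B0 := by positivity
  have hB1' : 0 ≤ B1 := by positivity
  have hB2' : 0 ≤ B2 := by positivity
  have hB3' : 0 ≤ B3 := by positivity
  set M : ℝ := 1 + B0 + B1 + B2 + B3 with hM
  have hM0 : 0 < M := by positivity
  refine ⟨M, hM0, fun k hk v b hb => ?_⟩
  have hk0 : (0 : ℝ) < k := by linarith
  have hk1 : (1 : ℝ) ≤ k := by linarith
  have hnk : ‖(k : ℂ)‖ = k := Complex.norm_natCast k
  have hA : (levelMatrix Φ k).mulVec v =
      (k : ℂ) ^ 2 • v - (k : ℂ) • (v + (TG Φ).mulVec v) - (TH Φ).mulVec v := by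
    simp [levelMatrix, Matrix.sub_mulVec, Matrix.smul_mulVec, Matrix.add_mulVec]
  rw [hA] at hb
  have e0 := congrFun hb 0
  have e1 := congrFun hb 1
  have e2 := congrFun hb 2
  have e3 := congrFun hb 3
  simp only [TG, TH, Matrix.mulVec, dotProduct, Fin.sum_univ_four,
    Pi.sub_apply, Pi.smul_apply, Pi.add_apply, smul_eq_mul] at e0 e1 e2 e3
  simp at e0 e1 e2 e3
  -- The left-hand side of the estimate is `k * m`, so error terms of size `M * m` can be absorbed
  -- for large `k`.
  set m : ℝ := k * ‖v 0‖ + ‖v 1‖ + k * ‖v 2‖ + ‖v 3‖ with hm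
  have n0 := norm_nonneg (v 0)
  have n1 := norm_nonneg (v 1)
  have n2 := norm_nonneg (v 2)
  have n3 := norm_nonneg (v 3)
  have p0 : 0 ≤ k * ‖v 0‖ := by positivity
  have p2 : 0 ≤ k * ‖v 2‖ := by positivity
  have hm0 : 0 ≤ m := by positivity
  have q2 : ‖v 2‖ ≤ k * ‖v 2‖ := le_mul_of_one_le_left n2 hk1
  have b1 : ‖v 1‖ ≤ m := by linarith
  have b2 : ‖v 2‖ ≤ m := by linarith
  have b3 : ‖v 3‖ ≤ m := by linarith
  have c0 : ‖(k : ℂ) * v 0‖ ≤ m := by rw [norm_mul, hnk]; linarith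
  have c2 : ‖(k : ℂ) * v 2‖ ≤ m := by rw [norm_mul, hnk]; linarith
  have hmk : m ≤ k * m := le_mul_of_one_le_left hm0 hk1
  have d0 := c0.trans hmk
  have d2 := c2.trans hmk
  have w1 := b1.trans hmk
  have w2 := b2.trans hmk
  have w3 := b3.trans hmk
  have d1 : ‖(k : ℂ) * v 1‖ ≤ k * m := by
    rw [norm_mul, hnk]; exact mul_le_mul_of_nonneg_left b1 hk0.le
  have d3 : ‖(k : ℂ) * v 3‖ ≤ k * m := by
    rw [norm_mul, hnk]; exact mul_le_mul_of_nonneg_left b3 hk0.le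
  have hle : ∀ B, B ≤ M → ∀ x, 0 ≤ x → B * x ≤ M * x := fun B hB x hx =>
    mul_le_mul_of_nonneg_right hB hx
  -- The coupling `2 k v₃` has the same order as the quantity to be bounded; it is kept explicit and
  -- estimated by the fourth row.
  have f0 : (k : ℝ) ^ 2 * ‖v 0‖ ≤ ‖b 0‖ + M * m + 2 * (k * ‖v 3‖) := by
    have h : (k : ℂ) ^ 2 * v 0 = b 0 + ((α 0 - 1) * (k * v 0) + 3 * β 0 * v 1 + α 1 * v 2)
        + 2 * (k * v 3) := by linear_combination e0
    have h1 : ‖(2 : ℂ) * (k * v 3)‖ = 2 * (k * ‖v 3‖) := by simp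
    have h2 : ‖(α 0 - 1) * (k * v 0) + 3 * β 0 * v 1 + α 1 * v 2‖ ≤ B0 * m :=
      (norm_add₃_le).trans ((add_le_add (add_le_add (norm_mul_le_of_le c0) (norm_mul_le_of_le b1))
        (norm_mul_le_of_le b2)).trans_eq (by rw [hB0]; ring))
    have h4 : ‖(k : ℂ) ^ 2 * v 0‖ = (k : ℝ) ^ 2 * ‖v 0‖ := by simp
    rw [← h4, h]
    refine (norm_add₃_le).trans ?_
    rw [h1]
    linarith [hle B0 (by linarith) m hm0]
  have f2 : (k : ℝ) ^ 2 * ‖v 2‖ ≤ ‖b 2‖ + M * m := by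
    have h : (k : ℂ) ^ 2 * v 2 = b 2 + (-(2 * β 0 * (k * v 0)) + (1 - α 0) * (k * v 2)
        + -(4 * γ 0 * v 1) + -(β 1 * v 2) + β 0 * v 3) := by linear_combination e2
    have h2 : ‖-(2 * β 0 * (k * v 0)) + (1 - α 0) * (k * v 2)
        + -(4 * γ 0 * v 1) + -(β 1 * v 2) + β 0 * v 3‖ ≤ B2 * m := by
      refine (norm_add_le_of_le (norm_add₄_le) le_rfl).trans ?_
      rw [norm_neg, norm_neg, norm_neg]
      exact (add_le_add (add_le_add (add_le_add (add_le_add (norm_mul_le_of_le c0)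
        (norm_mul_le_of_le c2)) (norm_mul_le_of_le b1)) (norm_mul_le_of_le b2))
        (norm_mul_le_of_le b3)).trans_eq (by rw [hB2]; ring)
    have h4 : ‖(k : ℂ) ^ 2 * v 2‖ = (k : ℝ) ^ 2 * ‖v 2‖ := by simp
    rw [← h4, h]
    refine (norm_add_le _ _).trans ?_
    linarith [hle B2 (by linarith) m hm0]
  have f1 : k * ‖v 1‖ ≤ ‖b 1‖ / k + M * m := by
    have h : (k : ℂ) ^ 2 * v 1 = b 1 + (-((1 / 3) * α 1 * (k * v 0)) + (α 0 - 1) * (k * v 1)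
        + -(β 1 * v 1) + -((2 / 3) * α 2 * v 2) + -((1 / 3) * α 1 * v 3)) := by
      linear_combination e1
    have h2 : ‖-((1 / 3) * α 1 * (k * v 0)) + (α 0 - 1) * (k * v 1)
        + -(β 1 * v 1) + -((2 / 3) * α 2 * v 2) + -((1 / 3) * α 1 * v 3)‖ ≤ B1 * (k * m) := by
      refine (norm_add_le_of_le (norm_add₄_le) le_rfl).trans ?_
      rw [norm_neg, norm_neg, norm_neg, norm_neg]
      exact (add_le_add (add_le_add (add_le_add (add_le_add (norm_mul_le_of_le d0)
        (norm_mul_le_of_le d1)) (norm_mul_le_of_le w1)) (norm_mul_le_of_le w2))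
        (norm_mul_le_of_le w3)).trans_eq (by rw [hB1]; ring)
    have h3 : (k : ℝ) ^ 2 * ‖v 1‖ ≤ ‖b 1‖ + M * (k * m) := by
      have h4 : ‖(k : ℂ) ^ 2 * v 1‖ = (k : ℝ) ^ 2 * ‖v 1‖ := by simp
      rw [← h4, h]
      refine (norm_add_le _ _).trans ?_
      linarith [hle B1 (by linarith) (k * m) (by positivity)]
    rw [div_add' _ _ _ hk0.ne', le_div_iff₀ hk0]
    linarith
  have f3 : k * ‖v 3‖ ≤ ‖b 3‖ / k + M * m := by
    have h : (k : ℂ) ^ 2 * v 3 = b 3 + (-(2 * β 1 * (k * v 0)) + -(α 1 * (k * v 2))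
        + (1 - α 0) * (k * v 3) + -((4 * γ 1 + 2 * β 0 * (α 0 - 1)) * v 1) + -(2 * β 2 * v 2)) := by
      linear_combination e3
    have h2 : ‖-(2 * β 1 * (k * v 0)) + -(α 1 * (k * v 2))
        + (1 - α 0) * (k * v 3) + -((4 * γ 1 + 2 * β 0 * (α 0 - 1)) * v 1) + -(2 * β 2 * v 2)‖ ≤
        B3 * (k * m) := by
      refine (norm_add_le_of_le (norm_add₄_le) le_rfl).trans ?_
      rw [norm_neg, norm_neg, norm_neg, norm_neg]
      exact (add_le_add (add_le_add (add_le_add (add_le_add (norm_mul_le_of_le d0)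
        (norm_mul_le_of_le d2)) (norm_mul_le_of_le d3)) (norm_mul_le_of_le w1))
        (norm_mul_le_of_le w2)).trans_eq (by rw [hB3]; ring)
    have h3 : (k : ℝ) ^ 2 * ‖v 3‖ ≤ ‖b 3‖ + M * (k * m) := by
      have h4 : ‖(k : ℂ) ^ 2 * v 3‖ = (k : ℝ) ^ 2 * ‖v 3‖ := by simp
      rw [← h4, h]
      refine (norm_add_le _ _).trans ?_
      linarith [hle B3 (by linarith) (k * m) (by positivity)]
    rw [div_add' _ _ _ hk0.ne', le_div_iff₀ hk0]
    linarith
  -- Adding the four rows, with the fourth counted three times, gives `k m ≤ 3 (…) + 6 M m`. Since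
  -- `12 M ≤ k`, half of the left side absorbs the error, whence the factor `6`.
  have hkm : 12 * M * m ≤ k * m := mul_le_mul_of_nonneg_right hk hm0
  have hkm' : k * m = (k : ℝ) ^ 2 * ‖v 0‖ + k * ‖v 1‖ + (k : ℝ) ^ 2 * ‖v 2‖ + k * ‖v 3‖ := by
    rw [hm]; ring
  have g0 := norm_nonneg (b 0)
  have g2 := norm_nonneg (b 2)
  have g1 : 0 ≤ ‖b 1‖ / k := by positivity
  linarith

/-- Large `k` are covered by dominance of `k²`. The finitely many remaining levels use injectivity
in finite dimension, where non-resonance enters. -/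
theorem exists_levelMatrix_bound {Φ : Series3} (hres : NonResonant Φ) :
    ∃ C : ℝ, 0 ≤ C ∧ ∀ k : ℕ, 0 < k → ∀ v b : Fin 4 → ℂ, (levelMatrix Φ k).mulVec v = b →
      (k : ℝ) ^ 2 * ‖v 0‖ + k * ‖v 1‖ + (k : ℝ) ^ 2 * ‖v 2‖ + k * ‖v 3‖ ≤
        C * (‖b 0‖ + ‖b 1‖ / k + ‖b 2‖ + ‖b 3‖ / k) := by
  have hsmall : ∀ k : ℕ, ∃ C : ℝ, 0 ≤ C ∧ (0 < k → ∀ v b : Fin 4 → ℂ,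
      (levelMatrix Φ k).mulVec v = b →
      (k : ℝ) ^ 2 * ‖v 0‖ + k * ‖v 1‖ + (k : ℝ) ^ 2 * ‖v 2‖ + k * ‖v 3‖ ≤
        C * (‖b 0‖ + ‖b 1‖ / k + ‖b 2‖ + ‖b 3‖ / k)) := by
    intro k
    rcases Nat.eq_zero_or_pos k with rfl | hk
    · exact ⟨0, le_rfl, fun h => absurd h (lt_irrefl _)⟩
    have hker : LinearMap.ker (Matrix.toLin' (levelMatrix Φ k)) = ⊥ :=
      LinearMap.ker_eq_bot'.2 fun v hv => levelMatrix_mulVec_injective hres hk hv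
    obtain ⟨K, hK, hlip⟩ := LinearMap.exists_antilipschitzWith _ hker
    -- Four summands, each with at most `k²` from the left side and one `k` from `‖b‖ ≤ k S`.
    refine ⟨4 * (k : ℝ) ^ 3 * K, by positivity, fun _ v b hb => ?_⟩
    have hv : ‖v‖ ≤ K * ‖b‖ := by
      have := hlip.le_mul_dist v 0
      rw [map_zero, dist_zero_right, dist_zero_right, Matrix.toLin'_apply, hb] at this
      exact this
    have hk1 : (1 : ℝ) ≤ k := by exact_mod_cast hk
    have hk0 : (0 : ℝ) < k := by linarith
    set S : ℝ := ‖b 0‖ + ‖b 1‖ / k + ‖b 2‖ + ‖b 3‖ / k with hS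
    have g0 := norm_nonneg (b 0)
    have g2 := norm_nonneg (b 2)
    have g1 : 0 ≤ ‖b 1‖ / k := by positivity
    have g3 : 0 ≤ ‖b 3‖ / k := by positivity
    have hS0 : 0 ≤ S := by positivity
    have hSk : S ≤ k * S := le_mul_of_one_le_left hS0 hk1
    have hb' : ‖b‖ ≤ k * S := by
      refine (pi_norm_le_iff_of_nonneg (by positivity)).2 fun i => ?_
      have e1 : ‖b 1‖ = k * (‖b 1‖ / k) := by field_simp
      have e3 : ‖b 3‖ = k * (‖b 3‖ / k) := by field_simp
      fin_cases i
      · change ‖b 0‖ ≤ _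
        linarith
      · change ‖b 1‖ ≤ _
        rw [e1]; exact mul_le_mul_of_nonneg_left (by linarith) hk0.le
      · change ‖b 2‖ ≤ _
        linarith
      · change ‖b 3‖ ≤ _
        rw [e3]; exact mul_le_mul_of_nonneg_left (by linarith) hk0.le
    have hv' : ∀ i, ‖v i‖ ≤ K * (k * S) := fun i =>
      (norm_le_pi_norm v i).trans (hv.trans (mul_le_mul_of_nonneg_left hb' K.2))
    have hkk : (k : ℝ) ≤ (k : ℝ) ^ 2 := by nlinarith
    have hx : ∀ i, (k : ℝ) ^ 2 * ‖v i‖ ≤ (k : ℝ) ^ 3 * K * S := fun i =>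
      (mul_le_mul_of_nonneg_left (hv' i) (by positivity)).trans_eq (by ring)
    have hy : ∀ i, (k : ℝ) * ‖v i‖ ≤ (k : ℝ) ^ 3 * K * S := fun i =>
      (mul_le_mul_of_nonneg_right hkk (norm_nonneg _)).trans (hx i)
    linarith [hx 0, hy 1, hx 2, hy 3]
  obtain ⟨M, hM, hlarge⟩ := levelMatrix_bound_of_large Φ
  choose C hC hsm using hsmall
  obtain ⟨K, hK⟩ := exists_nat_ge (12 * M)
  have hsum : 0 ≤ ∑ j ∈ Finset.range K, C j := Finset.sum_nonneg fun j _ => hC j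
  refine ⟨6 + ∑ j ∈ Finset.range K, C j, by positivity, fun k hk v b hb => ?_⟩
  have hS0 : 0 ≤ ‖b 0‖ + ‖b 1‖ / k + ‖b 2‖ + ‖b 3‖ / k := by positivity
  rcases lt_or_ge k K with hkK | hkK
  · refine (hsm k hk v b hb).trans (mul_le_mul_of_nonneg_right ?_ hS0)
    have := Finset.single_le_sum (f := C) (fun j _ => hC j) (Finset.mem_range.2 hkK)
    linarith
  · refine (hlarge k (hK.trans (by exact_mod_cast hkK)) v b hb).trans
      (mul_le_mul_of_nonneg_right (by linarith) hS0)

end MatrixBound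

/-! ### The linear estimate, uniform in `ρ` -/

section LinearEstimate

/-- The part of `R` which enters the system for the Cauchy data at level `k`. -/
def rhsSize (r ρ : ℝ≥0) (R : Series3) (k : ℕ) : ℝ≥0 :=
  ∑ c ∈ Finset.range 4, (‖cf R 0 k c‖₊ * wt r ρ 0 k + ‖cf R 1 k c‖₊ * wt r ρ 1 k)

/-- The factor `1/k` which the matrix bound puts on the second and fourth entries matches the weight
`r ρ^k / (k+1)` of `z w^k`. It also compensates the factor `k` in the term `2 k R_{0,k,1}` of
`levelRhs`. -/
theorem exists_cauchyData_bound {Φ : Series3} (hres : NonResonant Φ) {r : ℝ≥0} (hr0 : 0 < r)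
    (hr : r ≤ 1) : ∃ C : ℝ≥0, ∀ (ρ : ℝ≥0) (f u : Series2) (R : Series3) (k : ℕ), 0 < k →
      LevelEq Φ f u R k →
      (k ^ 2 * ‖c2 u 0 k‖₊ + k * ‖c2 u 1 k‖₊ + k ^ 2 * ‖c2 f 0 k‖₊ + k * ‖c2 f 1 k‖₊) * ρ ^ k ≤
        C * rhsSize r ρ R k := by
  obtain ⟨C, hC, hbound⟩ := exists_levelMatrix_bound hres
  set D : ℝ := 2 + 2 * ‖cf Φ 0 0 3‖ + 4 * ‖cf Φ 0 0 4‖ with hD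
  have hr0' : (0 : ℝ) < r := hr0
  refine ⟨⟨C * D / r, by positivity⟩, fun ρ f u R k hk h => ?_⟩
  have hb := hbound k hk _ _ ((levelEq_iff Φ f u R k).1 h).2.2
  have hk1 : (1 : ℝ) ≤ k := by exact_mod_cast hk
  have hk0 : (0 : ℝ) < k := by linarith
  set x : ℕ → ℝ := fun c => ‖cf R 0 k c‖ with hx
  set y : ℕ → ℝ := fun c => ‖cf R 1 k c‖ / (k + 1) with hy
  have hx0 : ∀ c, 0 ≤ x c := fun c => norm_nonneg _
  have hy0 : ∀ c, 0 ≤ y c := fun c => by simp only [hy]; positivity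
  have hyk : ∀ c, ‖cf R 1 k c‖ / k ≤ 2 * y c := fun c => by
    simp only [hy]
    rw [← mul_div_assoc, div_le_div_iff₀ hk0 (by linarith)]
    nlinarith [norm_nonneg (cf R 1 k c)]
  have hdk : ∀ a : ℝ, 0 ≤ a → a / k ≤ a := fun a ha => div_le_self ha hk1
  set T : ℝ := ∑ c ∈ Finset.range 4, (x c + y c) with hT
  have hT' : T = x 0 + y 0 + (x 1 + y 1) + (x 2 + y 2) + (x 3 + y 3) := by
    rw [hT]; simp [Finset.sum_range_succ]
  have r0 : ‖levelRhs Φ R k 0‖ = x 2 := rfl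
  have r2 : ‖levelRhs Φ R k 2‖ = x 3 := norm_neg _
  have r1 : ‖levelRhs Φ R k 1‖ / k ≤ 2 * y 2 + x 1 + ‖cf Φ 0 0 3‖ * x 0 := by
    have h1 : ‖levelRhs Φ R k 1‖ ≤ (‖cf R 1 k 2‖ + 2 * k * x 1 + 3 * ‖cf Φ 0 0 3‖ * x 0) / 3 := by
      change ‖-(cf R 1 k 2 - 2 * k * cf R 0 k 1 + 3 * cf Φ 0 0 3 * cf R 0 k 0) / 3‖ ≤ _
      rw [norm_div, norm_neg]
      have h3 : ‖(3 : ℂ)‖ = 3 := by simp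
      rw [h3]
      refine div_le_div_of_nonneg_right ((norm_add_le_of_le (norm_sub_le _ _) le_rfl).trans_eq ?_)
        (by norm_num)
      simp [hx]
    have h2 := hyk 2
    have h3 := hdk (‖cf Φ 0 0 3‖ * x 0) (mul_nonneg (norm_nonneg _) (hx0 0))
    have h4 : (‖cf R 1 k 2‖ + 2 * k * x 1 + 3 * ‖cf Φ 0 0 3‖ * x 0) / 3 / k =
      (1 / 3) * (‖cf R 1 k 2‖ / k) + (2 / 3) * x 1 + ‖cf Φ 0 0 3‖ * x 0 / k := by
        field_simp
    have h5 := div_le_div_of_nonneg_right h1 hk0.le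
    have := hx0 1
    have := hy0 2
    linarith
  have r3 : ‖levelRhs Φ R k 3‖ / k ≤ 2 * y 3 + ‖cf Φ 0 0 3‖ * x 1 + 4 * ‖cf Φ 0 0 4‖ * x 0 := by
    have h1 : ‖levelRhs Φ R k 3‖ ≤ ‖cf R 1 k 3‖ + ‖cf Φ 0 0 3‖ * x 1 + 4 * ‖cf Φ 0 0 4‖ * x 0 := by
      change ‖-(cf R 1 k 3 + cf Φ 0 0 3 * cf R 0 k 1 + 4 * cf Φ 0 0 4 * cf R 0 k 0)‖ ≤ _
      rw [norm_neg]
      refine (norm_add₃_le).trans_eq ?_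
      simp [hx]
    have h2 := hyk 3
    have h3 := hdk (‖cf Φ 0 0 3‖ * x 1) (mul_nonneg (norm_nonneg _) (hx0 1))
    have h4 := hdk (4 * ‖cf Φ 0 0 4‖ * x 0) (mul_nonneg (by positivity) (hx0 0))
    have h5 := div_le_div_of_nonneg_right h1 hk0.le
    rw [add_div, add_div] at h5
    linarith
  have hDT : ‖levelRhs Φ R k 0‖ + ‖levelRhs Φ R k 1‖ / k + ‖levelRhs Φ R k 2‖
      + ‖levelRhs Φ R k 3‖ / k ≤ D * T := by
    have hp : 0 ≤ ‖cf Φ 0 0 3‖ := norm_nonneg _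
    have hq : 0 ≤ ‖cf Φ 0 0 4‖ := norm_nonneg _
    have hT0 : x 0 ≤ T := by linarith [hx0 1, hx0 2, hx0 3, hy0 0, hy0 1, hy0 2, hy0 3]
    have hT1 : x 1 ≤ T := by linarith [hx0 0, hx0 2, hx0 3, hy0 0, hy0 1, hy0 2, hy0 3]
    have e1 := mul_le_mul_of_nonneg_left hT0 hp
    have e2 := mul_le_mul_of_nonneg_left hT1 hp
    have e3 := mul_le_mul_of_nonneg_left hT0 hq
    have : D * T = 2 * T + 2 * (‖cf Φ 0 0 3‖ * T) + 4 * (‖cf Φ 0 0 4‖ * T) := by rw [hD]; ring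
    linarith [hx0 0, hx0 1, hx0 2, hx0 3, hy0 0, hy0 1, hy0 2, hy0 3]
  rw [← NNReal.coe_le_coe]
  -- The weight of `z w^k` contains a factor `r`, absent from `T`; restoring it costs `1 / r`.
  have hTr : T * (ρ : ℝ) ^ k ≤ (rhsSize r ρ R k : ℝ) / r := by
    rw [le_div_iff₀ hr0', rhsSize, hT, Finset.sum_mul, Finset.sum_mul]
    push_cast
    refine Finset.sum_le_sum fun c _ => ?_
    rw [wt_zero, wt_one]
    push_cast
    have : x c * (ρ : ℝ) ^ k * r ≤ x c * (ρ : ℝ) ^ k :=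
      mul_le_of_le_one_right (mul_nonneg (hx0 c) (by positivity)) (by exact_mod_cast hr)
    calc (x c + y c) * (ρ : ℝ) ^ k * r = x c * (ρ : ℝ) ^ k * r + y c * (ρ : ℝ) ^ k * r := by ring
      _ ≤ x c * (ρ : ℝ) ^ k + y c * (ρ : ℝ) ^ k * r := by linarith
      _ = _ := by simp only [hx, hy]; ring
  push_cast
  change _ ≤ C * D / r * (rhsSize r ρ R k : ℝ)
  calc _ ≤ C * (D * T) * (ρ : ℝ) ^ k := by
        refine mul_le_mul_of_nonneg_right ?_ (by positivity)
        exact hb.trans (mul_le_mul_of_nonneg_left hDT hC)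
    _ = C * D * (T * (ρ : ℝ) ^ k) := by ring
    _ ≤ C * D * ((rhsSize r ρ R k : ℝ) / r) := mul_le_mul_of_nonneg_left hTr (by positivity)
    _ = _ := by ring

theorem tsum_rhsSize_le (r ρ : ℝ≥0) (R : Series3) :
    ∑' k, (rhsSize r ρ R k : ℝ≥0∞) ≤ ∑ c ∈ Finset.range 4, N2 r ρ (zc c R) := by
  simp only [rhsSize, ENNReal.ofNNReal_finsetSum]
  rw [Summable.tsum_finsetSum fun _ _ => ENNReal.summable]
  refine Finset.sum_le_sum fun c _ => ?_
  rw [N2_eq]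
  refine ENNReal.tsum_le_tsum fun k => ?_
  refine le_trans (le_of_eq ?_) (ENNReal.sum_le_tsum (Finset.range 2))
  rw [Finset.sum_range_succ, Finset.sum_range_one]
  push_cast
  rfl

/-- Extracting the coefficient of `ζ^c` costs `τ^(-c)`, here with `c ≤ 3`. -/
theorem sum_N2_zc_le {r ρ τ : ℝ≥0} (hτ0 : 0 < τ) (hτ : τ ≤ 1) (R : Series3) :
    ∑ c ∈ Finset.range 4, N2 r ρ (zc c R) ≤ ((4 / τ ^ 3 : ℝ≥0) : ℝ≥0∞) * N3 r ρ τ R := by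
  have h : ∀ c ∈ Finset.range 4, N2 r ρ (zc c R) ≤ ((1 / τ ^ 3 : ℝ≥0) : ℝ≥0∞) * N3 r ρ τ R := by
    intro c hc
    have hc' : c ≤ 3 := Nat.lt_succ_iff.1 (Finset.mem_range.1 hc)
    refine le_trans ?_ (mul_le_mul_right (N2_zc_le r ρ τ c R) _)
    rw [← mul_assoc]
    refine le_mul_of_one_le_left' ?_
    rw [← ENNReal.coe_pow, ← ENNReal.coe_mul, ← ENNReal.coe_one, ENNReal.coe_le_coe, one_div,
      ← div_eq_inv_mul, one_le_div (by positivity)]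
    exact pow_le_pow_of_le_one (zero_le) hτ hc'
  refine (Finset.sum_le_sum h).trans_eq ?_
  rw [Finset.sum_const, Finset.card_range, nsmul_eq_mul, ← mul_assoc]
  congr 1
  rw [show (4 / τ ^ 3 : ℝ≥0) = 4 * (1 / τ ^ 3) by rw [mul_one_div]]
  push_cast
  rfl

/-- The linear estimate: the constant does not depend on `ρ`. -/
theorem exists_jetNorm_bound {Φ : Series3} (hres : NonResonant Φ) {r τ a : ℝ≥0} (hr0 : 0 < r)
    (hr : r ≤ 1) (hτ0 : 0 < τ) (hτ : τ ≤ 1) (ha : ∀ ρ, N2 r ρ (ax Φ 2) ≤ a) :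
    ∃ C : ℝ≥0, ∀ (ρ : ℝ≥0) (f u : Series2) (R : Series3), (X 1 : Series2) ∣ f →
      (X 1 : Series2) ∣ u → (∀ k, 0 < k → LevelEq Φ f u R k) →
      jetNorm r ρ f + jetNorm r ρ u ≤ C * N3 r ρ τ R := by
  obtain ⟨C, hC⟩ := exists_cauchyData_bound hres hr0 hr
  -- The summands bound the Cauchy data by `C`, `u_zz` by `1`, and `f_zz` by the inner bracket; `4 /
  -- τ ^ 3` comes from extracting the four coefficients in `ζ`.
  refine ⟨(C + 1 + (1 + 2 * a * (C + 1) + 4 * (C + 1))) * (4 / τ ^ 3),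
    fun ρ f u R hf hu h => ?_⟩
  set S := ∑ c ∈ Finset.range 4, N2 r ρ (zc c R) with hS
  have hf0 := X_one_dvd_iff₂.1 hf
  have hu0 := X_one_dvd_iff₂.1 hu
  set Su0 := ∑' k : ℕ, (k : ℝ≥0∞) ^ 2 * ‖c2 u 0 k‖ₑ * (ρ : ℝ≥0∞) ^ k with hSu0
  set Su1 := ∑' k : ℕ, (k : ℝ≥0∞) * ‖c2 u 1 k‖ₑ * (ρ : ℝ≥0∞) ^ k with hSu1
  set Sf0 := ∑' k : ℕ, (k : ℝ≥0∞) ^ 2 * ‖c2 f 0 k‖ₑ * (ρ : ℝ≥0∞) ^ k with hSf0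
  set Sf1 := ∑' k : ℕ, (k : ℝ≥0∞) * ‖c2 f 1 k‖ₑ * (ρ : ℝ≥0∞) ^ k with hSf1
  have hD0 : Su0 + Su1 + Sf0 + Sf1 ≤ C * S := by
    rw [hSu0, hSu1, hSf0, hSf1, ← ENNReal.tsum_add, ← ENNReal.tsum_add, ← ENNReal.tsum_add]
    refine le_trans ?_ (mul_le_mul_right (tsum_rhsSize_le r ρ R) _)
    rw [← ENNReal.tsum_mul_left]
    refine ENNReal.tsum_le_tsum fun k => ?_
    rcases Nat.eq_zero_or_pos k with rfl | hk
    · simp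
    · refine le_trans (le_of_eq ?_) (ENNReal.coe_le_coe.2 (hC ρ f u R k hk (h k hk)))
      push_cast
      simp only [← enorm_eq_nnnorm]
      ring
  have hzc : ∀ c < 4, N2 r ρ (zc c R) ≤ S := fun c hc =>
    Finset.single_le_sum (f := fun c => N2 r ρ (zc c R)) (fun _ _ => zero_le)
      (Finset.mem_range.2 hc)
  have hu2 : N2 r ρ (dz (dz u)) ≤ S := by
    refine (N2_mono fun i k => ?_).trans (hzc 0 (by norm_num))
    rcases Nat.eq_zero_or_pos k with rfl | hk
    · rw [c2_dz, c2_dz, hu0]; simp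
    · have := (h k hk).1 i
      rw [lin0, c2_add, c2_neg, neg_add_eq_zero] at this
      rw [this]
  -- The restriction of `w ∂_w u_z` to `z = 0` belongs to the Cauchy data, and the rest is
  -- controlled by `u_zz`.
  have hu1 : N2 r ρ (th (dz u)) ≤ (C + 1) * S := by
    refine (N2_th_le hr _).trans ?_
    rw [add_mul, one_mul]
    refine add_le_add (le_trans ?_ hD0) hu2
    simp only [c2_dz, CharP.cast_eq_zero, zero_add, one_mul]
    exact le_add_self.trans (le_self_add.trans le_self_add)
  have hu1' : N2 r ρ (dz u) ≤ (C + 1) * S := (N2_le_th (X_one_dvd_dz hu)).trans hu1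
  -- The condition at `ζ^1` expresses `f_zz` by `R`, `u_z` and `w ∂_w u_z`, all already bounded.
  have hf2 : N2 r ρ (dz (dz f)) ≤ S + 2 * a * ((C + 1) * S) + 4 * ((C + 1) * S) := by
    have h1 : N2 r ρ (dz (dz f)) ≤ N2 r ρ (zc 1 R + 2 * (ax Φ 2 * dz u) - 2 * dz u
        - 2 * th (dz u)) := by
      refine N2_mono fun i k => ?_
      rcases Nat.eq_zero_or_pos k with rfl | hk
      · rw [c2_dz, c2_dz, hf0]; simp
      · have := (h k hk).2.1 i
        rw [lin1, c2_add, c2_add, c2_sub, c2_sub] at this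
        rw [c2_sub, c2_sub, c2_add, ← enorm_neg]
        refine le_of_eq (congrArg _ ?_)
        linear_combination -this
    have h2 : ∀ g, N2 r ρ (2 * g) ≤ 2 * N2 r ρ g := fun g => by
      rw [two_mul, two_mul]; exact wnorm_add_le _ _
    have h3 : N2 r ρ (ax Φ 2 * dz u) ≤ a * ((C + 1) * S) :=
      (wnorm_mul_le (isSubmul_W2 r ρ) _ _).trans (mul_le_mul' (ha ρ) hu1')
    refine h1.trans ?_
    refine (wnorm_sub_le _ _).trans (le_trans (add_le_add ((wnorm_sub_le _ _).trans (add_le_add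
      ((wnorm_add_le _ _).trans (add_le_add (hzc 1 (by norm_num))
        ((h2 _).trans (mul_le_mul_right h3 2))))
      ((h2 _).trans (mul_le_mul_right hu1' 2)))) ((h2 _).trans (mul_le_mul_right hu1 2)))
      (le_of_eq ?_))
    ring
  rw [jetNorm_eq, jetNorm_eq, ENNReal.coe_mul, mul_assoc]
  refine le_trans ?_ (mul_le_mul_right (sum_N2_zc_le hτ0 hτ R) _)
  push_cast
  calc _ = (Su0 + Su1 + Sf0 + Sf1) + N2 r ρ (dz (dz u)) + N2 r ρ (dz (dz f)) := by ring
    _ ≤ C * S + S + (S + 2 * a * ((C + 1) * S) + 4 * ((C + 1) * S)) :=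
        add_le_add (add_le_add hD0 hu2) hf2
    _ = _ := by ring

end LinearEstimate

/-! ### Convergence of the linear part -/

section ConvergentOperations

/-- Halving the radius gains `2^(-|d|)`, which outweighs the factor `d i + 1`. -/
theorem Convergent.pderiv {n : ℕ} {f : MvPowerSeries (Fin n) ℂ} (hf : Convergent f) (i : Fin n) :
    Convergent (MvPowerSeries.pderiv ℂ i f) := by
  obtain ⟨r, hr, h⟩ := (convergent_iff f).1 hf
  refine (convergent_iff _).2 ⟨r / 2, by positivity, ?_⟩
  have hle : wnorm (degWeight (Fin n) (r / 2)) (MvPowerSeries.pderiv ℂ i f) ≤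
      ((1 / r : ℝ≥0) : ℝ≥0∞) * wnorm (degWeight (Fin n) r) f := by
    rw [wnorm, wnorm]
    refine le_trans ?_ (mul_le_mul_right (ENNReal.tsum_comp_le_tsum_of_injective
      (add_left_injective (Finsupp.single i 1)) _) _)
    rw [← ENNReal.tsum_mul_left]
    refine ENNReal.tsum_le_tsum fun d => ?_
    have hd : (d i : ℝ≥0) + 1 ≤ 2 ^ d.degree := by
      have h1 : d i + 1 ≤ 2 ^ d.degree :=
        (Nat.succ_le_succ (Finsupp.le_degree i d)).trans Nat.lt_two_pow_self
      exact_mod_cast h1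
    have h2 : ((d i : ℝ≥0) + 1) * (r / 2) ^ d.degree ≤ 1 / r * r ^ (d.degree + 1) := by
      calc ((d i : ℝ≥0) + 1) * (r / 2) ^ d.degree ≤ 2 ^ d.degree * (r / 2) ^ d.degree :=
            mul_le_mul_left hd _
        _ = r ^ d.degree := by rw [← mul_pow, mul_div_cancel₀ _ two_ne_zero]
        _ = _ := by rw [pow_succ]; field_simp
    have h3 := ENNReal.coe_le_coe.2 h2
    simp only [ENNReal.coe_mul, ENNReal.coe_pow, ENNReal.coe_add, ENNReal.coe_natCast,
      ENNReal.coe_one] at h3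
    rw [MvPowerSeries.coeff_pderiv, enorm_mul, degWeight, degWeight]
    have h4 : ‖(d i : ℂ) + 1‖ₑ = (d i : ℝ≥0∞) + 1 := by
      have := enorm_natCast (d i + 1)
      push_cast at this
      exact this
    have h5 : (d + Finsupp.single i 1).degree = d.degree + 1 := by simp
    rw [h4, h5]
    calc _ = ‖coeff (d + Finsupp.single i 1) f‖ₑ * (((d i : ℝ≥0∞) + 1) *
          ((r / 2 : ℝ≥0) : ℝ≥0∞) ^ d.degree) := by ring
      _ ≤ ‖coeff (d + Finsupp.single i 1) f‖ₑ * (((1 / r : ℝ≥0) : ℝ≥0∞) *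
          (r : ℝ≥0∞) ^ (d.degree + 1)) := mul_le_mul_right h3 _
      _ = _ := by ring
  exact ne_top_of_le_ne_top (ENNReal.mul_ne_top ENNReal.coe_ne_top h) hle

theorem convergent_restrict {Φ : Series3} (hΦ : Convergent Φ) : Convergent (restrict Φ) := by
  obtain ⟨r, hr, h⟩ := (convergent_iff Φ).1 hΦ
  refine (convergent_iff _).2 ⟨r, hr, ne_top_of_le_ne_top h (wnorm_mono fun d => ?_)⟩
  rw [coeff_restrict]
  split_ifs
  · exact le_rfl
  · simp

theorem convergent_baseVars (i : Fin 3) : Convergent (baseVars i) := by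
  fin_cases i <;> exact Convergent.X _

theorem convergent_jetLinear {Φ : Series3} (hΦ : Convergent Φ) : Convergent (jetLinear Φ) := by
  have hX : ∀ i, Convergent (MvPowerSeries.X i : JetSeries) := Convergent.X
  have h2 : Convergent (2 : JetSeries) := by
    rw [← one_add_one_eq_two]; exact Convergent.one.add Convergent.one
  have hs : ∀ {A : Series3}, Convergent A → Convergent (MvPowerSeries.subst baseVars A) := fun hA =>
    hA.subst constantCoeff_baseVars convergent_baseVars
  have hr := convergent_restrict hΦ
  exact (((((hs hr).add (((hs hr).sub ((hX 2).pow 2)).mul (((h2.mul (hX 4)).add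
    ((hX 2).mul (hX 5))).sub (hX 8)))).add ((hX 3).mul (hs (hr.pderiv 0)))).add
    (((hs (hr.pderiv 2)).sub (h2.mul (hX 2))).mul ((hX 7).sub ((hX 2).mul (hX 4))))).sub
    (hX 9)).add ((hX 2).mul (hX 10))

/-- Only powers of `z` occur, with weights `r^i`, so the bound does not involve `ρ`; this lets `ρ`
be chosen after the constant of the linear estimate. -/
theorem N2_ax_le {r s : ℝ≥0} (hs : 0 < s) (hrs : r ≤ s) (ρ : ℝ≥0) (Φ : Series3) (c : ℕ) :
    N2 r ρ (ax Φ c) ≤ ((1 / s ^ c : ℝ≥0) : ℝ≥0∞) * wnorm (degWeight (Fin 3) s) Φ := by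
  rw [N2_eq, tsum_eq_single 0, wnorm]
  · have hinj : Function.Injective fun i => expo i 0 c := fun i j h => by
      simpa [expo_zero] using DFunLike.congr_fun h 0
    refine le_trans ?_ (mul_le_mul_right (ENNReal.tsum_comp_le_tsum_of_injective hinj _) _)
    rw [← ENNReal.tsum_mul_left]
    refine ENNReal.tsum_le_tsum fun i => ?_
    rw [c2_ax, if_pos rfl, wt_level_zero, degWeight]
    have h1 : (expo i 0 c).degree = i + c := by
      rw [Finsupp.degree_eq_sum, Fin.sum_univ_three]; rfl
    have h2 : r ^ i ≤ 1 / s ^ c * s ^ (i + c) := by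
      refine (pow_le_pow_left' hrs i).trans_eq ?_
      rw [pow_add]; field_simp
    have h3 := ENNReal.coe_le_coe.2 h2
    rw [ENNReal.coe_mul, ENNReal.coe_pow s] at h3
    rw [h1, mul_left_comm]
    exact mul_le_mul_right h3 _
  · intro k hk
    simp [c2_ax, hk]

end ConvergentOperations

/-! ### Truncations in `w` of the normalizing map -/

section Truncation

/-- The part of a series of degree less than `n` in `w`. -/
def trunc₃ (n : ℕ) (A : Series3) : Series3 := fun d => if d 1 < n then coeff d A else 0

theorem cf_trunc₃ (n : ℕ) (A : Series3) (i k c : ℕ) :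
    cf (trunc₃ n A) i k c = if k < n then cf A i k c else 0 := rfl

theorem N3_trunc₃_le (r ρ τ : ℝ≥0) (n : ℕ) (A : Series3) : N3 r ρ τ (trunc₃ n A) ≤ N3 r ρ τ A :=
  wnorm_mono fun d => by
    change ‖if d 1 < n then coeff d A else 0‖ₑ ≤ _
    split_ifs
    · exact le_rfl
    · simp

theorem levelEq_zero (Φ : Series3) (k : ℕ) : LevelEq Φ 0 0 0 k := by
  rw [levelEq_iff]
  refine ⟨fun i => by simp [c2_zero, cf_zero], fun i => ?_, ?_⟩
  · rw [c2_ax_mul]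
    simp [c2_zero, cf_zero, c2_dz]
  · have h1 : cauchyData 0 0 k = 0 := by
      ext i; fin_cases i <;> exact c2_zero _ _
    have h2 : levelRhs Φ 0 k = 0 := by
      ext i; fin_cases i <;> simp [levelRhs, cf_zero]
    rw [h1, h2, Matrix.mulVec_zero]

/-- By causality the nonlinear part up to degree `n` in `w` can be computed from the truncation
below `n`, so each truncation solves the linear problem with data from the preceding one. -/
theorem IsNormalizing.levelEq_truncW {Φ : Series3} {f u : Series2} (h : IsNormalizing Φ f u) (n : ℕ)
    {k : ℕ} (hk : 0 < k) : LevelEq Φ (truncW (n + 1) f) (truncW (n + 1) u)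
      (trunc₃ (n + 1) (nonlin Φ (truncW n f) (truncW n u))) k := by
  obtain ⟨hf, hu, hl⟩ := h
  have hag : ∀ m j, j < m → ∀ g : Series2, AgreeAt j g (truncW m g) := fun m j hj g i => by
    rw [c2_truncW, if_pos hj]
  by_cases hkn : k < n + 1
  · refine (hl k hk).congr (hag _ _ hkn f) (hag _ _ hkn u) fun i c => ?_
    rw [cf_trunc₃, if_pos hkn]
    exact cf_nonlin_congr Φ hf hu (X_one_dvd_truncW hf n) (X_one_dvd_truncW hu n)
      (fun j hj => hag n j hj f) (fun j hj => hag n j hj u) (Nat.lt_succ_iff.1 hkn) i c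
  · refine (levelEq_zero Φ k).congr (fun i => ?_) (fun i => ?_) fun i c => ?_
    · rw [c2_truncW, if_neg hkn, c2_zero]
    · rw [c2_truncW, if_neg hkn, c2_zero]
    · rw [cf_trunc₃, if_neg hkn, cf_zero]

theorem jetLevel_truncW {r ρ : ℝ≥0} (f : Series2) {n k : ℕ} (hk : k < n) :
    jetLevel r ρ (truncW n f) k = jetLevel r ρ f k := by
  simp only [jetLevel, c2_dz, c2_truncW, if_pos hk]

theorem jetNorm_truncW_zero (r ρ : ℝ≥0) (f : Series2) : jetNorm r ρ (truncW 0 f) = 0 := by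
  simp [jetNorm, jetLevel, c2_dz, c2_truncW]

/-- The norm is a sum of nonnegative contributions of the levels, and its partial sums are bounded
by norms of truncations. -/
theorem jetNorm_add_le_of_truncW {r ρ : ℝ≥0} {f u : Series2} {ε : ℝ≥0∞}
    (h : ∀ n, jetNorm r ρ (truncW n f) + jetNorm r ρ (truncW n u) ≤ ε) :
    jetNorm r ρ f + jetNorm r ρ u ≤ ε := by
  rw [jetNorm, jetNorm, ← ENNReal.tsum_add]
  refine ENNReal.tsum_le_of_sum_range_le fun n => le_trans ?_ (h n)
  rw [Finset.sum_add_distrib]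
  refine add_le_add ?_ ?_
  · rw [Finset.sum_congr rfl fun k hk => (jetLevel_truncW f (Finset.mem_range.1 hk)).symm]
    exact ENNReal.sum_le_tsum _
  · rw [Finset.sum_congr rfl fun k hk => (jetLevel_truncW u (Finset.mem_range.1 hk)).symm]
    exact ENNReal.sum_le_tsum _

end Truncation

/-! ### Convergence of the normalizing map and the normal form -/

section Convergence

theorem jetVars_zero (f u : Series2) : jetVars f u 0 = X 0 := by rw [jetVars]; rfl
theorem jetVars_one (f u : Series2) : jetVars f u 1 = X 1 := by rw [jetVars]; rfl
theorem jetVars_two (f u : Series2) : jetVars f u 2 = X 2 := by rw [jetVars]; rfl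

theorem wnorm_X_zero (r ρ τ : ℝ≥0) : wnorm (W3 r ρ τ) (X 0) = r := by
  rw [wnorm_X]; simp [W3, wt]

theorem wnorm_X_one (r ρ τ : ℝ≥0) : wnorm (W3 r ρ τ) (X 1) = ρ := by
  rw [wnorm_X]; simp [W3, wt]

theorem wnorm_X_two (r ρ τ : ℝ≥0) : wnorm (W3 r ρ τ) (X 2) = τ := by
  rw [wnorm_X]; simp [W3, wt]

/-- The formal solution is already known, so an a priori bound suffices and no contraction argument
is needed. Induction on the truncation shows that the jet norm stays below `R e / 4`: the remainder
has norm at most `A (s + e²)` with `s = e²`, and the linear estimate multiplies it by `C`. -/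
theorem IsNormalizing.convergent {Φ : Series3} (hres : NonResonant Φ) (hΦ : Convergent Φ)
    {f u : Series2} (h : IsNormalizing Φ f u) :
    Convergent f ∧ Convergent u ∧ Convergent (MvPowerSeries.subst (jetVars f u) (jetSource Φ)) := by
  obtain ⟨R₁, hR₁, hA₁, hB₁⟩ := (hΦ.jetSource.sub (convergent_jetLinear hΦ)).exists_wnorm₂ hΦ.jetSource
  obtain ⟨s, hs, hs'⟩ := (convergent_iff Φ).1 hΦ
  obtain ⟨hf, hu, -⟩ := id h
  set R := min R₁ 1 with hR
  have hR0 : 0 < R := lt_min hR₁ one_pos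
  have hR1 : R ≤ 1 := min_le_right _ _
  have hA : wnorm (degWeight (Fin 11) R) (jetSource Φ - jetLinear Φ) ≠ ∞ :=
    ne_top_of_le_ne_top hA₁ (wnorm_degWeight_mono (min_le_left _ _) _)
  have hB : wnorm (degWeight (Fin 11) R) (jetSource Φ) ≠ ∞ :=
    ne_top_of_le_ne_top hB₁ (wnorm_degWeight_mono (min_le_left _ _) _)
  obtain ⟨A, hA'⟩ : ∃ A : ℝ≥0, (A : ℝ≥0∞) = _ := ⟨_, ENNReal.coe_toNNReal hA⟩
  obtain ⟨a, ha'⟩ : ∃ a : ℝ≥0, (a : ℝ≥0∞) = _ :=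
    ⟨_, ENNReal.coe_toNNReal (ENNReal.mul_ne_top (ENNReal.coe_ne_top (r := 1 / s ^ 2)) hs')⟩
  set r := min R s with hr
  have hr0 : 0 < r := lt_min hR0 hs
  have hrR : r ≤ R := min_le_left _ _
  obtain ⟨C, hC⟩ := exists_jetNorm_bound hres (a := a) hr0 (hrR.trans hR1) hR0 hR1 fun ρ =>
    (N2_ax_le hs (min_le_right _ _) ρ Φ 2).trans_eq ha'.symm
  -- Chosen so that `2 C A e² ≤ R e / 4`; the `+ 1` keeps the denominator positive and gives `e ≤
  -- 1`.
  set e : ℝ≥0 := R / (8 * (C * A + 1)) with he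
  have he0 : 0 < e := by positivity
  have he1 : e ≤ 1 := by
    rw [he]
    refine div_le_one_of_le₀ (hR1.trans ?_) (zero_le)
    rw [mul_add, mul_one]
    exact le_trans (by norm_num) le_add_self
  have he2 : e ^ 2 ≤ 1 := pow_le_one' he1 2
  -- A factor `w` is thereby as small, relative to `R`, as a product of two jets. This is possible
  -- because `C` and `A` were fixed independently of `ρ`.
  set ρ : ℝ≥0 := R * e ^ 2 with hρ
  have hρ0 : 0 < ρ := by positivity
  have hsmall : C * (A * (e ^ 2 + e ^ 2)) ≤ R * e / 4 := by
    have h1 : (8 * (C * A + 1)) * e = R := by rw [he]; field_simp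
    rw [← NNReal.coe_le_coe]
    have h1' : ((8 * (C * A + 1)) * e : ℝ) = R := by exact_mod_cast congrArg NNReal.toReal h1
    push_cast
    rw [← h1']
    have : (0 : ℝ) ≤ e := e.2
    nlinarith [sq_nonneg (e : ℝ)]
  -- The factor `4` from `N3_jetVars_le` cancels the `4` in the bound `R e / 4`, so every jet
  -- variable has norm at most `R e`.
  have hjet : ∀ {g v : Series2}, (X 1 : Series2) ∣ g → (X 1 : Series2) ∣ v →
      jetNorm r ρ g + jetNorm r ρ v ≤ ((R * e / 4 : ℝ≥0) : ℝ≥0∞) → ∀ i : Fin 11, 3 ≤ i →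
      wnorm (W3 r ρ R) (jetVars g v i) ≤ (R : ℝ≥0∞) * e := by
    intro g v hg hv hgv i hi
    refine (N3_jetVars_le (hrR.trans hR1) hR1 hg hv i hi).trans ((mul_le_mul_right hgv 4).trans ?_)
    have h4 : (4 : ℝ≥0∞) = ((4 : ℝ≥0) : ℝ≥0∞) := rfl
    rw [h4, ← ENNReal.coe_mul, ← ENNReal.coe_mul, ENNReal.coe_le_coe,
      mul_div_cancel₀ _ (by norm_num : (4 : ℝ≥0) ≠ 0)]
  have hbase : ∀ g v : Series2, wnorm (W3 r ρ R) (jetVars g v 0) ≤ R ∧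
      wnorm (W3 r ρ R) (jetVars g v 1) ≤ (R : ℝ≥0∞) * ((e ^ 2 : ℝ≥0) : ℝ≥0∞) ∧
      wnorm (W3 r ρ R) (jetVars g v 2) ≤ R := by
    intro g v
    rw [jetVars_zero, jetVars_one, jetVars_two, wnorm_X_zero, wnorm_X_one, wnorm_X_two]
    exact ⟨ENNReal.coe_le_coe.2 hrR, by rw [← ENNReal.coe_mul], le_rfl⟩
  have hbound : ∀ n, jetNorm r ρ (truncW n f) + jetNorm r ρ (truncW n u) ≤
      ((R * e / 4 : ℝ≥0) : ℝ≥0∞) := by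
    intro n
    induction n with
    | zero => rw [jetNorm_truncW_zero, jetNorm_truncW_zero, add_zero]; exact zero_le
    | succ n ih =>
      have hfn := X_one_dvd_truncW hf n
      have hun := X_one_dvd_truncW hu n
      obtain ⟨b0, b1, b2⟩ := hbase (truncW n f) (truncW n u)
      refine (hC ρ _ _ _ (X_one_dvd_truncW hf _) (X_one_dvd_truncW hu _)
        fun k hk => h.levelEq_truncW n hk).trans ?_
      refine (mul_le_mul_right ((N3_trunc₃_le _ _ _ _ _).trans
        (wnorm_subst_nonlin_le (isSubmul_W3 r ρ R) (hasSubst_jetVars hfn hun) he2 he1 b0 b1 b2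
          (hjet hfn hun ih) (jetSource_sub_jetLinear_mem Φ))) _).trans ?_
      rw [← hA', ← ENNReal.coe_pow, ← ENNReal.coe_add, ← ENNReal.coe_mul, ← ENNReal.coe_mul,
        ENNReal.coe_le_coe]
      exact hsmall
  have hfin := jetNorm_add_le_of_truncW hbound
  have hfin' : jetNorm r ρ f + jetNorm r ρ u ≠ ∞ := ne_top_of_le_ne_top ENNReal.coe_ne_top hfin
  rw [ENNReal.add_ne_top] at hfin'
  refine ⟨convergent_of_N2 hr0 hρ0 (ne_top_of_le_ne_top hfin'.1 (N2_le_jetNorm (hrR.trans hR1) hf)),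
    convergent_of_N2 hr0 hρ0 (ne_top_of_le_ne_top hfin'.2 (N2_le_jetNorm (hrR.trans hR1) hu)),
    convergent_of_N3 hr0 hρ0 hR0 (ne_top_of_le_ne_top hB (wnorm_subst_le_of_le
      (isSubmul_W3 r ρ R) (hasSubst_jetVars hf hu) (fun i => ?_) _))⟩
  obtain ⟨b0, b1, b2⟩ := hbase f u
  by_cases hi : 3 ≤ i
  · exact (hjet hf hu hfin i hi).trans (mul_le_of_le_one_right' (by exact_mod_cast he1))
  · fin_cases i
    · exact b0
    · exact b1.trans (mul_le_of_le_one_right' (by exact_mod_cast he2))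
    · exact b2
    all_goals exact absurd (by decide) hi

end Convergence

theorem exists_normalForm {Φ : Series3} (hΦ : Φ ∈ ODE1) (hres : NonResonant Φ) :
    ∃ (N : Series3) (H : Series2 × Series2), N ∈ NF1 ∧
      (∀ N' ∈ NF1, (Hom N' Φ).Nonempty → N' = N) ∧ Hom N Φ = {H} ∧
      (Convergent Φ → Convergent N ∧ Convergent H.1 ∧ Convergent H.2) := by
  obtain ⟨f, u, h⟩ := exists_isNormalizing hres
  -- Any map from any normal form gives a solution of the same level equations, so one uniqueness
  -- argument identifies both the map and its source.
  have key : ∀ N' ∈ NF1, ∀ H' ∈ Hom N' Φ, N' = subst (jetVars f u) (jetSource Φ) ∧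
      H' = (X 0 + f, X 1 * (1 + u)) := by
    rintro N' hN' ⟨F, G⟩ hH
    obtain ⟨f', u', hf', hu', rfl, rfl⟩ := exists_of_mem_hom hN'.1 hΦ hH
    have hN := (transforms_iff hf' hu').1 hH.2
    have hn : IsNormalizing Φ f' u' := (mem_NF1_iff hΦ hf' hu').1 (hN ▸ hN')
    obtain ⟨rfl, rfl⟩ := hn.unique hres h
    exact ⟨hN, rfl⟩
  have hmem : subst (jetVars f u) (jetSource Φ) ∈ NF1 := (mem_NF1_iff hΦ h.1 h.2.1).2 h
  refine ⟨subst (jetVars f u) (jetSource Φ), (X 0 + f, X 1 * (1 + u)), hmem,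
    fun N' hN' ⟨H', hH'⟩ => (key N' hN' H' hH').1, Set.Subset.antisymm
      (fun H' hH' => (key _ hmem H' hH').2) ?_, fun hc => ?_⟩
  · rw [Set.singleton_subset_iff]
    exact ⟨normalized_of_dvd h.1 h.2.1, (transforms_iff h.1 h.2.1).2 rfl⟩
  · obtain ⟨h1, h2, h3⟩ := h.convergent hres hc
    exact ⟨h3, (Convergent.X 0).add h1, (Convergent.X 1).mul (Convergent.one.add h2)⟩

end SingODE
end

theorem mainTheorem10 (Φ : SingODE.Series3) (hΦ : Φ ∈ SingODE.ODE1)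
    (hres : SingODE.NonResonant Φ) :
    ∃ (N : SingODE.Series3) (H : SingODE.Series2 × SingODE.Series2),
      N ∈ SingODE.NF1 ∧
      (∀ N' ∈ SingODE.NF1, (SingODE.Hom N' Φ).Nonempty → N' = N) ∧
      SingODE.Hom N Φ = {H} ∧
      (SingODE.Convergent Φ →
        SingODE.Convergent N ∧ SingODE.Convergent H.1 ∧ SingODE.Convergent H.2) :=
  SingODE.exists_normalForm hΦ hres
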